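/- **Setting.** Let $\Omega\subset\mathbb R^2$ be a bounded simply connected domain with $C^{2,1}$ boundary and outward unit normal $n$, let $\mathbb D$ be the open unit disc, and let $\varphi:\overline\Omega\to\overline{\mathbb D}$ be a conformal mapping: $\varphi$ is $C^2$ up to the boundary, holomorphic in $\Omega$ (with $\mathbb R^2\cong\mathbb C$), and maps $\Omega$ one to one onto $\mathbb D$ and $\partial\Omega$ one to one onto $\partial\mathbb D$. For $x\in\Omega$, $y\in\overline\Omega$, $y\ne x$, define the pull-back Green's function $$N(x,y)=\frac1{2\pi}\Big(\ln|\varphi(x)-\varphi(y)|+\ln\Big||\varphi(x)|\varphi(y)-\frac{\varphi(x)}{|\varphi(x)|}\Big|\Big),$$ where the second logarithm is $0$ (its continuous extension) if $\varphi(x)=0$. Let $T>0$, $t\in(0,T)$ and $q>2$. Let $\rho$ (scalar) and $u$ (vector valued) be continuous on $[0,T]\times\overline\Omega$, and have time derivatives $\rho_t$, $u_t$ at time $t$ as limits of difference quotients in $L^q(\Omega)$, with $u_t$ continuous on $\overline\Omega$; let $u(t,\cdot)\in C^1(\overline\Omega)$, and let $H$ be a vector field with $H(t,\cdot)\in C^1(\overline\Omega)$.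 Write $\dot u=u_t+u\cdot\nabla u$ and $\frac{D}{Dt}=\partial_t+u\cdot\nabla$. Everything below is taken at time $t$. **Statement.** Let $F\in C^1(\overline\Omega)\cap C^2(\Omega)$ solve the Neumann problem $$\Delta F=\operatorname{div}(\rho\dot u-H\cdot\nabla H)\ \text{ in }\Omega,\qquad \frac{\partial F}{\partial n}=(\rho\dot u-H\cdot\nabla H)\cdot n\ \text{ on }\partial\Omega,$$ the divergence being understood in the sense of distributions. Then for every $x\in\Omega$ $$F(x)=-\int_\Omega\nabla_yN(x,y)\cdot(\rho\dot u-H\cdot\nabla H)(y)\,dy+\int_{\partial\Omega}\frac{\partial N}{\partial n}(x,y)F(y)\,dS_y,$$ where both integrals converge absolutely and $\partial N/\partial n$ is the outward normal derivative in $y$. If, moreover, the continuity equation $\rho_t+\operatorname{div}(\rho u)=0$ holds in $\Omega$ at time $t$ in the sense of distributions and $u\cdot n=0$ on $\partial\Omega$, then for every $x\in\Omega$ $$F(x)=-\frac{D}{Dt}F_0+F_1+F_2+F_3,$$ with (summing over repeated indices) $$F_0=\int_\Omega\partial_{y_j}N(x,y)\,\rho u_j(y)\,dy,$$ $$F_1=\int_\Omega\big[\partial_{x_i}\partial_{y_j}N(x,y)\,u_i(x)+\partial_{y_i}\partial_{y_j}N(x,y)\,u_i(y)\big]\rho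 u_j(y)\,dy,$$ $$F_2=\int_\Omega\nabla_yN(x,y)\cdot(H\cdot\nabla H)(y)\,dy,\qquad F_3=\int_{\partial\Omega}\frac{\partial N}{\partial n}(x,y)F(y)\,dS_y.$$ Here all the integrals converge absolutely (that of $F_0$ at every time in $[0,T]$), and $F_0$, as a function of time and space, is differentiable in time at $t$ and in space at $x$. -/

import Mathlib

open MeasureTheory Set Filter Topology
open scoped ENNReal NNReal ContDiff

/-! The plane `ℝ²` is identified with `ℂ` (same norm, same real inner product, same Lebesgue
measure), so that vector fields are functions `ℂ → ℂ` and conformal maps are holomorphic functions.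
For a scalar function `g`, the number `fderiv ℝ g y v` is `∇g(y) · v`. -/

namespace MHD

noncomputable section

/-- The boundary of `Ω` is of class `C^{2,1}`: near each boundary point, in suitable Cartesian
coordinates `(s, τ)` centred at that point, `Ω` is the region `τ > h s` above the graph of a
function `h` whose second derivative exists and is Lipschitz continuous. -/
def HasC21Boundary (Ω : Set ℂ) : Prop :=
  ∀ p ∈ frontier Ω, ∃ (e : ℂ) (r : ℝ) (h : ℝ → ℝ) (K : ℝ≥0), ‖e‖ = 1 ∧ 0 < r ∧
    ContDiffOn ℝ 2 h (Ioo (-r) r) ∧ LipschitzOnWith K (iteratedDeriv 2 h) (Ioo (-r) r) ∧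
    ∀ z : ℂ, ‖z‖ < r → (p + e * z ∈ Ω ↔ h z.re < z.im)

/-- Bounded simply connected domains with `C^{2,1}` boundary. -/
structure IsC21Domain (Ω : Set ℂ) : Prop where
  isOpen : IsOpen Ω
  isBounded : Bornology.IsBounded Ω
  simplyConnected : SimplyConnectedSpace Ω
  boundary : HasC21Boundary Ω

/-- `ν` is the outward unit normal of `Ω` at the boundary point `p`: up to `o(‖z - p‖)`, the
points `z` of `Ω` lie in the half plane `ν · (z - p) ≤ 0` and the points outside `Ω` in the
opposite one. -/
def IsOuterUnitNormal (Ω : Set ℂ) (p ν : ℂ) : Prop :=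
  ‖ν‖ = 1 ∧ ∀ ε : ℝ, 0 < ε →
    (∀ᶠ z in 𝓝[Ω] p, inner ℝ ν (z - p) ≤ ε * ‖z - p‖) ∧
    (∀ᶠ z in 𝓝[Ωᶜ] p, -(ε * ‖z - p‖) ≤ inner ℝ ν (z - p))

/-- A conformal mapping `φ` of `closure Ω` onto the closed unit disc: it is `C²` up to the
boundary, holomorphic in `Ω`, and maps `Ω` and `∂Ω` one to one onto the open unit disc and the
unit circle. -/
structure IsConformalOntoDisc (Ω : Set ℂ) (φ : ℂ → ℂ) : Prop where
  contDiffOn : ContDiffOn ℝ 2 φ (closure Ω)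
  holomorphic : DifferentiableOn ℂ φ Ω
  bijOn_interior : BijOn φ Ω (Metric.ball 0 1)
  bijOn_boundary : BijOn φ (frontier Ω) (Metric.sphere 0 1)

/-- The pull-back Green's function
`N(x, y) = (1/2π) (ln |φ(x) - φ(y)| + ln | |φ(x)| φ(y) - φ(x)/|φ(x)| |)`. For `φ(x) = 0` the
second logarithm is `0`, by the conventions `0 / 0 = 0` and `log 0 = 0`; this is its continuous
extension, because `| |a| b - a/|a| | = |1 - conj(a) b|` for `a ≠ 0`. -/
def pullbackGreen (φ : ℂ → ℂ) (x y : ℂ) : ℝ :=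
  (2 * Real.pi)⁻¹ *
    (Real.log ‖φ x - φ y‖ + Real.log ‖(‖φ x‖ : ℂ) * φ y - φ x / (‖φ x‖ : ℂ)‖)

/-- `div f = g` in `Ω` in the sense of distributions. -/
def HasDivIn (Ω : Set ℂ) (f : ℂ → ℂ) (g : ℂ → ℝ) : Prop :=
  ∀ ψ : ℂ → ℝ, ContDiff ℝ ∞ ψ → HasCompactSupport ψ → tsupport ψ ⊆ Ω →
    ∫ y in Ω, g y * ψ y = -∫ y in Ω, fderiv ℝ ψ y (f y)

/-- The derivative of `g` at `y` in the direction `v`, with one-sided values at the boundary: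
`(v · ∇) g (y)`. -/
def dirDeriv {E : Type*} [NormedAddCommGroup E] [NormedSpace ℝ E]
    (Ω : Set ℂ) (g : ℂ → E) (y v : ℂ) : E :=
  fderivWithin ℝ g (closure Ω) y v

/-- `F ∈ C¹(closure Ω) ∩ C²(Ω)` solves `ΔF = div f` in `Ω`, `∂F/∂n = f · n` on `∂Ω`. -/
structure SolvesNeumann (Ω : Set ℂ) (n : ℂ → ℂ) (f : ℂ → ℂ) (F : ℂ → ℝ) : Prop where
  contDiffOn_closure : ContDiffOn ℝ 1 F (closure Ω)
  contDiffOn : ContDiffOn ℝ 2 F Ω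
  equation : HasDivIn Ω f (Laplacian.laplacian F)
  flux : ∀ y ∈ frontier Ω, dirDeriv Ω F y (n y) = inner ℝ (f y) (n y)

/-- `g'` is the time derivative of `g` at time `t`, as a limit of difference quotients in
`L^q(Ω)`. -/
def HasTimeDerivAt {E : Type*} [NormedAddCommGroup E] [NormedSpace ℝ E]
    (Ω : Set ℂ) (q : ℝ≥0∞) (g : ℝ → ℂ → E) (g' : ℂ → E) (t : ℝ) : Prop :=
  MemLp g' q (volume.restrict Ω) ∧
    Tendsto (fun s => eLpNorm (fun y => (s - t)⁻¹ • (g s y - g t y) - g' y) q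
      (volume.restrict Ω)) (𝓝[≠] t) (𝓝 0)

/-- The material derivative `u̇ = u_t + u · ∇u` at a fixed time (`ut` is the value of `u_t`). -/
def uDot (Ω : Set ℂ) (u ut : ℂ → ℂ) (y : ℂ) : ℂ :=
  ut y + dirDeriv Ω u y (u y)

/-- The field `H · ∇H` at a fixed time. -/
def advect (Ω : Set ℂ) (H : ℂ → ℂ) (y : ℂ) : ℂ :=
  dirDeriv Ω H y (H y)

/-- The field `ρ u̇ - H · ∇H` at a fixed time. -/
def force (Ω : Set ℂ) (ρ : ℂ → ℝ) (u ut H : ℂ → ℂ) (y : ℂ) : ℂ :=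
  ρ y • uDot Ω u ut y - advect Ω H y

/-- The material derivative `DG/Dt = ∂_t G + u · ∇G` of a scalar function `G(t, x)`. -/
def materialDeriv (u : ℝ → ℂ → ℂ) (G : ℝ → ℂ → ℝ) (t : ℝ) (x : ℂ) : ℝ :=
  deriv (fun s => G s x) t + fderiv ℝ (G t) x (u t x)

/-- The integrand `∂_{y_j} N(x, y) ρ u_j(y)` of `F₀`. -/
def kernel0 (φ : ℂ → ℂ) (ρ : ℂ → ℝ) (u : ℂ → ℂ) (x y : ℂ) : ℝ :=
  fderiv ℝ (pullbackGreen φ x) y (ρ y • u y)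

/-- `F₀(x) = ∫ ∂_{y_j} N(x, y) ρ u_j(y) dy`. -/
def F0 (Ω : Set ℂ) (φ : ℂ → ℂ) (ρ : ℂ → ℝ) (u : ℂ → ℂ) (x : ℂ) : ℝ :=
  ∫ y in Ω, kernel0 φ ρ u x y

/-- The integrand
`[∂_{x_i} ∂_{y_j} N(x, y) u_i(x) + ∂_{y_i} ∂_{y_j} N(x, y) u_i(y)] ρ u_j(y)` of `F₁`: the sums over
`j` and `i` are the directional derivatives along the fixed vectors `ρ u (y)`, and `u (x)` resp.
`u (y)`. -/
def kernel1 (φ : ℂ → ℂ) (ρ : ℂ → ℝ) (u : ℂ → ℂ) (x y : ℂ) : ℝ :=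
  fderiv ℝ (fun x' => fderiv ℝ (pullbackGreen φ x') y (ρ y • u y)) x (u x) +
    fderiv ℝ (fun y' => fderiv ℝ (pullbackGreen φ x) y' (ρ y • u y)) y (u y)

/-- `F₁(x) = ∫ [∂_{x_i} ∂_{y_j} N u_i(x) + ∂_{y_i} ∂_{y_j} N u_i(y)] ρ u_j(y) dy`. -/
def F1 (Ω : Set ℂ) (φ : ℂ → ℂ) (ρ : ℂ → ℝ) (u : ℂ → ℂ) (x : ℂ) : ℝ :=
  ∫ y in Ω, kernel1 φ ρ u x y

/-- The integrand `∇_y N(x, y) · (H · ∇H)(y)` of `F₂`. -/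
def kernel2 (Ω : Set ℂ) (φ : ℂ → ℂ) (H : ℂ → ℂ) (x y : ℂ) : ℝ :=
  fderiv ℝ (pullbackGreen φ x) y (advect Ω H y)

/-- `F₂(x) = ∫ ∇_y N(x, y) · (H · ∇H)(y) dy`. -/
def F2 (Ω : Set ℂ) (φ : ℂ → ℂ) (H : ℂ → ℂ) (x : ℂ) : ℝ :=
  ∫ y in Ω, kernel2 Ω φ H x y

/-- The boundary integrand `∂N/∂n (x, y) F(y)` of `F₃`. -/
def kernel3 (Ω : Set ℂ) (n φ : ℂ → ℂ) (F : ℂ → ℝ) (x y : ℂ) : ℝ :=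
  dirDeriv Ω (pullbackGreen φ x) y (n y) * F y

/-- `F₃(x) = ∫_{∂Ω} ∂N/∂n (x, y) F(y) dS_y`, with respect to arc length. -/
def F3 (Ω : Set ℂ) (n φ : ℂ → ℂ) (F : ℂ → ℝ) (x : ℂ) : ℝ :=
  ∫ y in frontier Ω, kernel3 Ω n φ F x y ∂(Measure.hausdorffMeasure 1)

end

end MHD

namespace MHD

noncomputable section

/-! Put `z = φ y` and `a = φ x`. Up to a unimodular factor inside the second logarithm, `2πN = log|z
- a| + log|1 - conj(a) z|` (`pullbackGreen_eq`). This is a Neumann function of the disc: it has a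
unit source at `a`, and its normal derivative on the circle is the constant `1/2π`
(`re_discKernel_mul_self`). Pulled back to `Ω`, `∂N/∂n = |φ'|/2π`, so the boundary integral in the
theorem is the mean of `F ∘ φ⁻¹` over the circle.

Representation formula. For `F` of class `C¹` up to the boundary, `∫ ∇N · ∇F` equals that mean minus
`F(x)`. This is proved in the disc (`integral_fderiv_discKernel`) and carried to `Ω` by conformal
invariance of the Dirichlet pairing. With `f = ρu̇ - H·∇H`, the field `∇F - f` is divergence free in
`Ω` and tangential on the boundary, so it pairs to zero with `∇N`, and `∇F` may be replaced by `f`.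

The tool is `IsDefiningFunction.integral_mul_eq`: integration by parts for a continuous tangential
field with distributional divergence, against a function that is mildly singular at `x` and does not
vanish at the boundary. Boundary cutoffs are functions of `d = 1 - |φ|²`. At scale `1/κ` their
gradient has size `κ` on a layer of area `O(1/κ)`, but its component along a tangential field is
only `o(κ)`, so the error vanishes. Control of the layers requires `φ' ≠ 0` up to the boundary,
which is Hopf's lemma on an interior ball together with an inverse function argument inside.

Material derivative. Integration by parts with the continuity equation gives `F₀ = ∫ ρ_t N`. Hence
`u·∇F₀ = ∫ ρ_t u(x)·∇ₓN`, while `∂_t F₀ = ∫ ∇N·(ρ_t u + ρ u_t)`. The `ρ_t` terms add up to `∫ ρ_t Φ`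
with `Φ(y) = (u(x)·∇ₓ + u(y)·∇_y) N`. The leading singularities of the two halves of `Φ` cancel
because `φ' u` is Lipschitz at `x` (`exists_transportKernel_le`), so the continuity equation can be
used again: `∫ ρ_t Φ = ∫ ∇Φ·ρu`. By the product rule the last integrand is that of `F₁` plus
`∇N·ρ(u·∇)u`. Thus `DF₀/Dt = F₁ + ∫ ∇N·ρu̇`, which is substituted into the representation formula.

The condition `q > 2` makes `|y - x|^(-1-s)` lie in the dual Lebesgue space for some `s > 0`,
uniformly in `x`. This gives the time derivative of `F₀` by continuity of a linear functional, and
its space derivative through a remainder of order `1 + s`. -/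

/-! ### Test functions of class `C¹` and Green's first identity with compact support. -/

theorem exists_smooth_approx {Ω : Set ℂ} (hΩ : IsOpen Ω) {ψ : ℂ → ℝ} (hψ : ContDiff ℝ 1 ψ)
    (hc : HasCompactSupport ψ) (hs : tsupport ψ ⊆ Ω) {ε : ℝ} (hε : 0 < ε) :
    ∃ χ : ℂ → ℝ, ContDiff ℝ ∞ χ ∧ HasCompactSupport χ ∧ tsupport χ ⊆ Ω ∧
      (∀ y, |χ y - ψ y| ≤ ε) ∧ ∀ y, ‖fderiv ℝ χ y - fderiv ℝ ψ y‖ ≤ ε := by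
  have hu1 := hc.uniformContinuous_of_continuous hψ.continuous
  have hu2 := (hc.fderiv (𝕜 := ℝ)).uniformContinuous_of_continuous (hψ.continuous_fderiv one_ne_zero)
  obtain ⟨δ₁, hδ₁, h1⟩ := Metric.uniformContinuous_iff.1 hu1 ε hε
  obtain ⟨δ₂, hδ₂, h2⟩ := Metric.uniformContinuous_iff.1 hu2 ε hε
  obtain ⟨δ₃, hδ₃, h3⟩ := hc.isCompact.exists_cthickening_subset_open hΩ hs
  -- One mollification radius controls the oscillation of `ψ`, the oscillation of its derivative,
  -- and the enlargement of its support inside `Ω`.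
  set δ := min δ₁ (min δ₂ δ₃) with hδ
  have hδ0 : 0 < δ := by positivity
  let b : ContDiffBump (0 : ℂ) := ⟨δ / 2, δ, by positivity, by linarith⟩
  have hL : (ContinuousLinearMap.lsmul ℝ ℝ : ℝ →L[ℝ] ℝ →L[ℝ] ℝ).precompR ℂ
      = ContinuousLinearMap.lsmul ℝ ℝ := by
    ext; simp
  have hbi : LocallyIntegrable (b.normed volume) (volume : Measure ℂ) :=
    b.continuous_normed.locallyIntegrable
  set χ := MeasureTheory.convolution (b.normed volume) ψ (ContinuousLinearMap.lsmul ℝ ℝ) volume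
    with hχ
  have hd : ∀ y, HasFDerivAt χ (MeasureTheory.convolution (b.normed volume) (fderiv ℝ ψ)
      (ContinuousLinearMap.lsmul ℝ ℝ) volume y) y := by
    intro y
    have := hc.hasFDerivAt_convolution_right (ContinuousLinearMap.lsmul ℝ ℝ) hbi hψ y
    rwa [hL] at this
  have hsupp : tsupport χ ⊆ Metric.cthickening δ₃ (tsupport ψ) := by
    refine closure_minimal ?_ Metric.isClosed_cthickening
    refine (support_convolution_subset _).trans ?_
    rintro _ ⟨u, hu, v, hv, rfl⟩
    rw [b.support_normed_eq] at hu
    refine Metric.mem_cthickening_of_dist_le _ v _ _ (subset_tsupport _ hv) ?_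
    have : ‖u‖ < δ := by simpa using hu
    simp only [dist_eq_norm, add_sub_cancel_right]
    exact this.le.trans ((min_le_right _ _).trans (min_le_right _ _))
  refine ⟨χ, ?_, ?_, hsupp.trans h3, ?_, ?_⟩
  · exact b.hasCompactSupport_normed.contDiff_convolution_left _ b.contDiff_normed
      hψ.continuous.locallyIntegrable
  · exact hc.isCompact.cthickening.of_isClosed_subset (isClosed_tsupport _) hsupp
  · intro y
    rw [← Real.dist_eq]
    refine b.dist_normed_convolution_le hψ.continuous.aestronglyMeasurable fun x hx => (h1 ?_).le
    exact (Metric.mem_ball.1 hx).trans_le (min_le_left _ _)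
  · intro y
    rw [(hd y).fderiv, ← dist_eq_norm]
    refine b.dist_normed_convolution_le
      (hψ.continuous_fderiv one_ne_zero).aestronglyMeasurable fun x hx => (h2 ?_).le
    exact (Metric.mem_ball.1 hx).trans_le ((min_le_right _ _).trans (min_le_left _ _))

/-- `HasDivIn` with continuously differentiable test functions. -/
theorem HasDivIn.integral_eq {Ω : Set ℂ} (hΩ : IsOpen Ω) {m : ℂ → ℂ} {g : ℂ → ℝ}
    (h : HasDivIn Ω m g) (hm : IntegrableOn m Ω) (hg : IntegrableOn g Ω)
    {ψ : ℂ → ℝ} (hψ : ContDiff ℝ 1 ψ) (hc : HasCompactSupport ψ) (hs : tsupport ψ ⊆ Ω) :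
    ∫ y in Ω, g y * ψ y = -∫ y in Ω, fderiv ℝ ψ y (m y) := by
  have hgi : ∀ {χ : ℂ → ℝ}, Continuous χ → HasCompactSupport χ →
      IntegrableOn (fun y => g y * χ y) Ω := by
    intro χ h1 h2
    obtain ⟨B, hB⟩ := h2.exists_bound_of_continuous h1
    exact hg.mul_bdd (c := B) h1.aestronglyMeasurable (ae_of_all _ hB)
  have hmi : ∀ {χ : ℂ → ℂ →L[ℝ] ℝ}, Continuous χ → HasCompactSupport χ →
      IntegrableOn (fun y => χ y (m y)) Ω := by
    intro χ h1 h2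
    obtain ⟨B, hB⟩ := h2.exists_bound_of_continuous h1
    refine (hm.norm.const_mul B).mono' ?_ (ae_of_all _ fun y => ?_)
    · exact (isBoundedBilinearMap_apply.continuous).comp_aestronglyMeasurable
        (h1.aestronglyMeasurable.prodMk hm.aestronglyMeasurable)
    · exact ((χ y).le_opNorm _).trans (by gcongr; exact hB y)
  suffices H : |(∫ y in Ω, g y * ψ y) + ∫ y in Ω, fderiv ℝ ψ y (m y)| ≤ 0 by
    have := abs_nonpos_iff.1 H; linarith
  refine le_of_forall_pos_le_add fun η hη => ?_
  set A := (∫ y in Ω, |g y|) + ∫ y in Ω, ‖m y‖ with hA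
  have hA0 : 0 ≤ A := by positivity
  -- The two errors together are at most `A` times the `C¹` distance; the `+ 1` only guards against
  -- `A = 0`.
  obtain ⟨χ, hχ1, hχ2, hχ3, hχ4, hχ5⟩ := exists_smooth_approx hΩ hψ hc hs
    (ε := η / (A + 1)) (by positivity)
  have key := h χ hχ1 hχ2 hχ3
  have e1 : |(∫ y in Ω, g y * χ y) - ∫ y in Ω, g y * ψ y| ≤ ∫ y in Ω, |g y| * (η / (A + 1)) := by
    rw [← integral_sub (hgi hχ1.continuous hχ2) (hgi hψ.continuous hc)]
    rw [← Real.norm_eq_abs]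
    refine norm_integral_le_of_norm_le (hg.norm.mul_const _) (ae_of_all _ fun y => ?_)
    rw [← mul_sub, norm_mul]
    exact mul_le_mul_of_nonneg_left (hχ4 y) (norm_nonneg _)
  have e2 : |(∫ y in Ω, fderiv ℝ χ y (m y)) - ∫ y in Ω, fderiv ℝ ψ y (m y)|
      ≤ ∫ y in Ω, ‖m y‖ * (η / (A + 1)) := by
    rw [← integral_sub (hmi (hχ1.continuous_fderiv (by simp)) (hχ2.fderiv (𝕜 := ℝ)))
      (hmi (hψ.continuous_fderiv one_ne_zero) (hc.fderiv (𝕜 := ℝ)))]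
    rw [← Real.norm_eq_abs]
    refine norm_integral_le_of_norm_le (hm.norm.mul_const _) (ae_of_all _ fun y => ?_)
    rw [← _root_.sub_apply, mul_comm]
    exact ((fderiv ℝ χ y - fderiv ℝ ψ y).le_opNorm _).trans (by gcongr; exact hχ5 y)
  rw [integral_mul_const] at e1 e2
  have e3 : A * (η / (A + 1)) ≤ η := by
    rw [mul_div_assoc', div_le_iff₀ (by positivity)]; nlinarith
  rw [hA, add_mul] at e3
  rw [abs_le] at e1 e2 ⊢
  constructor <;> linarith [e1.1, e1.2, e2.1, e2.2]

/-- The gradient of a scalar function on the plane, as a complex number. -/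
def grad (F : ℂ → ℝ) (y : ℂ) : ℂ := fderiv ℝ F y 1 + fderiv ℝ F y Complex.I * Complex.I

theorem clm_apply_eq {E : Type*} [NormedAddCommGroup E] [NormedSpace ℝ E] (L : ℂ →L[ℝ] E) (v : ℂ) :
    L v = v.re • L 1 + v.im • L Complex.I := by
  conv_lhs => rw [← Complex.re_add_im v]
  rw [map_add, ← map_smul, ← map_smul]
  simp

theorem clm_apply_grad (L : ℂ →L[ℝ] ℝ) (F : ℂ → ℝ) (y : ℂ) :
    L (grad F y) = L 1 * fderiv ℝ F y 1 + L Complex.I * fderiv ℝ F y Complex.I := by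
  rw [clm_apply_eq]; simp [grad]; ring

theorem fderiv_apply_eq_inner_grad (F : ℂ → ℝ) (y v : ℂ) :
    fderiv ℝ F y v = inner ℝ (grad F y) v := by
  rw [clm_apply_eq (fderiv ℝ F y) v]; simp [grad, Complex.inner]

/-- Green's first identity with a compactly supported factor. -/
theorem integral_laplacian_mul {Ω : Set ℂ} (hΩ : IsOpen Ω) {F : ℂ → ℝ} (hF : ContDiffOn ℝ 2 F Ω)
    {ψ : ℂ → ℝ} (hψ : ContDiff ℝ 1 ψ) (hc : HasCompactSupport ψ) (hs : tsupport ψ ⊆ Ω) :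
    ∫ y in Ω, Laplacian.laplacian F y * ψ y = -∫ y in Ω, fderiv ℝ ψ y (grad F y) := by
  have hdF : ContDiffOn ℝ 1 (fderiv ℝ F) Ω := hF.fderiv_of_isOpen hΩ (by norm_num)
  have hev : ∀ v, ContDiffOn ℝ 1 (fun y => fderiv ℝ F y v) Ω := fun v =>
    hdF.clm_apply contDiffOn_const
  have hdev : ∀ v, ContinuousOn (fun y => fderiv ℝ (fun z => fderiv ℝ F z v) y v) Ω := fun v =>
    ((hev v).continuousOn_fderiv_of_isOpen hΩ le_rfl).clm_apply continuousOn_const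
  -- Nothing is known about `F` outside `Ω`. A factor supported in `tsupport ψ` makes every product
  -- continuous on the whole plane, where the integration by parts is carried out one coordinate
  -- direction at a time.
  have hcont : ∀ {k h : ℂ → ℝ}, Continuous k → tsupport k ⊆ tsupport ψ → ContinuousOn h Ω →
      Integrable (fun y => k y * h y) := by
    intro k h hk hks hh
    have hsub : tsupport (fun y => k y * h y) ⊆ tsupport k := tsupport_mul_subset_left
    refine Continuous.integrable_of_hasCompactSupport ?_ ?_
    · exact ContinuousOn.continuous_of_tsupport_subset (hk.continuousOn.mul hh) hΩ
        (hsub.trans (hks.trans hs))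
    · exact hc.isCompact.of_isClosed_subset (isClosed_tsupport _) (hsub.trans hks)
  have hdψ : ∀ v, tsupport (fun y => fderiv ℝ ψ y v) ⊆ tsupport ψ := fun v =>
    tsupport_fderiv_apply_subset ℝ v
  have hcψ : ∀ v, Continuous (fun y => fderiv ℝ ψ y v) := fun v =>
    (hψ.continuous_fderiv one_ne_zero).clm_apply continuous_const
  have key : ∀ v, ∫ y, ψ y * fderiv ℝ (fun z => fderiv ℝ F z v) y v
      = -∫ y, fderiv ℝ ψ y v * fderiv ℝ F y v := by
    intro v
    refine integral_mul_fderiv_eq_neg_fderiv_mul_of_integrable ?_ ?_ ?_ ?_ ?_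
    · exact hcont (hcψ v) (hdψ v) (hev v).continuousOn
    · exact hcont hψ.continuous subset_rfl (hdev v)
    · exact hcont hψ.continuous subset_rfl (hev v).continuousOn
    · exact fun x _ => hψ.differentiable one_ne_zero x
    · exact fun x hx => ((hev v).differentiableOn one_ne_zero).differentiableAt
        (hΩ.mem_nhds (hs hx))
  have h0 : ∀ y, y ∉ Ω → ψ y = 0 := fun y hy =>
    image_eq_zero_of_notMem_tsupport fun h => hy (hs h)
  have h0' : ∀ y, y ∉ Ω → fderiv ℝ ψ y = 0 := fun y hy =>
    image_eq_zero_of_notMem_tsupport fun h => hy (hs (tsupport_fderiv_subset ℝ h))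
  rw [setIntegral_eq_integral_of_forall_compl_eq_zero (fun y hy => by simp [h0 y hy]),
    setIntegral_eq_integral_of_forall_compl_eq_zero (fun y hy => by simp [h0' y hy])]
  have e1 : ∀ y, Laplacian.laplacian F y * ψ y =
      ψ y * fderiv ℝ (fun z => fderiv ℝ F z 1) y 1
      + ψ y * fderiv ℝ (fun z => fderiv ℝ F z Complex.I) y Complex.I := by
    intro y
    by_cases hy : y ∈ Ω
    · have hd : DifferentiableAt ℝ (fderiv ℝ F) y :=
        (hdF.differentiableOn one_ne_zero).differentiableAt (hΩ.mem_nhds hy)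
      have h2 : ∀ v, fderiv ℝ (fun z => fderiv ℝ F z v) y v = fderiv ℝ (fderiv ℝ F) y v v := by
        intro v
        rw [fderiv_clm_apply hd (differentiableAt_const _)]; simp
      rw [InnerProductSpace.laplacian_eq_iteratedFDeriv_complexPlane]
      simp only [iteratedFDeriv_two_apply, h2]
      simp; ring
    · simp [h0 y hy]
  simp_rw [e1, clm_apply_grad]
  rw [integral_add (hcont hψ.continuous subset_rfl (hdev _)) (hcont hψ.continuous subset_rfl (hdev _)),
    integral_add (hcont (hcψ _) (hdψ _) (hev _).continuousOn)
      (hcont (hcψ _) (hdψ _) (hev _).continuousOn), key, key]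
  ring

/-! ### Cutoffs at the boundary and tangential fields. -/

theorem exists_deriv_smoothTransition_bound : ∃ L : ℝ, 0 < L ∧
    (∀ s, |deriv Real.smoothTransition s| ≤ L) ∧
    ∀ s, s < 0 ∨ 1 < s → deriv Real.smoothTransition s = 0 := by
  have h0 : ∀ s, s < 0 ∨ 1 < s → deriv Real.smoothTransition s = 0 := by
    rintro s (hs | hs)
    · have : Real.smoothTransition =ᶠ[𝓝 s] fun _ => 0 := by
        filter_upwards [Iio_mem_nhds hs] with t ht
        exact Real.smoothTransition.zero_of_nonpos (le_of_lt ht)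
      rw [this.deriv_eq]; simp
    · have : Real.smoothTransition =ᶠ[𝓝 s] fun _ => 1 := by
        filter_upwards [Ioi_mem_nhds hs] with t ht
        exact Real.smoothTransition.one_of_one_le (le_of_lt ht)
      rw [this.deriv_eq]; simp
  have hc : Continuous (deriv Real.smoothTransition) :=
    (Real.smoothTransition.contDiff (n := 1)).continuous_deriv le_rfl
  obtain ⟨L, hL⟩ := (isCompact_Icc (a := (0 : ℝ)) (b := 1)).exists_bound_of_continuousOn
    hc.continuousOn
  refine ⟨max L 1, by positivity, fun s => ?_, h0⟩
  by_cases hs : s ∈ Icc (0 : ℝ) 1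
  · exact (hL s hs).trans (le_max_left _ _)
  · rw [mem_Icc, not_and_or, not_le, not_le] at hs
    rw [h0 s hs, abs_zero]; positivity

/-- `d` is a function on `Ω` that is positive, vanishes at the boundary, and whose sublevel sets
are thin boundary layers. -/
structure IsDefiningFunction (Ω : Set ℂ) (d : ℂ → ℝ) (C : ℝ) : Prop where
  contDiffOn : ContDiffOn ℝ 1 d Ω
  pos : ∀ y ∈ Ω, 0 < d y
  isCompact : ∀ ε : ℝ, 0 < ε → IsCompact {y ∈ Ω | ε ≤ d y}
  nonneg : 0 ≤ C
  volume_le : ∀ ε : ℝ, 0 < ε → volume {y ∈ Ω | d y < ε} ≤ ENNReal.ofReal (C * ε)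

open Classical in
/-- A cutoff function that vanishes where `d ≤ κ⁻¹` and is `1` where `d ≥ 2 κ⁻¹`. -/
def cutoff (Ω : Set ℂ) (d : ℂ → ℝ) (κ : ℝ) (y : ℂ) : ℝ :=
  if y ∈ Ω then Real.smoothTransition (κ * d y - 1) else 0

section cutoff

variable {Ω : Set ℂ} {d : ℂ → ℝ} {C κ : ℝ}

theorem cutoff_of_mem {y : ℂ} (hy : y ∈ Ω) :
    cutoff Ω d κ y = Real.smoothTransition (κ * d y - 1) := if_pos hy

theorem cutoff_mem_Icc (y : ℂ) : cutoff Ω d κ y ∈ Icc (0 : ℝ) 1 := by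
  unfold cutoff
  split_ifs
  · exact ⟨Real.smoothTransition.nonneg _, Real.smoothTransition.le_one _⟩
  · simp

theorem support_cutoff_subset (hκ : 0 < κ) :
    Function.support (cutoff Ω d κ) ⊆ {y ∈ Ω | κ⁻¹ ≤ d y} := by
  intro y hy
  have hyΩ : y ∈ Ω := by
    by_contra h; exact hy (if_neg h)
  refine ⟨hyΩ, ?_⟩
  by_contra! h
  refine hy ?_
  rw [cutoff_of_mem hyΩ]
  refine Real.smoothTransition.zero_of_nonpos ?_
  have := mul_lt_mul_of_pos_left h hκ
  rw [mul_inv_cancel₀ hκ.ne'] at this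
  linarith

theorem IsDefiningFunction.tsupport_mul_cutoff_subset (hd : IsDefiningFunction Ω d C) (hκ : 0 < κ)
    (Φ : ℂ → ℝ) : tsupport (fun y => Φ y * cutoff Ω d κ y) ⊆ {y ∈ Ω | κ⁻¹ ≤ d y} := by
  refine closure_minimal ?_ (hd.isCompact _ (by positivity)).isClosed
  exact (Function.support_mul_subset_right _ _).trans (support_cutoff_subset hκ)

theorem IsDefiningFunction.contDiff_mul_cutoff (hΩ : IsOpen Ω) (hd : IsDefiningFunction Ω d C)
    (hκ : 0 < κ) {Φ : ℂ → ℝ} (hΦ : ContDiffOn ℝ 1 Φ Ω) :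
    ContDiff ℝ 1 (fun y => Φ y * cutoff Ω d κ y) := by
  rw [contDiff_iff_contDiffAt]
  intro y
  by_cases hy : y ∈ Ω
  · have hn := hΩ.mem_nhds hy
    refine (hΦ.contDiffAt hn).mul ?_
    have : cutoff Ω d κ =ᶠ[𝓝 y] fun y => Real.smoothTransition (κ * d y - 1) := by
      filter_upwards [hn] with z hz using cutoff_of_mem hz
    refine ContDiffAt.congr_of_eventuallyEq ?_ this
    exact Real.smoothTransition.contDiffAt.comp y
      ((contDiffAt_const.mul (hd.contDiffOn.contDiffAt hn)).sub contDiffAt_const)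
  · have hK := (hd.isCompact κ⁻¹ (by positivity)).isClosed
    have : (fun y => Φ y * cutoff Ω d κ y) =ᶠ[𝓝 y] fun _ => 0 := by
      filter_upwards [hK.isOpen_compl.mem_nhds (fun h => hy h.1 : y ∈ {y ∈ Ω | κ⁻¹ ≤ d y}ᶜ)]
        with z hz
      by_contra h
      exact hz (support_cutoff_subset hκ (right_ne_zero_of_mul h))
    exact contDiffAt_const.congr_of_eventuallyEq this

theorem IsDefiningFunction.contDiff_cutoff (hΩ : IsOpen Ω) (hd : IsDefiningFunction Ω d C)
    (hκ : 0 < κ) : ContDiff ℝ 1 (cutoff Ω d κ) := by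
  simpa using hd.contDiff_mul_cutoff hΩ hκ (Φ := fun _ => 1) contDiffOn_const

theorem IsDefiningFunction.fderiv_cutoff (hΩ : IsOpen Ω) (hd : IsDefiningFunction Ω d C)
    {y : ℂ} (hy : y ∈ Ω) (v : ℂ) : fderiv ℝ (cutoff Ω d κ) y v =
      deriv Real.smoothTransition (κ * d y - 1) * (κ * fderiv ℝ d y v) := by
  have hn := hΩ.mem_nhds hy
  have : cutoff Ω d κ =ᶠ[𝓝 y] fun y => Real.smoothTransition (κ * d y - 1) := by
    filter_upwards [hn] with z hz using cutoff_of_mem hz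
  rw [this.fderiv_eq]
  have h1 : HasFDerivAt d (fderiv ℝ d y) y :=
    ((hd.contDiffOn.contDiffAt hn).differentiableAt one_ne_zero).hasFDerivAt
  have h2 : HasDerivAt Real.smoothTransition (deriv Real.smoothTransition (κ * d y - 1))
      (κ * d y - 1) :=
    ((Real.smoothTransition.contDiff (n := 1)).differentiable one_ne_zero _).hasDerivAt
  have h3 := h2.comp_hasFDerivAt y ((h1.const_mul κ).sub_const 1)
  have h4 : HasFDerivAt (fun y => Real.smoothTransition (κ * d y - 1)) _ y := h3
  rw [h4.fderiv]
  simp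

theorem IsDefiningFunction.measurableSet_layer (hΩ : IsOpen Ω) (hd : IsDefiningFunction Ω d C)
    (ε : ℝ) : MeasurableSet {y ∈ Ω | d y < ε} :=
  (hd.contDiffOn.continuousOn.isOpen_inter_preimage hΩ isOpen_Iio).measurableSet

theorem aestronglyMeasurable_clm_apply {E F : Type*} [NormedAddCommGroup E] [NormedSpace ℝ E]
    [NormedAddCommGroup F] [NormedSpace ℝ F] {μ : Measure ℂ} {A : ℂ → E →L[ℝ] F} {m : ℂ → E}
    (hA : AEStronglyMeasurable A μ) (hm : AEStronglyMeasurable m μ) :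
    AEStronglyMeasurable (fun y => A y (m y)) μ :=
  (isBoundedBilinearMap_apply.continuous).comp_aestronglyMeasurable (hA.prodMk hm)

/-- Boundary cutoffs can be removed when the field `m` is tangential at the boundary. -/
theorem IsDefiningFunction.tendsto_integral_mul_cutoff (hΩ : IsOpen Ω)
    (hd : IsDefiningFunction Ω d C) {m : ℂ → ℂ} (hm : AEStronglyMeasurable m (volume.restrict Ω))
    (htan : ∀ η : ℝ, 0 < η → ∃ ε : ℝ, 0 < ε ∧ ∀ y ∈ Ω, d y < ε → |fderiv ℝ d y (m y)| ≤ η)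
    {Φ : ℂ → ℝ} (hΦ : ContDiffOn ℝ 1 Φ Ω) {B : ℝ} (hB : ∀ y ∈ Ω, |Φ y| ≤ B)
    (hint : IntegrableOn (fun y => fderiv ℝ Φ y (m y)) Ω) :
    Tendsto (fun κ : ℝ => ∫ y in Ω, fderiv ℝ (fun y => Φ y * cutoff Ω d κ y) y (m y)) atTop
      (𝓝 (∫ y in Ω, fderiv ℝ Φ y (m y))) := by
  -- The product rule splits the integral. The term with `∇Φ` converges by domination. In the other
  -- one the derivative of the cutoff along `m` is at most `L κ η` on a layer of area at most
  -- `3C/κ`, so `κ` cancels and an arbitrary `η` remains.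
  obtain ⟨L, hL0, hL, hL'⟩ := exists_deriv_smoothTransition_bound
  have hmeas := hΩ.measurableSet
  have hBn : 0 ≤ max B 0 := le_max_right _ _
  have hC := hd.nonneg
  have hΦm : AEStronglyMeasurable Φ (volume.restrict Ω) :=
    hΦ.continuousOn.aestronglyMeasurable hmeas
  -- the derivative of the cutoff along `m` is small near the boundary
  have hlayer : ∀ η : ℝ, 0 < η → ∀ᶠ κ : ℝ in atTop, ∀ y ∈ Ω,
      |fderiv ℝ (cutoff Ω d κ) y (m y)| ≤
        {y ∈ Ω | d y < 3 / κ}.indicator (fun _ => L * (κ * η)) y := by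
    intro η hη
    obtain ⟨ε, hε, h⟩ := htan η hη
    filter_upwards [eventually_gt_atTop (3 / ε), eventually_gt_atTop 0] with κ hκ hκ0 y hy
    rw [hd.fderiv_cutoff hΩ hy]
    -- The derivative of the transition vanishes once `κ d - 1 > 1`; the threshold `3` instead of
    -- `2` makes this inequality strict.
    by_cases hyl : d y < 3 / κ
    · rw [indicator_of_mem (show y ∈ {y ∈ Ω | d y < 3 / κ} from ⟨hy, hyl⟩), abs_mul, abs_mul,
        abs_of_pos hκ0]
      have : 3 / κ < ε := by rw [div_lt_iff₀ hκ0, mul_comm]; exact (div_lt_iff₀ hε).1 hκ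
      gcongr
      · exact hL _
      · exact h y hy (hyl.trans this)
    · rw [indicator_of_notMem (fun h => hyl h.2)]
      have : 3 ≤ κ * d y := by rw [mul_comm]; exact (div_le_iff₀ hκ0).1 (not_lt.1 hyl)
      rw [hL' _ (Or.inr (by linarith))]; simp
  have hvol : ∀ κ : ℝ, 0 < κ → volume {y ∈ Ω | d y < 3 / κ} ≤ ENNReal.ofReal (C * (3 / κ)) :=
    fun κ hκ => hd.volume_le _ (by positivity)
  have hind : ∀ κ η : ℝ, 0 < κ → IntegrableOn
      (fun y => max B 0 * {y ∈ Ω | d y < 3 / κ}.indicator (fun _ => L * (κ * η)) y) Ω := by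
    intro κ η hκ
    refine (Integrable.const_mul ?_ _)
    refine (integrable_indicator_iff (hd.measurableSet_layer hΩ _)).2 ?_
    refine integrableOn_const ?_
    exact ((Measure.restrict_apply_le _ _).trans_lt
      ((hvol κ hκ).trans_lt ENNReal.ofReal_lt_top)).ne
  have hb2 : ∀ η : ℝ, 0 < η → ∀ᶠ κ : ℝ in atTop, ∀ᵐ y ∂(volume.restrict Ω),
      ‖Φ y * fderiv ℝ (cutoff Ω d κ) y (m y)‖ ≤
        max B 0 * {y ∈ Ω | d y < 3 / κ}.indicator (fun _ => L * (κ * η)) y := by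
    intro η hη
    filter_upwards [hlayer η hη] with κ hκ
    filter_upwards [ae_restrict_mem hmeas] with y hy
    rw [norm_mul]
    exact mul_le_mul ((hB y hy).trans (le_max_left _ _)) (hκ y hy) (norm_nonneg _) hBn
  have hmeas2 : ∀ κ : ℝ, 0 < κ → AEStronglyMeasurable
      (fun y => Φ y * fderiv ℝ (cutoff Ω d κ) y (m y)) (volume.restrict Ω) := by
    intro κ hκ
    exact hΦm.mul (aestronglyMeasurable_clm_apply
      ((hd.contDiff_cutoff hΩ hκ).continuous_fderiv one_ne_zero).aestronglyMeasurable hm)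
  have hint2 : ∀ᶠ κ : ℝ in atTop,
      IntegrableOn (fun y => Φ y * fderiv ℝ (cutoff Ω d κ) y (m y)) Ω := by
    filter_upwards [hb2 1 one_pos, eventually_gt_atTop 0] with κ hκ hκ0
    exact (hind κ 1 hκ0).mono' (hmeas2 κ hκ0) hκ
  have hcutmeas : ∀ κ : ℝ, 0 < κ → AEStronglyMeasurable (cutoff Ω d κ) (volume.restrict Ω) :=
    fun κ hκ => (hd.contDiff_cutoff hΩ hκ).continuous.aestronglyMeasurable
  have hint1 : ∀ᶠ κ : ℝ in atTop,
      IntegrableOn (fun y => cutoff Ω d κ y * fderiv ℝ Φ y (m y)) Ω := by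
    filter_upwards [eventually_gt_atTop 0] with κ hκ
    refine hint.bdd_mul (c := 1) (hcutmeas κ hκ) (ae_of_all _ fun y => ?_)
    rw [Real.norm_eq_abs, abs_of_nonneg (cutoff_mem_Icc y).1]
    exact (cutoff_mem_Icc y).2
  have hlim1 : Tendsto (fun κ : ℝ => ∫ y in Ω, cutoff Ω d κ y * fderiv ℝ Φ y (m y)) atTop
      (𝓝 (∫ y in Ω, fderiv ℝ Φ y (m y))) := by
    refine tendsto_integral_filter_of_dominated_convergence (fun y => ‖fderiv ℝ Φ y (m y)‖)
      ?_ ?_ hint.norm ?_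
    · filter_upwards [eventually_gt_atTop 0] with κ hκ
      exact (hcutmeas κ hκ).mul hint.aestronglyMeasurable
    · refine Eventually.of_forall fun κ => ae_of_all _ fun y => ?_
      rw [norm_mul, Real.norm_eq_abs, abs_of_nonneg (cutoff_mem_Icc y).1]
      exact mul_le_of_le_one_left (norm_nonneg _) (cutoff_mem_Icc y).2
    · filter_upwards [ae_restrict_mem hmeas] with y hy
      refine tendsto_const_nhds.congr' ?_
      filter_upwards [eventually_gt_atTop (2 / d y)] with κ hκ
      rw [cutoff_of_mem hy, Real.smoothTransition.one_of_one_le, one_mul]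
      have := (div_lt_iff₀ (hd.pos y hy)).1 hκ
      linarith
  have hlim2 : Tendsto (fun κ : ℝ => ∫ y in Ω, Φ y * fderiv ℝ (cutoff Ω d κ) y (m y)) atTop
      (𝓝 0) := by
    rw [Metric.tendsto_nhds]
    intro δ hδ
    -- Tuned so that the final bound `max B 0 * (L * (C * 3)) * η`, free of `κ`, stays below `δ`.
    set η := δ / (2 * (max B 0 * (L * (C * 3)) + 1)) with hη
    have hη0 : 0 < η := by positivity
    filter_upwards [hb2 η hη0, eventually_gt_atTop 0] with κ hκ hκ0
    rw [dist_zero_right]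
    refine (norm_integral_le_of_norm_le (hind κ η hκ0) hκ).trans_lt ?_
    rw [integral_const_mul, integral_indicator (hd.measurableSet_layer hΩ _),
      setIntegral_const, smul_eq_mul]
    have hv : (volume.restrict Ω).real {y ∈ Ω | d y < 3 / κ} ≤ C * (3 / κ) := by
      refine ENNReal.toReal_le_of_le_ofReal (by positivity) ?_
      exact (Measure.restrict_apply_le _ _).trans (hvol κ hκ0)
    calc max B 0 * ((volume.restrict Ω).real {y ∈ Ω | d y < 3 / κ} * (L * (κ * η)))
        ≤ max B 0 * (C * (3 / κ) * (L * (κ * η))) := by gcongr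
      _ = (max B 0 * (L * (C * 3))) * η := by field_simp
      _ < δ := by
        have hA : 0 ≤ max B 0 * (L * (C * 3)) := by positivity
        rw [hη, mul_div_assoc', div_lt_iff₀ (by positivity)]
        nlinarith
  have hsum := hlim1.add hlim2
  rw [add_zero] at hsum
  refine hsum.congr' ?_
  filter_upwards [hint1, hint2, eventually_gt_atTop 0] with κ h1 h2 hκ
  rw [← integral_add h1 h2]
  refine setIntegral_congr_fun hmeas fun y hy => ?_
  have hn := hΩ.mem_nhds hy
  rw [fderiv_fun_mul ((hΦ.contDiffAt hn).differentiableAt one_ne_zero)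
    ((hd.contDiff_cutoff hΩ hκ).differentiable one_ne_zero y)]
  simp; ring

end cutoff

/-! ### Cutoffs at the pole and integration by parts across a singularity. -/

theorem integrableOn_norm_sub_rpow {Ω : Set ℂ} (hb : Bornology.IsBounded Ω) {p : ℝ}
    (hp : p < 2) (x : ℂ) : IntegrableOn (fun y => ‖y - x‖ ^ (-p)) Ω := by
  have h : LocallyIntegrable (fun y : ℂ => ‖y‖ ^ (-p)) :=
    locallyIntegrable_of_norm_le_rpow (C := 1) (α := p) (by simp) (by simpa using hp)
      (ae_of_all _ fun y => by
        rw [Real.norm_of_nonneg (by positivity), one_mul])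
      (by fun_prop : Measurable fun y : ℂ => ‖y‖ ^ (-p)).aestronglyMeasurable
  obtain ⟨R, hR⟩ := hb.subset_closedBall x
  have h1 : IntegrableOn (fun y : ℂ => ‖y‖ ^ (-p)) (Metric.closedBall 0 R) :=
    h.integrableOn_isCompact (isCompact_closedBall _ _)
  have h2 := (measurePreserving_sub_right volume x).integrableOn_comp_preimage
    (measurableEmbedding_subRight x) (f := fun y : ℂ => ‖y‖ ^ (-p)) (s := Metric.closedBall 0 R)
  refine (h2.2 h1).mono_set fun y hy => ?_
  simpa [dist_eq_norm] using hR hy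

/-- A cutoff function that vanishes near `x` and is `1` away from `x`, at scale `κ⁻¹`. -/
def pointCutoff (x : ℂ) (κ : ℝ) (y : ℂ) : ℝ :=
  Real.smoothTransition (κ ^ 2 * ‖y - x‖ ^ 2 - 1)

section pointCutoff

variable {x : ℂ} {κ : ℝ}

theorem pointCutoff_mem_Icc (y : ℂ) : pointCutoff x κ y ∈ Icc (0 : ℝ) 1 :=
  ⟨Real.smoothTransition.nonneg _, Real.smoothTransition.le_one _⟩

theorem pointCutoff_eq_zero {y : ℂ} (hκ : 0 < κ) (h : ‖y - x‖ ≤ κ⁻¹) : pointCutoff x κ y = 0 := by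
  refine Real.smoothTransition.zero_of_nonpos ?_
  have : κ * ‖y - x‖ ≤ 1 := by
    have := mul_le_mul_of_nonneg_left h hκ.le
    rwa [mul_inv_cancel₀ hκ.ne'] at this
  rw [← mul_pow]
  have h0 : 0 ≤ κ * ‖y - x‖ := by positivity
  nlinarith

theorem eventually_pointCutoff_eq_one {y : ℂ} (hy : y ≠ x) :
    ∀ᶠ κ : ℝ in atTop, ∀ᶠ z in 𝓝 y, pointCutoff x κ z = 1 := by
  have h0 : 0 < ‖y - x‖ := norm_pos_iff.2 (sub_ne_zero.2 hy)
  filter_upwards [eventually_gt_atTop (2 / ‖y - x‖), eventually_gt_atTop 0] with κ hκ hκ0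
  have h1 : 2 < κ * ‖y - x‖ := (div_lt_iff₀ h0).1 hκ
  have hc : Continuous fun z : ℂ => κ * ‖z - x‖ := by fun_prop
  filter_upwards [(isOpen_lt continuous_const hc).mem_nhds h1] with z hz
  refine Real.smoothTransition.one_of_one_le ?_
  rw [← mul_pow]
  have hz : 2 < κ * ‖z - x‖ := hz
  nlinarith

theorem contDiff_pointCutoff : ContDiff ℝ 1 (pointCutoff x κ) :=
  Real.smoothTransition.contDiff.comp
    ((contDiff_const.mul ((contDiff_id.sub contDiff_const).norm_sq ℝ)).sub contDiff_const)

/-- Scale invariance: the gradient has size `κ` and lives where `‖y - x‖` is comparable to `κ⁻¹`, so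
`κ` can be traded for `‖y - x‖⁻¹`. The bound no longer involves `κ` and serves as a majorant when
the cutoff is removed. -/
theorem exists_fderiv_pointCutoff_bound : ∃ L : ℝ, 0 < L ∧ ∀ (x : ℂ) (κ : ℝ) (y : ℂ), y ≠ x →
    ‖fderiv ℝ (pointCutoff x κ) y‖ ≤ L * ‖y - x‖⁻¹ := by
  obtain ⟨L, hL0, hL, hL'⟩ := exists_deriv_smoothTransition_bound
  refine ⟨L * 6, by positivity, fun x κ y hy => ?_⟩
  have h0 : 0 < ‖y - x‖ := norm_pos_iff.2 (sub_ne_zero.2 hy)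
  have h2 : HasDerivAt Real.smoothTransition
      (deriv Real.smoothTransition (κ ^ 2 * ‖y - x‖ ^ 2 - 1)) (κ ^ 2 * ‖y - x‖ ^ 2 - 1) :=
    ((Real.smoothTransition.contDiff (n := 1)).differentiable one_ne_zero _).hasDerivAt
  have h1 : HasFDerivAt (fun y : ℂ => ‖y - x‖ ^ 2) (2 • innerSL ℝ (y - x)) y := by
    simpa using! ((hasFDerivAt_id y).sub_const x).norm_sq
  have h3 := h2.comp_hasFDerivAt y ((h1.const_mul (κ ^ 2)).sub_const 1)
  have h3 : HasFDerivAt (pointCutoff x κ) _ y := h3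
  rw [h3.fderiv, norm_smul, norm_smul, two_smul]
  by_cases hc : 1 < κ ^ 2 * ‖y - x‖ ^ 2 - 1
  · rw [hL' _ (Or.inr hc)]; simp; positivity
  · have h4 : κ ^ 2 ≤ 3 / ‖y - x‖ ^ 2 := by
      rw [le_div_iff₀ (by positivity)]; linarith
    have h5 : ‖innerSL ℝ (y - x) + innerSL ℝ (y - x)‖ ≤ 2 * ‖y - x‖ := by
      refine (norm_add_le _ _).trans ?_
      rw [innerSL_apply_norm]; linarith
    calc ‖deriv Real.smoothTransition (κ ^ 2 * ‖y - x‖ ^ 2 - 1)‖ *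
        (‖κ ^ 2‖ * ‖innerSL ℝ (y - x) + innerSL ℝ (y - x)‖)
        ≤ L * (3 / ‖y - x‖ ^ 2 * (2 * ‖y - x‖)) := by
          gcongr
          · exact hL _
          · rw [Real.norm_of_nonneg (sq_nonneg _)]; exact h4
      _ = L * 6 * ‖y - x‖⁻¹ := by field_simp; ring

end pointCutoff

/-- Integration by parts on `Ω` for a tangential field `m` with distributional divergence `g`,
against a function with a mild singularity at an interior point. -/
theorem IsDefiningFunction.integral_mul_eq {Ω : Set ℂ} {d : ℂ → ℝ} {C : ℝ} (hΩ : IsOpen Ω)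
    (hb : Bornology.IsBounded Ω) (hd : IsDefiningFunction Ω d C) {m : ℂ → ℂ} {g : ℂ → ℝ}
    (hdiv : HasDivIn Ω m g) (hg : IntegrableOn g Ω)
    (hm : AEStronglyMeasurable m (volume.restrict Ω)) {M : ℝ} (hM : ∀ y ∈ Ω, ‖m y‖ ≤ M)
    (htan : ∀ η : ℝ, 0 < η → ∃ ε : ℝ, 0 < ε ∧ ∀ y ∈ Ω, d y < ε → |fderiv ℝ d y (m y)| ≤ η)
    {x : ℂ} {Φ : ℂ → ℝ} (hΦ : ContDiffOn ℝ 1 Φ (Ω \ {x})) {B : ℝ}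
    (hB : ∀ y ∈ Ω \ {x}, |Φ y| ≤ B * ‖y - x‖ ^ (-(1 / 2) : ℝ))
    (hB' : ∀ y ∈ Ω \ {x}, ‖fderiv ℝ Φ y‖ ≤ B * ‖y - x‖⁻¹)
    (hgΦ : IntegrableOn (fun y => g y * Φ y) Ω) :
    IntegrableOn (fun y => fderiv ℝ Φ y (m y)) Ω ∧
      ∫ y in Ω, g y * Φ y = -∫ y in Ω, fderiv ℝ Φ y (m y) := by
  -- Two cutoffs are inserted, at the pole (scale `κ⁻¹`) and at the boundary (scale `τ⁻¹`). For
  -- fixed `κ` the function cut at the pole is bounded and `C¹` in `Ω`, so the boundary cutoff goes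
  -- first; then `κ → ∞`. The powers `1/2` and `1` make the error `Φ ∇(pointCutoff)` of order `‖y -
  -- x‖ ^ (-3/2)`, still integrable in the plane.
  have hmeas := hΩ.measurableSet
  have hΩ' : IsOpen (Ω \ {x}) := hΩ.sdiff isClosed_singleton
  have haex : ∀ᵐ y ∂(volume.restrict Ω), y ∈ Ω \ {x} := by
    filter_upwards [ae_restrict_mem hmeas, (measure_eq_zero_iff_ae_notMem.1
      (measure_singleton x) : ∀ᵐ y ∂(volume.restrict Ω), y ∉ ({x} : Set ℂ))] with y h1 h2
    exact ⟨h1, h2⟩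
  have hrestr : volume.restrict Ω = volume.restrict (Ω \ {x}) :=
    (Measure.restrict_congr_set (sdiff_null_ae_eq_self (measure_singleton x))).symm
  have hfin : volume Ω ≠ ⊤ := hb.measure_lt_top.ne
  have hmi : IntegrableOn m Ω :=
    (integrableOn_const (C := M) hfin).mono' hm ((ae_restrict_mem hmeas).mono hM)
  have hk1 : IntegrableOn (fun y => ‖y - x‖⁻¹) Ω := by
    simpa [Real.rpow_neg_one] using integrableOn_norm_sub_rpow hb (p := 1) (by norm_num) x
  have hk2 : IntegrableOn (fun y => ‖y - x‖ ^ (-(3 / 2) : ℝ)) Ω :=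
    integrableOn_norm_sub_rpow hb (p := 3 / 2) (by norm_num) x
  have hΦmeas : AEStronglyMeasurable Φ (volume.restrict Ω) := by
    rw [hrestr]; exact hΦ.continuousOn.aestronglyMeasurable hΩ'.measurableSet
  have hdΦmeas : AEStronglyMeasurable (fderiv ℝ Φ) (volume.restrict Ω) := by
    rw [hrestr]
    exact (hΦ.continuousOn_fderiv_of_isOpen hΩ' le_rfl).aestronglyMeasurable hΩ'.measurableSet
  have hi1 : IntegrableOn (fun y => fderiv ℝ Φ y (m y)) Ω := by
    refine ((hk1.const_mul B).mul_const M).mono' (aestronglyMeasurable_clm_apply hdΦmeas hm) ?_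
    filter_upwards [haex] with y hy
    exact (ContinuousLinearMap.le_opNorm _ _).trans (mul_le_mul (hB' y hy) (hM y hy.1)
      (norm_nonneg _) ((norm_nonneg _).trans (hB' y hy)))
  refine ⟨hi1, ?_⟩
  obtain ⟨L, hL0, hL⟩ := exists_fderiv_pointCutoff_bound
  have hprodd : ∀ κ : ℝ, ∀ y ∈ Ω \ {x}, fderiv ℝ (fun y => Φ y * pointCutoff x κ y) y (m y)
      = pointCutoff x κ y * fderiv ℝ Φ y (m y) + Φ y * fderiv ℝ (pointCutoff x κ) y (m y) := by
    intro κ y hy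
    rw [fderiv_fun_mul ((hΦ.contDiffAt (hΩ'.mem_nhds hy)).differentiableAt one_ne_zero)
      (contDiff_pointCutoff.differentiable one_ne_zero y)]
    simp; ring
  have hcm : ∀ κ, AEStronglyMeasurable (pointCutoff x κ) (volume.restrict Ω) := fun κ =>
    (contDiff_pointCutoff (x := x)).continuous.aestronglyMeasurable
  have hI1 : ∀ κ, IntegrableOn (fun y => pointCutoff x κ y * fderiv ℝ Φ y (m y)) Ω := by
    intro κ
    refine hi1.bdd_mul (c := 1) (hcm κ) (ae_of_all _ fun y => ?_)
    rw [Real.norm_eq_abs, abs_of_nonneg (pointCutoff_mem_Icc y).1]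
    exact (pointCutoff_mem_Icc y).2
  have hbd2 : ∀ κ, ∀ᵐ y ∂(volume.restrict Ω), ‖Φ y * fderiv ℝ (pointCutoff x κ) y (m y)‖ ≤
      B * L * M * ‖y - x‖ ^ (-(3 / 2) : ℝ) := by
    intro κ
    filter_upwards [haex] with y hy
    have h0 : 0 < ‖y - x‖ := norm_pos_iff.2 (sub_ne_zero.2 hy.2)
    have e : ‖y - x‖ ^ (-(3 / 2) : ℝ) = ‖y - x‖ ^ (-(1 / 2) : ℝ) * ‖y - x‖⁻¹ := by
      rw [← Real.rpow_neg_one, ← Real.rpow_add h0]; norm_num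
    have hBn : 0 ≤ B * ‖y - x‖ ^ (-(1 / 2) : ℝ) := (abs_nonneg _).trans (hB y hy)
    calc ‖Φ y * fderiv ℝ (pointCutoff x κ) y (m y)‖
        ≤ (B * ‖y - x‖ ^ (-(1 / 2) : ℝ)) * ((L * ‖y - x‖⁻¹) * M) := by
          rw [norm_mul]
          refine mul_le_mul (hB y hy) ?_ (norm_nonneg _) hBn
          exact (ContinuousLinearMap.le_opNorm _ _).trans (mul_le_mul (hL x κ y hy.2) (hM y hy.1)
            (norm_nonneg _) (by positivity))
      _ = _ := by rw [e]; ring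
  have hcm2 : ∀ κ, AEStronglyMeasurable (fun y => Φ y * fderiv ℝ (pointCutoff x κ) y (m y))
      (volume.restrict Ω) := fun κ => hΦmeas.mul (aestronglyMeasurable_clm_apply
        ((contDiff_pointCutoff (x := x)).continuous_fderiv one_ne_zero).aestronglyMeasurable hm)
  have hI2 : ∀ κ, IntegrableOn (fun y => Φ y * fderiv ℝ (pointCutoff x κ) y (m y)) Ω := fun κ =>
    (hk2.const_mul (B * L * M)).mono' (hcm2 κ) (hbd2 κ)
  -- the identity with a cutoff at the singularity
  have hcut : ∀ κ : ℝ, 0 < κ → ∫ y in Ω, g y * (Φ y * pointCutoff x κ y)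
      = -∫ y in Ω, fderiv ℝ (fun y => Φ y * pointCutoff x κ y) y (m y) := by
    intro κ hκ
    have hC1 : ContDiffOn ℝ 1 (fun y => Φ y * pointCutoff x κ y) Ω := by
      intro y hy
      by_cases hyx : y = x
      · have : (fun y => Φ y * pointCutoff x κ y) =ᶠ[𝓝 y] fun _ => 0 := by
          filter_upwards [Metric.ball_mem_nhds y (inv_pos.2 hκ)] with z hz
          rw [pointCutoff_eq_zero hκ, mul_zero]
          rw [← hyx, ← dist_eq_norm]; exact (Metric.mem_ball.1 hz).le
        exact (contDiffAt_const.congr_of_eventuallyEq this).contDiffWithinAt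
      · exact ((hΦ.contDiffAt (hΩ'.mem_nhds ⟨hy, hyx⟩)).mul
          contDiff_pointCutoff.contDiffAt).contDiffWithinAt
    have hbound : ∀ y ∈ Ω, |Φ y * pointCutoff x κ y| ≤ |B| * κ ^ (1 / 2 : ℝ) := by
      intro y hy
      by_cases hyx : ‖y - x‖ ≤ κ⁻¹
      · rw [pointCutoff_eq_zero hκ hyx]; simp; positivity
      · have hne : y ≠ x := by rintro rfl; simp at hyx; linarith
        rw [abs_mul, abs_of_nonneg (pointCutoff_mem_Icc y).1]
        refine (mul_le_of_le_one_right (abs_nonneg _) (pointCutoff_mem_Icc y).2).trans ?_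
        refine (hB y ⟨hy, hne⟩).trans ?_
        refine mul_le_mul (le_abs_self _) ?_ (by positivity) (abs_nonneg _)
        rw [Real.rpow_neg (norm_nonneg _), ← Real.inv_rpow (norm_nonneg _)]
        refine Real.rpow_le_rpow (by positivity) ?_ (by norm_num)
        exact inv_le_of_inv_le₀ hκ (not_le.1 hyx).le
    have hint : IntegrableOn (fun y => fderiv ℝ (fun y => Φ y * pointCutoff x κ y) y (m y)) Ω := by
      refine ((hI1 κ).add (hI2 κ)).congr ?_
      filter_upwards [haex] with y hy
      exact (hprodd κ y hy).symm
    have hlim := hd.tendsto_integral_mul_cutoff hΩ hm htan hC1 hbound hint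
    have hlim' : Tendsto (fun τ : ℝ => ∫ y in Ω,
        g y * (Φ y * pointCutoff x κ y * cutoff Ω d τ y)) atTop
        (𝓝 (∫ y in Ω, g y * (Φ y * pointCutoff x κ y))) := by
      have hdom : IntegrableOn (fun y => g y * Φ y * pointCutoff x κ y) Ω := by
        refine hgΦ.mul_bdd (c := 1) (hcm κ) (ae_of_all _ fun y => ?_)
        rw [Real.norm_eq_abs, abs_of_nonneg (pointCutoff_mem_Icc y).1]
        exact (pointCutoff_mem_Icc y).2
      refine tendsto_integral_filter_of_dominated_convergence
        (fun y => ‖g y * Φ y * pointCutoff x κ y‖) ?_ ?_ hdom.norm ?_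
      · filter_upwards [eventually_gt_atTop 0] with τ hτ
        exact hg.aestronglyMeasurable.mul
          ((hd.contDiff_mul_cutoff hΩ hτ hC1).continuous.aestronglyMeasurable)
      · refine Eventually.of_forall fun τ => ae_of_all _ fun y => ?_
        rw [← mul_assoc, ← mul_assoc, norm_mul _ (cutoff Ω d τ y), Real.norm_eq_abs (cutoff Ω d τ y),
          abs_of_nonneg (cutoff_mem_Icc y).1]
        exact mul_le_of_le_one_right (norm_nonneg _) (cutoff_mem_Icc y).2
      · filter_upwards [ae_restrict_mem hmeas] with y hy
        refine tendsto_const_nhds.congr' ?_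
        filter_upwards [eventually_gt_atTop (2 / d y)] with τ hτ
        rw [cutoff_of_mem hy, Real.smoothTransition.one_of_one_le, mul_one]
        have := (div_lt_iff₀ (hd.pos y hy)).1 hτ
        linarith
    refine tendsto_nhds_unique hlim' (hlim.neg.congr' ?_)
    filter_upwards [eventually_gt_atTop 0] with τ hτ
    have hsub := hd.tsupport_mul_cutoff_subset hτ (fun y => Φ y * pointCutoff x κ y)
    exact (hdiv.integral_eq hΩ hmi hg (hd.contDiff_mul_cutoff hΩ hτ hC1)
      ((hd.isCompact _ (inv_pos.2 hτ)).of_isClosed_subset (isClosed_tsupport _) hsub)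
      (hsub.trans fun y hy => hy.1)).symm
  -- removing the cutoff at the singularity
  have hl1 : Tendsto (fun κ : ℝ => ∫ y in Ω, g y * (Φ y * pointCutoff x κ y)) atTop
      (𝓝 (∫ y in Ω, g y * Φ y)) := by
    refine tendsto_integral_filter_of_dominated_convergence
      (fun y => ‖g y * Φ y‖) ?_ ?_ hgΦ.norm ?_
    · exact Eventually.of_forall fun κ => hg.aestronglyMeasurable.mul (hΦmeas.mul (hcm κ))
    · refine Eventually.of_forall fun τ => ae_of_all _ fun y => ?_
      rw [← mul_assoc, norm_mul _ (pointCutoff x τ y), Real.norm_eq_abs (pointCutoff x τ y),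
        abs_of_nonneg (pointCutoff_mem_Icc y).1]
      exact mul_le_of_le_one_right (norm_nonneg _) (pointCutoff_mem_Icc y).2
    · filter_upwards [haex] with y hy
      refine tendsto_const_nhds.congr' ?_
      filter_upwards [eventually_pointCutoff_eq_one hy.2] with κ hκ
      rw [hκ.self_of_nhds, mul_one]
  have hl2 : Tendsto (fun κ : ℝ => ∫ y in Ω,
      (pointCutoff x κ y * fderiv ℝ Φ y (m y) + Φ y * fderiv ℝ (pointCutoff x κ) y (m y))) atTop
      (𝓝 (∫ y in Ω, fderiv ℝ Φ y (m y))) := by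
    refine tendsto_integral_filter_of_dominated_convergence
      (fun y => ‖fderiv ℝ Φ y (m y)‖ + B * L * M * ‖y - x‖ ^ (-(3 / 2) : ℝ)) ?_ ?_
      (hi1.norm.add (hk2.const_mul _)) ?_
    · exact Eventually.of_forall fun κ => (hI1 κ).aestronglyMeasurable.add (hcm2 κ)
    · refine Eventually.of_forall fun κ => ?_
      filter_upwards [hbd2 κ] with y hy
      refine (norm_add_le _ _).trans (add_le_add ?_ hy)
      rw [norm_mul, Real.norm_eq_abs (pointCutoff x κ y), abs_of_nonneg (pointCutoff_mem_Icc y).1]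
      exact mul_le_of_le_one_left (norm_nonneg _) (pointCutoff_mem_Icc y).2
    · filter_upwards [haex] with y hy
      refine tendsto_const_nhds.congr' ?_
      filter_upwards [eventually_pointCutoff_eq_one hy.2] with κ hκ
      have h0 : fderiv ℝ (pointCutoff x κ) y = 0 := by
        have : pointCutoff x κ =ᶠ[𝓝 y] fun _ => 1 := hκ
        rw [this.fderiv_eq]; simp
      rw [hκ.self_of_nhds, h0]; simp
  refine tendsto_nhds_unique hl1 (hl2.neg.congr' ?_)
  filter_upwards [eventually_gt_atTop 0] with κ hκ
  rw [hcut κ hκ]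
  congr 1
  refine integral_congr_ae ?_
  filter_upwards [haex] with y hy
  exact (hprodd κ y hy).symm

/-! ### Interior balls and one-sided derivatives at the boundary. -/

/-- The derivative of `h` is Lipschitz near `0`, and the mean value inequality is applied to `h`
minus its tangent on the interval of radius `|s|`. -/
theorem exists_quadratic_bound {h : ℝ → ℝ} (hh : ContDiffAt ℝ 2 h 0) :
    ∃ M δ : ℝ, 0 < M ∧ 0 < δ ∧ ∀ s, |s| < δ → h s - h 0 - deriv h 0 * s ≤ M * s ^ 2 := by
  have hd : ContDiffAt ℝ 1 (deriv h) 0 := by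
    have h1 : ContDiffAt ℝ 1 (fderiv ℝ h) 0 := hh.fderiv_right (by norm_num)
    exact h1.clm_apply contDiffAt_const
  obtain ⟨K, U, hU, hK⟩ := hd.exists_lipschitzOnWith
  have hdiff : ∀ᶠ s in 𝓝 (0 : ℝ), DifferentiableAt ℝ h s := by
    filter_upwards [hh.eventually (by simp)] with s hs using hs.differentiableAt (by simp)
  obtain ⟨δ, hδ, hsub⟩ := Metric.mem_nhds_iff.1 (inter_mem hU hdiff)
  refine ⟨K + 1, δ, by positivity, hδ, fun s hs => ?_⟩
  have hmem : ∀ τ ∈ Metric.closedBall (0 : ℝ) |s|, τ ∈ U ∩ {s | DifferentiableAt ℝ h s} :=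
    fun τ hτ => hsub (by simp at hτ ⊢; linarith)
  have key := (convex_closedBall (0 : ℝ) |s|).norm_image_sub_le_of_norm_hasDerivWithin_le
    (f := fun τ => h τ - deriv h 0 * τ) (f' := fun τ => deriv h τ - deriv h 0) (C := K * |s|)
    (x := 0) (y := s) ?_ ?_ (by simp) (by simp)
  · rw [sub_zero, Real.norm_eq_abs, Real.norm_eq_abs, mul_assoc, ← sq, sq_abs] at key
    have := (le_abs_self _).trans key
    simp only [mul_zero, sub_zero] at this
    nlinarith [sq_nonneg s]
  · intro τ hτ
    have h1 := (hmem τ hτ).2.hasDerivAt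
    have h2 := (hasDerivAt_id τ).const_mul (deriv h 0)
    simpa using! (h1.sub h2).hasDerivWithinAt
  · intro τ hτ
    have h1 := hK.dist_le_mul τ (hmem τ hτ).1 0 (mem_of_mem_nhds hU)
    rw [Real.dist_eq, Real.dist_eq, sub_zero] at h1
    refine h1.trans ?_
    have : |τ| ≤ |s| := by simpa using hτ
    gcongr

/-- The interior ball condition for domains with `C²` boundary. -/
theorem HasC21Boundary.exists_interior_ball {Ω : Set ℂ} (hΩ : IsOpen Ω) (hb : HasC21Boundary Ω)
    {p : ℂ} (hp : p ∈ frontier Ω) :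
    ∃ (c : ℂ) (R : ℝ), 0 < R ∧ ‖p - c‖ = R ∧ Metric.ball c R ⊆ Ω := by
  obtain ⟨e, r, h, K, he, hr, hh, -, hiff⟩ := hb p hp
  have hhat : ContDiffAt ℝ 2 h 0 := hh.contDiffAt (Ioo_mem_nhds (by linarith) hr)
  obtain ⟨M, δ, hM, hδ, hbound⟩ := exists_quadratic_bound hhat
  have he0 : e ≠ 0 := by rintro rfl; simp at he
  have hsurj : ∀ w : ℂ, p + e * ((w - p) / e) = w := fun w => by field_simp; ring
  have hnorm : ∀ w : ℂ, ‖(w - p) / e‖ = ‖w - p‖ := fun w => by rw [norm_div, he, div_one]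
  -- Not part of the chart data: `h 0 ≤ 0` because `p` is a limit of points of `Ω`, and `0 ≤ h 0`
  -- because `p ∉ Ω`.
  have h0 : h 0 = 0 := by
    refine le_antisymm ?_ ?_
    · have hpc : p ∈ closure Ω := frontier_subset_closure hp
      have hcont : ContinuousAt (fun w : ℂ => ((w - p) / e).im - h ((w - p) / e).re) p := by
        have h1 : ContinuousAt (fun w : ℂ => ((w - p) / e).re) p := by fun_prop
        have h2 : ContinuousAt (fun w : ℂ => ((w - p) / e).im) p := by fun_prop
        have h3 : ContinuousAt h ((p - p) / e).re := by simpa using hhat.continuousAt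
        exact h2.sub (ContinuousAt.comp (f := fun w : ℂ => ((w - p) / e).re) h3 h1)
      have : (0 : ℝ) ≤ ((p - p) / e).im - h ((p - p) / e).re := by
        have := mem_closure_iff_nhdsWithin_neBot.1 hpc
        refine ge_of_tendsto (hcont.mono_left nhdsWithin_le_nhds : Tendsto _ (𝓝[Ω] p) _) ?_
        filter_upwards [self_mem_nhdsWithin,
          nhdsWithin_le_nhds (Metric.ball_mem_nhds p hr)] with w hw hwr
        have := (hiff ((w - p) / e) (by rw [hnorm, ← dist_eq_norm]; exact hwr)).1
          (by rwa [hsurj])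
        linarith
      simp at this; exact this
    · have hpn : p ∉ Ω := by
        rw [hΩ.frontier_eq] at hp; exact hp.2
      have := (hiff 0 (by simpa using hr)).not.1 (by simpa using hpn)
      simpa using this
  set a := deriv h 0 with ha
  set N := Real.sqrt (1 + a ^ 2) with hN
  have hN1 : 1 ≤ N := by rw [hN]; exact Real.one_le_sqrt.2 (by nlinarith [sq_nonneg a])
  have hN2 : N ^ 2 = 1 + a ^ 2 := Real.sq_sqrt (by positivity)
  -- The ball has diameter `2R`: it must fit in the chart and in the range of the quadratic bound,
  -- and `2RM ≤ 1` makes the circle curve at least as much as the parabola above the graph.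
  set R := min (min (r / 2) (δ / 2)) (1 / (2 * M)) with hR
  have hR0 : 0 < R := by positivity
  have hRr : R ≤ r / 2 := (min_le_left _ _).trans (min_le_left _ _)
  have hRδ : R ≤ δ / 2 := (min_le_left _ _).trans (min_le_right _ _)
  have hRM : 2 * R * M ≤ 1 := by
    have : R ≤ 1 / (2 * M) := min_le_right _ _
    rw [le_div_iff₀ (by positivity)] at this; linarith
  -- The unit normal to the graph at the origin, on the side of `Ω`, in chart coordinates.
  set ν : ℂ := ⟨-a / N, 1 / N⟩ with hν
  have hνn : ‖ν‖ = 1 := by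
    rw [Complex.norm_def, Complex.normSq_mk]
    rw [show -a / N * (-a / N) + 1 / N * (1 / N) = (1 + a ^ 2) / N ^ 2 by field_simp; ring, hN2,
      div_self (by positivity), Real.sqrt_one]
  refine ⟨p + e * (R * ν), R, hR0, ?_, fun w hw => ?_⟩
  · rw [sub_add_cancel_left, norm_neg, norm_mul, norm_mul, he, hνn]
    simp [abs_of_pos hR0]
  · set z := (w - p) / e with hz
    have hzw : w = p + e * z := (hsurj w).symm
    have hzR : ‖z - R * ν‖ < R := by
      have h1 : w - (p + e * (R * ν)) = e * (z - R * ν) := by rw [hzw]; ring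
      rw [Metric.mem_ball, dist_eq_norm, h1, norm_mul, he, one_mul] at hw
      exact hw
    have hz2 : ‖z‖ < 2 * R := by
      have h1 : ‖(R : ℂ) * ν‖ = R := by rw [norm_mul, hνn]; simp [abs_of_pos hR0]
      have := norm_le_norm_add_norm_sub' z (R * ν)
      rw [h1] at this
      linarith
    rw [hzw, hiff z (by linarith)]
    have hre : |z.re| < δ := (Complex.abs_re_le_norm z).trans_lt (by linarith)
    have hb := hbound z.re hre
    rw [h0] at hb
    have hsq : ‖z - R * ν‖ ^ 2 < R ^ 2 := by
      have := norm_nonneg (z - R * ν); nlinarith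
    rw [Complex.sq_norm, Complex.normSq_apply] at hsq
    simp [hν] at hsq
    have e1 : (z.re - R * (-a / N)) * (z.re - R * (-a / N)) +
        (z.im - R * N⁻¹) * (z.im - R * N⁻¹) =
        z.re ^ 2 + z.im ^ 2 + R ^ 2 * ((1 + a ^ 2) / N ^ 2) - 2 * R * (z.im - a * z.re) / N := by
      field_simp; ring
    rw [e1, hN2, div_self (by positivity), mul_one] at hsq
    have e2 : z.re ^ 2 + z.im ^ 2 < 2 * R * (z.im - a * z.re) / N := by linarith
    rw [lt_div_iff₀ (by positivity)] at e2
    have e3 : z.re ^ 2 < 2 * R * (z.im - a * z.re) := by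
      nlinarith [sq_nonneg z.re, sq_nonneg z.im]
    have e4 : M * z.re ^ 2 < z.im - a * z.re := by
      have h1 : M * z.re ^ 2 < M * (2 * R * (z.im - a * z.re)) := by gcongr
      have h2 : 0 ≤ z.im - a * z.re := by
        by_contra! hneg
        nlinarith [sq_nonneg z.re]
      nlinarith
    linarith

/-- An interior ball touching at `p` is convex with nonempty interior and has `p` in its closure;
unique differentiability then passes to the larger set. This gives meaning to `fderivWithin` on
`closure Ω`. -/
theorem IsC21Domain.uniqueDiffOn {Ω : Set ℂ} (hΩ : IsC21Domain Ω) :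
    UniqueDiffOn ℝ (closure Ω) := by
  intro p hp
  by_cases hpΩ : p ∈ Ω
  · exact (hΩ.isOpen.uniqueDiffWithinAt hpΩ).mono subset_closure
  · obtain ⟨c, R, hR, hpc, hsub⟩ := hΩ.boundary.exists_interior_ball hΩ.isOpen
      (by rw [hΩ.isOpen.frontier_eq]; exact ⟨hp, hpΩ⟩ : p ∈ frontier Ω)
    refine (uniqueDiffWithinAt_convex (convex_ball c R) ?_ ?_).mono (hsub.trans subset_closure)
    · rw [Metric.isOpen_ball.interior_eq]; exact Metric.nonempty_ball.2 hR
    · rw [closure_ball c hR.ne', Metric.mem_closedBall, dist_eq_norm, hpc]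

theorem IsC21Domain.isCompact_closure {Ω : Set ℂ} (hΩ : IsC21Domain Ω) : IsCompact (closure Ω) :=
  hΩ.isBounded.isCompact_closure

/-- The complex derivative of `φ`, with one-sided values at the boundary. -/
def cderiv (Ω : Set ℂ) (φ : ℂ → ℂ) (y : ℂ) : ℂ := fderivWithin ℝ φ (closure Ω) y 1

theorem fderivWithin_closure_of_mem {E : Type*} [NormedAddCommGroup E] [NormedSpace ℝ E]
    {Ω : Set ℂ} (hΩ : IsOpen Ω) (f : ℂ → E) {y : ℂ} (hy : y ∈ Ω) :
    fderivWithin ℝ f (closure Ω) y = fderiv ℝ f y :=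
  fderivWithin_of_mem_nhds (mem_of_superset (hΩ.mem_nhds hy) subset_closure)

/-! ### The conformal map up to the boundary: complex derivative, nonvanishing, inverse. -/

section conformal

variable {Ω : Set ℂ} {φ : ℂ → ℂ}

theorem IsConformalOntoDisc.continuousOn_cderiv (hΩ : IsC21Domain Ω)
    (hφ : IsConformalOntoDisc Ω φ) : ContinuousOn (cderiv Ω φ) (closure Ω) :=
  (hφ.contDiffOn.continuousOn_fderivWithin hΩ.uniqueDiffOn (by norm_num)).clm_apply
    continuousOn_const

theorem IsConformalOntoDisc.hasDerivAt (hΩ : IsC21Domain Ω) (hφ : IsConformalOntoDisc Ω φ)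
    {y : ℂ} (hy : y ∈ Ω) : HasDerivAt φ (cderiv Ω φ y) y := by
  have h := (hφ.holomorphic.differentiableAt (hΩ.isOpen.mem_nhds hy)).hasDerivAt
  have : cderiv Ω φ y = deriv φ y := by
    rw [cderiv, fderivWithin_closure_of_mem hΩ.isOpen φ hy, h.complexToReal_fderiv.fderiv]
    simp
  rwa [this]

/-- Complex linearity of the derivative holds in `Ω` and extends to the boundary by continuity and
density. -/
theorem IsConformalOntoDisc.fderivWithin_apply (hΩ : IsC21Domain Ω)
    (hφ : IsConformalOntoDisc Ω φ) {y : ℂ} (hy : y ∈ closure Ω) (v : ℂ) :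
    fderivWithin ℝ φ (closure Ω) y v = cderiv Ω φ y * v := by
  have hc := hφ.contDiffOn.continuousOn_fderivWithin hΩ.uniqueDiffOn (by norm_num)
  have h1 : EqOn (fun y => fderivWithin ℝ φ (closure Ω) y v) (fun y => cderiv Ω φ y * v)
      (closure Ω) := by
    refine EqOn.of_subset_closure (s := Ω) ?_ (hc.clm_apply continuousOn_const)
      ((hφ.continuousOn_cderiv hΩ).mul continuousOn_const) subset_closure subset_rfl
    intro z hz
    simp only [fderivWithin_closure_of_mem hΩ.isOpen φ hz]
    rw [(hφ.hasDerivAt hΩ hz).complexToReal_fderiv.fderiv]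
    simp
  exact h1 hy

theorem IsConformalOntoDisc.hasFDerivWithinAt (hΩ : IsC21Domain Ω)
    (hφ : IsConformalOntoDisc Ω φ) {y : ℂ} (hy : y ∈ closure Ω) :
    HasFDerivWithinAt φ (cderiv Ω φ y • (1 : ℂ →L[ℝ] ℂ)) (closure Ω) y := by
  have h := (hφ.contDiffOn.differentiableOn (by norm_num) y hy).hasFDerivWithinAt
  have e : cderiv Ω φ y • (1 : ℂ →L[ℝ] ℂ) = fderivWithin ℝ φ (closure Ω) y :=
    ContinuousLinearMap.ext fun v => by rw [hφ.fderivWithin_apply hΩ hy]; simp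
  rwa [e]

theorem IsConformalOntoDisc.norm_lt_one (hφ : IsConformalOntoDisc Ω φ) {y : ℂ}
    (hy : y ∈ Ω) : ‖φ y‖ < 1 := mem_ball_zero_iff.1 (hφ.bijOn_interior.mapsTo hy)

theorem IsConformalOntoDisc.norm_eq_one (hφ : IsConformalOntoDisc Ω φ) {y : ℂ}
    (hy : y ∈ frontier Ω) : ‖φ y‖ = 1 := mem_sphere_zero_iff_norm.1 (hφ.bijOn_boundary.mapsTo hy)

theorem IsConformalOntoDisc.bijOn_closure (hφ : IsConformalOntoDisc Ω φ) :
    BijOn φ (closure Ω) (Metric.closedBall 0 1) := by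
  rw [closure_eq_self_union_frontier, ← Metric.ball_union_sphere]
  refine hφ.bijOn_interior.union hφ.bijOn_boundary ?_
  rintro x (hx | hx) y (hy | hy) hxy
  · exact hφ.bijOn_interior.injOn hx hy hxy
  · have h1 := hφ.norm_lt_one hx; have h2 := hφ.norm_eq_one hy; rw [hxy] at h1; linarith
  · have h1 := hφ.norm_eq_one hx; have h2 := hφ.norm_lt_one hy; rw [hxy] at h1; linarith
  · exact hφ.bijOn_boundary.injOn hx hy hxy

/-- The algebraic identity behind the Schwarz-Pick lemma. -/
theorem one_sub_norm_sq_moebius (b w : ℂ) (h : 1 - starRingEnd ℂ b * w ≠ 0) :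
    1 - ‖(w - b) / (1 - starRingEnd ℂ b * w)‖ ^ 2 =
      (1 - ‖b‖ ^ 2) * (1 - ‖w‖ ^ 2) / ‖1 - starRingEnd ℂ b * w‖ ^ 2 := by
  have h1 : ‖1 - starRingEnd ℂ b * w‖ ^ 2 ≠ 0 := by simpa using h
  rw [norm_div, div_pow, eq_div_iff h1, sub_mul, div_mul_cancel₀ _ h1, one_mul]
  simp only [Complex.sq_norm, Complex.normSq_apply]
  simp
  ring

theorem one_sub_conj_mul_ne_zero {b w : ℂ} (hb : ‖b‖ < 1) (hw : ‖w‖ ≤ 1) :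
    1 - starRingEnd ℂ b * w ≠ 0 := by
  intro h
  have : ‖starRingEnd ℂ b * w‖ = 1 := by rw [← sub_eq_zero.1 h]; simp
  rw [norm_mul, RCLike.norm_conj] at this
  nlinarith [norm_nonneg b, norm_nonneg w]

theorem one_sub_norm_le_norm_one_sub_conj_mul {b w : ℂ} (hw : ‖w‖ ≤ 1) :
    1 - ‖b‖ ≤ ‖1 - starRingEnd ℂ b * w‖ := by
  have h1 := norm_sub_norm_le (1 : ℂ) (starRingEnd ℂ b * w)
  rw [norm_mul, RCLike.norm_conj, norm_one] at h1
  nlinarith [norm_nonneg b, norm_nonneg w]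

/-- A Hopf type lower bound: a holomorphic map of a disc into the unit disc. -/
theorem exists_one_sub_norm_sq_lower_bound {f : ℂ → ℂ} {c : ℂ} {R : ℝ} (hR : 0 < R)
    (hf : DifferentiableOn ℂ f (Metric.ball c R))
    (hmaps : MapsTo f (Metric.ball c R) (Metric.ball 0 1)) :
    ∃ κ : ℝ, 0 < κ ∧ ∀ w ∈ Metric.ball c R, κ * (1 - ‖w - c‖ / R) ≤ 1 - ‖f w‖ ^ 2 := by
  set b := f c with hb
  have hb1 : ‖b‖ < 1 := mem_ball_zero_iff.1 (hmaps (Metric.mem_ball_self hR))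
  have hle : ∀ w ∈ Metric.ball c R, ‖f w‖ < 1 := fun w hw => mem_ball_zero_iff.1 (hmaps hw)
  have hne : ∀ w ∈ Metric.ball c R, 1 - starRingEnd ℂ b * f w ≠ 0 := fun w hw =>
    one_sub_conj_mul_ne_zero hb1 (hle w hw).le
  refine ⟨(1 - ‖b‖) ^ 2, by have : 0 < 1 - ‖b‖ := by linarith
                            positivity, fun w hw => ?_⟩
  -- A Möbius map moves the central value to `0`, so that Schwarz's lemma bounds `‖g w‖` by `‖w - c‖
  -- / R`; `one_sub_norm_sq_moebius` turns this back into a statement on `f`.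
  set g : ℂ → ℂ := fun w => (f w - b) / (1 - starRingEnd ℂ b * f w) with hg
  have hgd : DifferentiableOn ℂ g (Metric.ball c R) :=
    (hf.sub_const b).div ((differentiableOn_const _).sub (hf.const_mul _)) hne
  have hgid : ∀ w ∈ Metric.ball c R, 1 - ‖g w‖ ^ 2 =
      (1 - ‖b‖ ^ 2) * (1 - ‖f w‖ ^ 2) / ‖1 - starRingEnd ℂ b * f w‖ ^ 2 := fun w hw =>
    one_sub_norm_sq_moebius b (f w) (hne w hw)
  have hgc : g c = 0 := by simp [hg, hb]
  have hgm : MapsTo g (Metric.ball c R) (Metric.ball (g c) 1) := by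
    intro w hw
    rw [hgc, mem_ball_zero_iff]
    have h1 : 0 < 1 - ‖g w‖ ^ 2 := by
      rw [hgid w hw]
      have := hle w hw
      have h2 : 0 < 1 - ‖f w‖ ^ 2 := by nlinarith [norm_nonneg (f w)]
      have h3 : 0 < 1 - ‖b‖ ^ 2 := by nlinarith [norm_nonneg b]
      have h4 : 0 < ‖1 - starRingEnd ℂ b * f w‖ := norm_pos_iff.2 (hne w hw)
      positivity
    nlinarith [norm_nonneg (g w)]
  have hs := Complex.dist_le_div_mul_dist_of_mapsTo_ball hgd
    (hgm.mono_right Metric.ball_subset_closedBall) hw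
  rw [hgc, dist_zero_right, dist_eq_norm, one_div, inv_mul_eq_div] at hs
  have hlt : ‖w - c‖ / R < 1 := by
    rw [div_lt_one hR, ← dist_eq_norm]; exact hw
  have h0 : 0 ≤ ‖w - c‖ / R := by positivity
  have h1 : 1 - ‖w - c‖ / R ≤ 1 - ‖g w‖ ^ 2 := by nlinarith [norm_nonneg (g w)]
  rw [hgid w hw, le_div_iff₀ (by have := norm_pos_iff.2 (hne w hw); positivity)] at h1
  have h2 := one_sub_norm_le_norm_one_sub_conj_mul (b := b) (hle w hw).le
  have h3 : (1 - ‖b‖) ^ 2 ≤ ‖1 - starRingEnd ℂ b * f w‖ ^ 2 := by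
    have : 0 ≤ 1 - ‖b‖ := by linarith
    gcongr
  have h4 : 0 ≤ 1 - ‖f w‖ ^ 2 := by nlinarith [norm_nonneg (f w), hle w hw]
  calc (1 - ‖b‖) ^ 2 * (1 - ‖w - c‖ / R)
      ≤ (1 - ‖w - c‖ / R) * ‖1 - starRingEnd ℂ b * f w‖ ^ 2 := by
        rw [mul_comm]; gcongr
    _ ≤ (1 - ‖b‖ ^ 2) * (1 - ‖f w‖ ^ 2) := h1
    _ ≤ 1 - ‖f w‖ ^ 2 := mul_le_of_le_one_left h4 (by nlinarith [norm_nonneg b])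

/-- Hopf's argument: along the radius of an interior ball ending at `p`, `1 - |φ|²` grows at least
linearly with the distance to `p`, whereas a zero derivative would make `φ - φ p` sublinear. -/
theorem IsConformalOntoDisc.cderiv_ne_zero_of_frontier (hΩ : IsC21Domain Ω)
    (hφ : IsConformalOntoDisc Ω φ) {p : ℂ} (hp : p ∈ frontier Ω) : cderiv Ω φ p ≠ 0 := by
  intro h0
  obtain ⟨c, R, hR, hpc, hsub⟩ := hΩ.boundary.exists_interior_ball hΩ.isOpen hp
  obtain ⟨κ, hκ, hlow⟩ := exists_one_sub_norm_sq_lower_bound hR (hφ.holomorphic.mono hsub)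
    (hφ.bijOn_interior.mapsTo.mono_left hsub)
  have hd := hφ.hasFDerivWithinAt hΩ (frontier_subset_closure hp)
  have e0 : (0 : ℂ) • (1 : ℂ →L[ℝ] ℂ) = 0 := ContinuousLinearMap.ext fun v => by simp
  rw [h0, e0, hasFDerivWithinAt_iff_isLittleO] at hd
  -- At distance `sR` from `p` the lower bound is `1 - |φ|² ≥ κs`, while this choice yields `1 - |φ|
  -- ≤ κs/4`; the two conflict because `1 - |φ|² ≤ 2(1 - |φ|)`.
  have hd2 := hd.def (c := κ / (4 * R)) (by positivity)
  rw [eventually_nhdsWithin_iff, Metric.eventually_nhds_iff] at hd2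
  obtain ⟨δ, hδ, hd2⟩ := hd2
  set s : ℝ := min (1 / 2) (δ / (2 * R)) with hs
  have hs0 : 0 < s := by positivity
  have hs1 : s ≤ 1 / 2 := min_le_left _ _
  have hs2 : s * R < δ := by
    have : s ≤ δ / (2 * R) := min_le_right _ _
    rw [le_div_iff₀ (by positivity)] at this; nlinarith
  set w := p + s * (c - p) with hw
  have hwp : ‖w - p‖ = s * R := by
    rw [hw, add_sub_cancel_left, norm_mul, norm_sub_rev, hpc]; simp [abs_of_pos hs0]
  have hwc : ‖w - c‖ = (1 - s) * R := by
    have : w - c = ((1 - s : ℝ) : ℂ) * (p - c) := by rw [hw]; push_cast; ring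
    rw [this, norm_mul, hpc, Complex.norm_real, Real.norm_of_nonneg (by linarith)]
  have hwb : w ∈ Metric.ball c R := by
    rw [Metric.mem_ball, dist_eq_norm, hwc]; nlinarith
  have h1 := hlow w hwb
  rw [hwc, mul_div_assoc, div_self hR.ne', mul_one, sub_sub_cancel] at h1
  have h2 := hd2 (y := w) (by rwa [dist_eq_norm, hwp]) (subset_closure (hsub hwb))
  simp only [zero_apply, sub_zero, hwp] at h2
  have h3 : κ / (4 * R) * (s * R) = κ * s / 4 := by field_simp
  rw [h3] at h2
  have h4 := hφ.norm_eq_one hp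
  have h5 := norm_sub_norm_le (φ p) (φ w)
  have h6 := hφ.norm_lt_one (hsub hwb)
  rw [norm_sub_rev] at h5
  nlinarith [norm_nonneg (φ w), mul_pos hκ hs0]

/-- The inverse of `φ` on the closed unit disc. -/
def discInv (Ω : Set ℂ) (φ : ℂ → ℂ) : ℂ → ℂ := Function.invFunOn φ (closure Ω)

theorem IsConformalOntoDisc.discInv_mem_closure (hφ : IsConformalOntoDisc Ω φ) {z : ℂ}
    (hz : z ∈ Metric.closedBall (0 : ℂ) 1) : discInv Ω φ z ∈ closure Ω :=
  Function.invFunOn_mem (hφ.bijOn_closure.surjOn hz)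

theorem IsConformalOntoDisc.apply_discInv (hφ : IsConformalOntoDisc Ω φ) {z : ℂ}
    (hz : z ∈ Metric.closedBall (0 : ℂ) 1) : φ (discInv Ω φ z) = z :=
  Function.invFunOn_eq (hφ.bijOn_closure.surjOn hz)

theorem IsConformalOntoDisc.discInv_apply (hφ : IsConformalOntoDisc Ω φ) {y : ℂ}
    (hy : y ∈ closure Ω) : discInv Ω φ (φ y) = y :=
  hφ.bijOn_closure.invOn_invFunOn.1 hy

theorem IsConformalOntoDisc.discInv_mem (hφ : IsConformalOntoDisc Ω φ) {z : ℂ}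
    (hz : z ∈ Metric.ball (0 : ℂ) 1) : discInv Ω φ z ∈ Ω := by
  obtain ⟨y, hy, rfl⟩ := hφ.bijOn_interior.surjOn hz
  rwa [hφ.discInv_apply (subset_closure hy)]

theorem IsConformalOntoDisc.discInv_mem_frontier (hφ : IsConformalOntoDisc Ω φ) {z : ℂ}
    (hz : z ∈ Metric.sphere (0 : ℂ) 1) : discInv Ω φ z ∈ frontier Ω := by
  obtain ⟨y, hy, rfl⟩ := hφ.bijOn_boundary.surjOn hz
  rwa [hφ.discInv_apply (frontier_subset_closure hy)]

/-- A continuous bijection from a compact set is a closed map. -/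
theorem IsConformalOntoDisc.continuousOn_discInv (hΩ : IsC21Domain Ω)
    (hφ : IsConformalOntoDisc Ω φ) : ContinuousOn (discInv Ω φ) (Metric.closedBall 0 1) := by
  rw [continuousOn_iff_isClosed]
  intro t ht
  refine ⟨φ '' (closure Ω ∩ t), ?_, ?_⟩
  · exact ((hΩ.isCompact_closure.inter_right ht).image_of_continuousOn
      (hφ.contDiffOn.continuousOn.mono inter_subset_left)).isClosed
  · ext z
    constructor
    · rintro ⟨h1, h2⟩
      exact ⟨⟨_, ⟨hφ.discInv_mem_closure h2, h1⟩, hφ.apply_discInv h2⟩, h2⟩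
    · rintro ⟨⟨y, ⟨hy, hyt⟩, rfl⟩, h2⟩
      refine ⟨?_, h2⟩
      rw [mem_preimage, hφ.discInv_apply hy]; exact hyt

theorem IsConformalOntoDisc.continuousAt_discInv (hΩ : IsC21Domain Ω)
    (hφ : IsConformalOntoDisc Ω φ) {z : ℂ} (hz : z ∈ Metric.ball (0 : ℂ) 1) :
    ContinuousAt (discInv Ω φ) z :=
  (hφ.continuousOn_discInv hΩ).continuousAt
    (mem_of_superset (Metric.isOpen_ball.mem_nhds hz) Metric.ball_subset_closedBall)

theorem IsConformalOntoDisc.hasDerivAt_discInv_of_ne_zero (hΩ : IsC21Domain Ω)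
    (hφ : IsConformalOntoDisc Ω φ) {z : ℂ} (hz : z ∈ Metric.ball (0 : ℂ) 1)
    (h0 : cderiv Ω φ (discInv Ω φ z) ≠ 0) :
    HasDerivAt (discInv Ω φ) (cderiv Ω φ (discInv Ω φ z))⁻¹ z := by
  refine HasDerivAt.of_local_left_inverse (hφ.continuousAt_discInv hΩ hz)
    (hφ.hasDerivAt hΩ (hφ.discInv_mem hz)) h0 ?_
  filter_upwards [Metric.isOpen_ball.mem_nhds hz] with w hw
  exact hφ.apply_discInv (Metric.ball_subset_closedBall hw)

/-- At interior points injectivity makes the zeros of `φ'` isolated. The inverse is then holomorphic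
in a punctured neighbourhood of the image of such a zero and continuous at it, hence holomorphic
there as well, and the chain rule for `φ⁻¹ ∘ φ` excludes `φ' = 0`. -/
theorem IsConformalOntoDisc.cderiv_ne_zero (hΩ : IsC21Domain Ω)
    (hφ : IsConformalOntoDisc Ω φ) {y : ℂ} (hy : y ∈ closure Ω) : cderiv Ω φ y ≠ 0 := by
  rw [closure_eq_self_union_frontier] at hy
  rcases hy with hy | hy
  swap
  · exact hφ.cderiv_ne_zero_of_frontier hΩ hy
  have hyn := hΩ.isOpen.mem_nhds hy
  have hcd : ∀ z ∈ Ω, cderiv Ω φ z = deriv φ z := fun z hz => (hφ.hasDerivAt hΩ hz).deriv.symm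
  have han : AnalyticAt ℂ φ y := hφ.holomorphic.analyticAt hyn
  have hz : φ y ∈ Metric.ball (0 : ℂ) 1 := hφ.bijOn_interior.mapsTo hy
  -- the derivative does not vanish in a punctured neighbourhood
  have hpunct : ∀ᶠ w in 𝓝[≠] y, cderiv Ω φ w ≠ 0 := by
    rcases han.deriv.eventually_eq_zero_or_eventually_ne_zero with h | h
    · exfalso
      obtain ⟨r, hr, hball⟩ := Metric.mem_nhds_iff.1 (inter_mem hyn h)
      have hconst : ∀ w ∈ Metric.ball y r, φ w = φ y := by
        intro w hw
        refine Metric.isOpen_ball.is_const_of_deriv_eq_zero (convex_ball y r).isPreconnected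
          (hφ.holomorphic.mono fun z hz => (hball hz).1) (fun z hz => (hball hz).2) hw
          (Metric.mem_ball_self hr)
      have hmem : y + (r / 2 : ℝ) ∈ Metric.ball y r := by
        simp [abs_of_pos hr]; linarith
      have := hφ.bijOn_interior.injOn (hball hmem).1 hy (hconst _ hmem)
      simp at this; linarith
    · filter_upwards [h, nhdsWithin_le_nhds hyn] with w hw hwΩ
      rwa [hcd w hwΩ]
  have hdiff : ∀ᶠ w in 𝓝[≠] φ y, DifferentiableAt ℂ (discInv Ω φ) w := by
    have hcont := hφ.continuousAt_discInv hΩ hz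
    have ht : Tendsto (discInv Ω φ) (𝓝[≠] φ y) (𝓝[≠] y) := by
      refine tendsto_nhdsWithin_iff.2 ⟨?_, ?_⟩
      · have := hcont.tendsto
        rw [hφ.discInv_apply (subset_closure hy)] at this
        exact this.mono_left nhdsWithin_le_nhds
      · filter_upwards [self_mem_nhdsWithin,
          nhdsWithin_le_nhds (Metric.isOpen_ball.mem_nhds hz)] with w hw hwb hwy
        refine hw ?_
        rw [← hφ.apply_discInv (Metric.ball_subset_closedBall hwb), mem_singleton_iff.1 hwy]
        rfl
    filter_upwards [ht.eventually hpunct,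
      nhdsWithin_le_nhds (Metric.isOpen_ball.mem_nhds hz)] with w hw hwb
    exact (hφ.hasDerivAt_discInv_of_ne_zero hΩ hwb hw).differentiableAt
  have hψ : DifferentiableAt ℂ (discInv Ω φ) (φ y) :=
    (Complex.analyticAt_of_differentiable_on_punctured_nhds_of_continuousAt hdiff
      (hφ.continuousAt_discInv hΩ hz)).differentiableAt
  have hcomp := hψ.hasDerivAt.comp y (hφ.hasDerivAt hΩ hy)
  have hid : discInv Ω φ ∘ φ =ᶠ[𝓝 y] id := by
    filter_upwards [hyn] with w hw using hφ.discInv_apply (subset_closure hw)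
  have h1 := (hcomp.congr_of_eventuallyEq hid.symm).unique (hasDerivAt_id y)
  exact right_ne_zero_of_mul (h1 ▸ one_ne_zero)

theorem IsConformalOntoDisc.hasDerivAt_discInv (hΩ : IsC21Domain Ω)
    (hφ : IsConformalOntoDisc Ω φ) {z : ℂ} (hz : z ∈ Metric.ball (0 : ℂ) 1) :
    HasDerivAt (discInv Ω φ) (cderiv Ω φ (discInv Ω φ z))⁻¹ z :=
  hφ.hasDerivAt_discInv_of_ne_zero hΩ hz
    (hφ.cderiv_ne_zero hΩ (subset_closure (hφ.discInv_mem hz)))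

theorem IsConformalOntoDisc.exists_cderiv_bounds (hΩ : IsC21Domain Ω)
    (hφ : IsConformalOntoDisc Ω φ) : ∃ A : ℝ, 0 < A ∧
      ∀ y ∈ closure Ω, ‖cderiv Ω φ y‖ ≤ A ∧ ‖(cderiv Ω φ y)⁻¹‖ ≤ A := by
  have hc := hφ.continuousOn_cderiv hΩ
  obtain ⟨A, hA⟩ := hΩ.isCompact_closure.exists_bound_of_continuousOn hc
  obtain ⟨A', hA'⟩ := hΩ.isCompact_closure.exists_bound_of_continuousOn
    (hc.inv₀ fun y hy => hφ.cderiv_ne_zero hΩ hy)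
  exact ⟨max 1 (max A A'), by positivity, fun y hy =>
    ⟨(hA y hy).trans ((le_max_left _ _).trans (le_max_right _ _)),
      (hA' y hy).trans ((le_max_right _ _).trans (le_max_right _ _))⟩⟩

/-- The mean value inequality is applied to the inverse map, because the disc is convex whereas `Ω`
need not be. The estimate converts singularities in `φ y - φ x` into singularities in `y - x`. -/
theorem IsConformalOntoDisc.exists_norm_sub_le (hΩ : IsC21Domain Ω)
    (hφ : IsConformalOntoDisc Ω φ) : ∃ A : ℝ, 0 < A ∧
      ∀ x ∈ Ω, ∀ y ∈ Ω, ‖x - y‖ ≤ A * ‖φ x - φ y‖ := by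
  obtain ⟨A, hA, hb⟩ := hφ.exists_cderiv_bounds hΩ
  refine ⟨A, hA, fun x hx y hy => ?_⟩
  have := (convex_ball (0 : ℂ) 1).norm_image_sub_le_of_norm_hasDerivWithin_le
    (f := discInv Ω φ) (C := A) (x := φ y) (y := φ x)
    (fun z hz => (hφ.hasDerivAt_discInv hΩ hz).hasDerivWithinAt)
    (fun z hz => (hb _ (subset_closure (hφ.discInv_mem hz))).2)
    (hφ.bijOn_interior.mapsTo hy) (hφ.bijOn_interior.mapsTo hx)
  rwa [hφ.discInv_apply (subset_closure hx), hφ.discInv_apply (subset_closure hy)] at this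

end conformal

/-! ### Boundary layers of `1 - |φ|²` and the action of `φ'` on the normal. -/

theorem det_smul_one (c : ℂ) : (c • (1 : ℂ →L[ℝ] ℂ)).det = ‖c‖ ^ 2 := by
  have h : ((c • (1 : ℂ →L[ℝ] ℂ) : ℂ →L[ℝ] ℂ) : ℂ →ₗ[ℝ] ℂ) = Algebra.lmul ℝ ℂ c := by
    ext; simp
  rw [ContinuousLinearMap.det, h, ← Algebra.norm_apply, Algebra.norm_complex_apply,
    Complex.sq_norm]

theorem coe_nnreal_pi : (NNReal.pi : ℝ≥0∞) = ENNReal.ofReal Real.pi :=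
  (ENNReal.ofReal_eq_coe_nnreal Real.pi_pos.le).symm

theorem volume_disc_layer_le {ε : ℝ} (hε : 0 < ε) :
    volume {z ∈ Metric.ball (0 : ℂ) 1 | 1 - ‖z‖ ^ 2 < ε} ≤ ENNReal.ofReal (Real.pi * ε) := by
  have hpi := Real.pi_pos
  by_cases h1 : 1 ≤ ε
  · calc volume {z ∈ Metric.ball (0 : ℂ) 1 | 1 - ‖z‖ ^ 2 < ε}
        ≤ volume (Metric.ball (0 : ℂ) 1) := measure_mono fun z hz => hz.1
      _ = ENNReal.ofReal Real.pi := by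
        rw [Complex.volume_ball, coe_nnreal_pi]; simp
      _ ≤ _ := ENNReal.ofReal_le_ofReal (by nlinarith)
  · have h1 : ε < 1 := not_le.1 h1
    set s := Real.sqrt (1 - ε) with hs
    have hs2 : s ^ 2 = 1 - ε := Real.sq_sqrt (by linarith)
    have hs0 : 0 ≤ s := Real.sqrt_nonneg _
    have hs1 : s ≤ 1 := by nlinarith
    have hsub : {z ∈ Metric.ball (0 : ℂ) 1 | 1 - ‖z‖ ^ 2 < ε} ⊆
        Metric.ball (0 : ℂ) 1 \ Metric.ball (0 : ℂ) s := by
      rintro z ⟨hz1, hz2⟩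
      refine ⟨hz1, fun hz3 => ?_⟩
      rw [mem_ball_zero_iff] at hz3
      nlinarith [norm_nonneg z]
    refine (measure_mono hsub).trans ?_
    rw [measure_sdiff (Metric.ball_subset_ball hs1) measurableSet_ball.nullMeasurableSet
      (by rw [Complex.volume_ball]; exact ENNReal.mul_ne_top (by simp) (by simp)),
      Complex.volume_ball, Complex.volume_ball]
    rw [coe_nnreal_pi, ← ENNReal.ofReal_pow zero_le_one, ← ENNReal.ofReal_pow hs0,
      ← ENNReal.ofReal_mul (by positivity), ← ENNReal.ofReal_mul (by positivity),
      ← ENNReal.ofReal_sub _ (by positivity), hs2]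
    exact ENNReal.ofReal_le_ofReal (by nlinarith)

theorem isDefiningFunction_disc :
    IsDefiningFunction (Metric.ball (0 : ℂ) 1) (fun z => 1 - ‖z‖ ^ 2) Real.pi where
  contDiffOn := (contDiff_const.sub (contDiff_id.norm_sq ℝ)).contDiffOn
  pos y hy := by
    have : ‖y‖ < 1 := mem_ball_zero_iff.1 hy
    nlinarith [norm_nonneg y]
  isCompact ε hε := by
    have h : {y ∈ Metric.ball (0 : ℂ) 1 | ε ≤ 1 - ‖y‖ ^ 2} =
        {y ∈ Metric.closedBall (0 : ℂ) 1 | ε ≤ 1 - ‖y‖ ^ 2} := by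
      ext z
      simp only [mem_ofPred_eq, mem_ball_zero_iff, mem_closedBall_zero_iff]
      constructor
      · rintro ⟨h1, h2⟩; exact ⟨h1.le, h2⟩
      · rintro ⟨h1, h2⟩; exact ⟨by nlinarith [norm_nonneg z], h2⟩
    rw [h]
    refine (isCompact_closedBall (0 : ℂ) 1).of_isClosed_subset ?_ fun z hz => hz.1
    exact Metric.isClosed_closedBall.inter (isClosed_le continuous_const
      (continuous_const.sub (continuous_norm.pow 2)))
  nonneg := Real.pi_pos.le
  volume_le _ hε := volume_disc_layer_le hε

section conformal

variable {Ω : Set ℂ} {φ : ℂ → ℂ}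

/-- The layers are images of thin annuli of the disc under the inverse map, whose Jacobian `|φ'|⁻²`
is bounded up to the boundary. -/
theorem IsConformalOntoDisc.isDefiningFunction (hΩ : IsC21Domain Ω)
    (hφ : IsConformalOntoDisc Ω φ) :
    ∃ C, IsDefiningFunction Ω (fun y => 1 - ‖φ y‖ ^ 2) C := by
  obtain ⟨A, hA, hb⟩ := hφ.exists_cderiv_bounds hΩ
  refine ⟨A ^ 2 * Real.pi, ?_, ?_, ?_, by positivity, ?_⟩
  · exact contDiffOn_const.sub
      (((hφ.contDiffOn.mono subset_closure).of_le (by norm_num)).norm_sq ℝ)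
  · intro y hy
    have := hφ.norm_lt_one hy
    nlinarith [norm_nonneg (φ y)]
  · intro ε hε
    have h : {y ∈ Ω | ε ≤ 1 - ‖φ y‖ ^ 2} =
        closure Ω ∩ (fun y => 1 - ‖φ y‖ ^ 2) ⁻¹' Ici ε := by
      ext y
      refine ⟨fun h => ⟨subset_closure h.1, h.2⟩, fun h => ⟨?_, h.2⟩⟩
      by_contra hy
      have := hφ.norm_eq_one (by rw [hΩ.isOpen.frontier_eq]; exact ⟨h.1, hy⟩ : y ∈ frontier Ω)
      have h2 : ε ≤ 1 - ‖φ y‖ ^ 2 := h.2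
      rw [this] at h2; linarith
    rw [h]
    refine hΩ.isCompact_closure.of_isClosed_subset ?_ inter_subset_left
    exact (continuousOn_const.sub (hφ.contDiffOn.continuousOn.norm.pow 2)).preimage_isClosed_of_isClosed
      isClosed_closure isClosed_Ici
  · intro ε hε
    set S := {z ∈ Metric.ball (0 : ℂ) 1 | 1 - ‖z‖ ^ 2 < ε} with hS
    have hSm : MeasurableSet S := isDefiningFunction_disc.measurableSet_layer Metric.isOpen_ball ε
    have hsub : {y ∈ Ω | 1 - ‖φ y‖ ^ 2 < ε} ⊆ discInv Ω φ '' S := by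
      rintro y ⟨hy, hyε⟩
      exact ⟨φ y, ⟨hφ.bijOn_interior.mapsTo hy, hyε⟩, hφ.discInv_apply (subset_closure hy)⟩
    refine (measure_mono hsub).trans ?_
    have hder : ∀ z ∈ S, HasFDerivWithinAt (discInv Ω φ)
        ((cderiv Ω φ (discInv Ω φ z))⁻¹ • (1 : ℂ →L[ℝ] ℂ)) S z := fun z hz =>
      (hφ.hasDerivAt_discInv hΩ hz.1).complexToReal_fderiv.hasFDerivWithinAt
    refine (addHaar_image_le_lintegral_abs_det_fderiv volume hSm hder).trans ?_
    calc ∫⁻ z in S, ENNReal.ofReal |((cderiv Ω φ (discInv Ω φ z))⁻¹ • (1 : ℂ →L[ℝ] ℂ)).det|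
        ≤ ∫⁻ z in S, ENNReal.ofReal (A ^ 2) := by
          refine setLIntegral_mono' hSm fun z hz => ENNReal.ofReal_le_ofReal ?_
          rw [det_smul_one, abs_of_nonneg (by positivity)]
          have := (hb _ (subset_closure (hφ.discInv_mem hz.1))).2
          gcongr
      _ = ENNReal.ofReal (A ^ 2) * volume S := by rw [setLIntegral_const]
      _ ≤ ENNReal.ofReal (A ^ 2) * ENNReal.ofReal (Real.pi * ε) := by
          gcongr; exact volume_disc_layer_le hε
      _ = ENNReal.ofReal (A ^ 2 * Real.pi * ε) := by
          rw [← ENNReal.ofReal_mul (by positivity), mul_assoc]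

theorem IsConformalOntoDisc.fderiv_one_sub_norm_sq (hΩ : IsC21Domain Ω)
    (hφ : IsConformalOntoDisc Ω φ) {y : ℂ} (hy : y ∈ Ω) (v : ℂ) :
    fderiv ℝ (fun y => 1 - ‖φ y‖ ^ 2) y v =
      -(2 * (starRingEnd ℂ (φ y) * cderiv Ω φ y * v).re) := by
  have h := ((hφ.hasDerivAt hΩ hy).complexToReal_fderiv.norm_sq).const_sub 1
  rw [h.fderiv]
  simp [Complex.inner, mul_assoc, -Complex.mul_re]
  ring_nf

/-- The set where `|f| ≥ η` is compact and misses the boundary, so `1 - |φ|²` has a positive minimum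
on it. This upgrades a boundary condition to smallness in a layer. -/
theorem IsConformalOntoDisc.exists_layer_small (hΩ : IsC21Domain Ω)
    (hφ : IsConformalOntoDisc Ω φ) {f : ℂ → ℝ} (hf : ContinuousOn f (closure Ω))
    (h0 : ∀ y ∈ frontier Ω, f y = 0) {η : ℝ} (hη : 0 < η) :
    ∃ ε : ℝ, 0 < ε ∧ ∀ y ∈ Ω, 1 - ‖φ y‖ ^ 2 < ε → |f y| ≤ η := by
  set K := closure Ω ∩ (fun y => |f y|) ⁻¹' Ici η with hK
  have hKc : IsCompact K := hΩ.isCompact_closure.of_isClosed_subset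
    (hf.abs.preimage_isClosed_of_isClosed isClosed_closure isClosed_Ici) inter_subset_left
  rcases K.eq_empty_or_nonempty with hKe | hKn
  · refine ⟨1, one_pos, fun y hy _ => ?_⟩
    by_contra! h
    have : y ∈ K := ⟨subset_closure hy, h.le⟩
    rw [hKe] at this; exact this
  · obtain ⟨y₀, hy₀, hmin⟩ := hKc.exists_isMinOn hKn
      (continuousOn_const.sub ((hφ.contDiffOn.continuousOn.mono inter_subset_left).norm.pow 2) :
        ContinuousOn (fun y => 1 - ‖φ y‖ ^ 2) K)
    have hy₀Ω : y₀ ∈ Ω := by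
      by_contra hn
      have h1 := h0 y₀ (by rw [hΩ.isOpen.frontier_eq]; exact ⟨hy₀.1, hn⟩)
      have h2 : η ≤ |f y₀| := hy₀.2
      rw [h1, abs_zero] at h2; linarith
    have := hφ.norm_lt_one hy₀Ω
    refine ⟨1 - ‖φ y₀‖ ^ 2, by nlinarith [norm_nonneg (φ y₀)], fun y hy hyε => ?_⟩
    by_contra! h
    have h2 : 1 - ‖φ y₀‖ ^ 2 ≤ 1 - ‖φ y‖ ^ 2 := hmin (show y ∈ K from ⟨subset_closure hy, h.le⟩)
    linarith

/-- At `p` the derivative is multiplication by `φ'(p)`, and it must send directions entering `Ω` to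
directions that do not leave the disc. For `b = conj(φ p) φ'(p) ν` this means that `Re w < 0`
implies `Re(bw) ≤ 0`, which forces `b` to be real and nonnegative, hence equal to its modulus
`|φ'(p)|`. -/
theorem IsConformalOntoDisc.cderiv_mul_normal (hΩ : IsC21Domain Ω)
    (hφ : IsConformalOntoDisc Ω φ) {p ν : ℂ} (hp : p ∈ frontier Ω)
    (hν : IsOuterUnitNormal Ω p ν) : cderiv Ω φ p * ν = ‖cderiv Ω φ p‖ * φ p := by
  have hpn := hφ.norm_eq_one hp
  have hpc : starRingEnd ℂ (φ p) * φ p = 1 := by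
    rw [mul_comm, Complex.mul_conj, Complex.normSq_eq_norm_sq, hpn]; simp
  -- inward directions decrease the modulus of `φ`
  have hdir : ∀ v : ℂ, inner ℝ ν v < 0 → (starRingEnd ℂ (φ p) * (cderiv Ω φ p * v)).re ≤ 0 := by
    intro v hv
    have hv0 : 0 < ‖v‖ := by
      rw [norm_pos_iff]; rintro rfl; simp at hv
    set ε := -inner ℝ ν v / (2 * ‖v‖) with hε
    have hε0 : 0 < ε := div_pos (by linarith) (by positivity)
    have hlim : Tendsto (fun k : ℕ => p + ((k : ℝ) + 1)⁻¹ • v) atTop (𝓝 p) := by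
      have h1 : Tendsto (fun k : ℕ => ((k : ℝ) + 1)⁻¹) atTop (𝓝 0) := by
        simpa [one_div] using tendsto_one_div_add_atTop_nhds_zero_nat (𝕜 := ℝ)
      simpa using (h1.smul_const v).const_add p
    -- Points outside `Ω` near `p` satisfy `ν·(z - p) ≥ -ε‖z - p‖`; with `ε` half of `-ν·v/‖v‖`,
    -- small multiples of `v` violate this.
    have hmem : ∀ᶠ k : ℕ in atTop, p + ((k : ℝ) + 1)⁻¹ • v ∈ Ω := by
      filter_upwards [hlim.eventually (eventually_nhdsWithin_iff.1 (hν.2 ε hε0).2)] with k hk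
      by_contra hn
      have h1 := hk hn
      have h2 : (0 : ℝ) < ((k : ℝ) + 1)⁻¹ := by positivity
      rw [add_sub_cancel_left, norm_smul, inner_smul_right, Real.norm_of_nonneg h2.le] at h1
      have h3 : ε * (((k : ℝ) + 1)⁻¹ * ‖v‖) = ((k : ℝ) + 1)⁻¹ * (-inner ℝ ν v / 2) := by
        rw [hε]; field_simp
      rw [h3] at h1
      nlinarith
    have hd0 : Tendsto (fun k : ℕ => ((k : ℝ) + 1)⁻¹ • v) atTop (𝓝 0) := by
      simpa using hlim.sub_const p
    have hl := (hφ.hasFDerivWithinAt hΩ (frontier_subset_closure hp)).lim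
      (c := fun k : ℕ => (k : ℝ) + 1) hd0 (hmem.mono fun k hk => subset_closure hk) (v := v) ?_
    · have hl2 := (Complex.continuous_re.tendsto _).comp (hl.const_mul (starRingEnd ℂ (φ p)))
      have hle : ∀ᶠ k : ℕ in atTop, (Complex.re ∘ fun k : ℕ => starRingEnd ℂ (φ p) *
          (((k : ℝ) + 1) • (φ (p + ((k : ℝ) + 1)⁻¹ • v) - φ p))) k ≤ 0 := by
        filter_upwards [hmem] with k hk
        have h1 := hφ.norm_lt_one hk
        set w := φ (p + ((k : ℝ) + 1)⁻¹ • v)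
        have h2 : (starRingEnd ℂ (φ p) * w).re ≤ 1 := by
          refine (Complex.re_le_norm _).trans ?_
          rw [norm_mul, RCLike.norm_conj, hpn, one_mul]; exact h1.le
        have h3 : starRingEnd ℂ (φ p) * (((k : ℝ) + 1) • (w - φ p)) =
            ((k : ℝ) + 1) • (starRingEnd ℂ (φ p) * w - 1) := by
          rw [mul_smul_comm, mul_sub, hpc]
        simp only [Function.comp_apply]
        rw [h3, Complex.smul_re, Complex.sub_re, Complex.one_re, smul_eq_mul]
        have h4 : (0 : ℝ) ≤ (k : ℝ) + 1 := by positivity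
        nlinarith
      simpa using le_of_tendsto hl2 hle
    · refine tendsto_const_nhds.congr fun k => ?_
      rw [smul_smul, mul_inv_cancel₀ (by positivity), one_smul]
  set b := starRingEnd ℂ (φ p) * (cderiv Ω φ p * ν) with hb
  have hb' : ∀ w : ℂ, w.re < 0 → (b * w).re ≤ 0 := by
    intro w hw
    have h1 : inner ℝ ν (ν * w) = w.re := by
      have h2 : ν * w * starRingEnd ℂ ν = w := by
        rw [mul_right_comm, Complex.mul_conj, Complex.normSq_eq_norm_sq, hν.1]; simp
      rw [Complex.inner, h2]
    have := hdir (ν * w) (by rw [h1]; exact hw)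
    rw [hb]
    convert this using 2
    ring
  have hre : 0 ≤ b.re := by
    have := hb' (-1) (by simp)
    simpa using this
  have him : b.im = 0 := by
    by_contra hne
    have h2 : 0 < b.im ^ 2 := by positivity
    -- The imaginary part produces `(b.im)²`; the real part is there only to be negative, and costs
    -- at most half of that square.
    have := hb' ⟨-(b.im ^ 2 / (2 * (b.re + 1))), -b.im⟩ (by simp; positivity)
    rw [Complex.mul_re] at this
    simp only at this
    have h3 : b.re * (b.im ^ 2 / (2 * (b.re + 1))) ≤ b.im ^ 2 / 2 := by
      rw [mul_div_assoc', div_le_div_iff₀ (by positivity) two_pos]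
      nlinarith
    nlinarith
  have hbn : ‖b‖ = ‖cderiv Ω φ p‖ := by
    rw [hb, norm_mul, norm_mul, RCLike.norm_conj, hpn, hν.1]; ring
  have hbr : b = ‖cderiv Ω φ p‖ := by
    rw [← hbn]
    apply Complex.ext
    · rw [Complex.ofReal_re, Complex.norm_def, Complex.normSq_apply, him, mul_zero, add_zero,
        Real.sqrt_mul_self hre]
    · simp [him]
  calc cderiv Ω φ p * ν = (starRingEnd ℂ (φ p) * φ p) * (cderiv Ω φ p * ν) := by rw [hpc, one_mul]
    _ = b * φ p := by rw [hb]; ring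
    _ = _ := by rw [hbr]

end conformal

/-! ### Gradient and normal derivative of the pull-back Green's function. -/

theorem hasFDerivWithinAt_log_norm {f : ℂ → ℂ} {f' : ℂ →L[ℝ] ℂ} {s : Set ℂ} {y : ℂ}
    (hf : HasFDerivWithinAt f f' s y) (h0 : f y ≠ 0) :
    HasFDerivWithinAt (fun y => Real.log ‖f y‖) (Complex.reCLM.comp ((f y)⁻¹ • f')) s y := by
  have h1 := (hf.norm_sq.log (by simpa using h0)).const_mul (1 / 2)
  have e : (fun y => Real.log ‖f y‖) = fun y => 1 / 2 * Real.log (‖f y‖ ^ 2) := by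
    ext y; rw [Real.log_pow]; push_cast; ring
  rw [e]
  refine h1.congr_fderiv ?_
  ext v
  have h2 : Complex.normSq (f y) ≠ 0 := by simpa using h0
  simp only [Complex.inner, Complex.inv_def, _root_.smul_apply,
    ContinuousLinearMap.comp_apply, smul_eq_mul, Complex.reCLM_apply, Complex.sq_norm,
    innerSL_apply_apply, nsmul_eq_mul]
  simp
  field_simp

theorem hasFDerivAt_log_norm {f : ℂ → ℂ} {f' : ℂ →L[ℝ] ℂ} {y : ℂ}
    (hf : HasFDerivAt f f' y) (h0 : f y ≠ 0) :
    HasFDerivAt (fun y => Real.log ‖f y‖) (Complex.reCLM.comp ((f y)⁻¹ • f')) y := by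
  rw [← hasFDerivWithinAt_univ] at hf ⊢
  exact hasFDerivWithinAt_log_norm hf h0

/-- Dropping the unimodular factor `-(φ x / |φ x|)` removes the apparent singularity at `φ x = 0`
and leaves logarithms of moduli of functions holomorphic in `φ y`. -/
theorem pullbackGreen_eq (φ : ℂ → ℂ) (x y : ℂ) : pullbackGreen φ x y = (2 * Real.pi)⁻¹ *
    (Real.log ‖φ y - φ x‖ + Real.log ‖1 - starRingEnd ℂ (φ x) * φ y‖) := by
  rw [pullbackGreen, norm_sub_rev (φ x)]
  congr 2
  by_cases h : φ x = 0
  · simp [h]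
  have hn : (‖φ x‖ : ℂ) ≠ 0 := by simpa using h
  have e : (‖φ x‖ : ℂ) * φ y - φ x / (‖φ x‖ : ℂ) =
      -(φ x / ‖φ x‖) * (1 - starRingEnd ℂ (φ x) * φ y) := by
    have : φ x * starRingEnd ℂ (φ x) = (‖φ x‖ : ℂ) * ‖φ x‖ := by
      rw [Complex.mul_conj, Complex.normSq_eq_norm_sq]; push_cast; ring
    field_simp
    linear_combination φ y * (-this)
  rw [e, norm_mul, norm_neg, norm_div, Complex.norm_real, norm_norm, div_self (by simpa using h),
    one_mul]

/-- `conj` of the gradient, up to the factor `2π`, of the Green function of the disc with pole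
`a`. -/
def discKernel (a z : ℂ) : ℂ := (z - a)⁻¹ - starRingEnd ℂ a * (1 - starRingEnd ℂ a * z)⁻¹

/-- Multiplication by a complex number followed by the real part. -/
def reMul (c : ℂ) : ℂ →L[ℝ] ℝ := Complex.reCLM.comp (c • (1 : ℂ →L[ℝ] ℂ))

@[simp] theorem reMul_apply (c v : ℂ) : reMul c v = (c * v).re := by simp [reMul]

theorem norm_reMul_le (c : ℂ) : ‖reMul c‖ ≤ ‖c‖ :=
  ContinuousLinearMap.opNorm_le_bound _ (norm_nonneg _) fun v => by
    rw [reMul_apply, ← norm_mul]; exact Complex.abs_re_le_norm _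

section conformal

variable {Ω : Set ℂ} {φ : ℂ → ℂ}

theorem IsConformalOntoDisc.sub_ne_zero (hφ : IsConformalOntoDisc Ω φ) {x y : ℂ} (hx : x ∈ Ω)
    (hy : y ∈ closure Ω) (hxy : y ≠ x) : φ y - φ x ≠ 0 := fun h =>
  hxy (hφ.bijOn_closure.injOn hy (subset_closure hx) (_root_.sub_eq_zero.1 h))

theorem IsConformalOntoDisc.one_sub_ne_zero (hφ : IsConformalOntoDisc Ω φ) {x y : ℂ} (hx : x ∈ Ω)
    (hy : y ∈ closure Ω) : 1 - starRingEnd ℂ (φ x) * φ y ≠ 0 :=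
  one_sub_conj_mul_ne_zero (hφ.norm_lt_one hx)
    (mem_closedBall_zero_iff.1 (hφ.bijOn_closure.mapsTo hy))

theorem IsConformalOntoDisc.hasFDerivWithinAt_pullbackGreen (hΩ : IsC21Domain Ω)
    (hφ : IsConformalOntoDisc Ω φ) {x y : ℂ} (hx : x ∈ Ω) (hy : y ∈ closure Ω) (hxy : y ≠ x) :
    HasFDerivWithinAt (pullbackGreen φ x)
      ((2 * Real.pi)⁻¹ • reMul (discKernel (φ x) (φ y) * cderiv Ω φ y)) (closure Ω) y := by
  have e : pullbackGreen φ x = fun y => (2 * Real.pi)⁻¹ *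
    (Real.log ‖φ y - φ x‖ + Real.log ‖1 - starRingEnd ℂ (φ x) * φ y‖) :=
    funext fun y => pullbackGreen_eq φ x y
  rw [e]
  have hd := hφ.hasFDerivWithinAt hΩ hy
  have h1 := hasFDerivWithinAt_log_norm (hd.sub_const (φ x)) (hφ.sub_ne_zero hx hy hxy)
  have h2 := hasFDerivWithinAt_log_norm ((hd.const_mul (starRingEnd ℂ (φ x))).const_sub 1)
    (hφ.one_sub_ne_zero hx hy)
  refine ((h1.add h2).const_mul _).congr_fderiv ?_
  refine ContinuousLinearMap.ext fun v => ?_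
  simp only [_root_.smul_apply, _root_.add_apply, smul_eq_mul,
    ContinuousLinearMap.comp_apply, reMul_apply, Complex.reCLM_apply, ← Complex.add_re,
    discKernel, _root_.neg_apply, one_apply_eq_self]
  congr 2
  ring

theorem IsConformalOntoDisc.fderivWithin_pullbackGreen (hΩ : IsC21Domain Ω)
    (hφ : IsConformalOntoDisc Ω φ) {x y : ℂ} (hx : x ∈ Ω) (hy : y ∈ closure Ω) (hxy : y ≠ x) :
    fderivWithin ℝ (pullbackGreen φ x) (closure Ω) y =
      (2 * Real.pi)⁻¹ • reMul (discKernel (φ x) (φ y) * cderiv Ω φ y) :=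
  (hφ.hasFDerivWithinAt_pullbackGreen hΩ hx hy hxy).fderivWithin (hΩ.uniqueDiffOn y hy)

theorem IsConformalOntoDisc.hasFDerivAt_pullbackGreen (hΩ : IsC21Domain Ω)
    (hφ : IsConformalOntoDisc Ω φ) {x y : ℂ} (hx : x ∈ Ω) (hy : y ∈ Ω) (hxy : y ≠ x) :
    HasFDerivAt (pullbackGreen φ x)
      ((2 * Real.pi)⁻¹ • reMul (discKernel (φ x) (φ y) * cderiv Ω φ y)) y :=
  (hφ.hasFDerivWithinAt_pullbackGreen hΩ hx (subset_closure hy) hxy).hasFDerivAt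
    (mem_of_superset (hΩ.isOpen.mem_nhds hy) subset_closure)

theorem IsConformalOntoDisc.fderiv_pullbackGreen_apply (hΩ : IsC21Domain Ω)
    (hφ : IsConformalOntoDisc Ω φ) {x y : ℂ} (hx : x ∈ Ω) (hy : y ∈ Ω) (hxy : y ≠ x) (v : ℂ) :
    fderiv ℝ (pullbackGreen φ x) y v =
      (2 * Real.pi)⁻¹ * (discKernel (φ x) (φ y) * cderiv Ω φ y * v).re := by
  rw [(hφ.hasFDerivAt_pullbackGreen hΩ hx hy hxy).fderiv]; simp

/-- On the unit circle `1 - conj(a) z = conj(z - a) z`, which collapses the expression to `1` plus a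
number minus its own conjugate. The flux density is therefore the same for every pole. -/
theorem re_discKernel_mul_self {a z : ℂ} (ha : ‖a‖ < 1) (hz : ‖z‖ = 1) :
    (discKernel a z * z).re = 1 := by
  have hza : z - a ≠ 0 := fun h => by rw [sub_eq_zero.1 h] at hz; linarith
  have h1 : 1 - starRingEnd ℂ a * z ≠ 0 := one_sub_conj_mul_ne_zero ha hz.le
  have hzz : starRingEnd ℂ z * z = 1 := by
    rw [mul_comm, Complex.mul_conj, Complex.normSq_eq_norm_sq, hz]; simp
  have e2 : 1 - starRingEnd ℂ a * z = starRingEnd ℂ (z - a) * z := by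
    rw [map_sub, sub_mul, hzz]
  have hz0 : z ≠ 0 := by rintro rfl; simp at hz
  have hza' : starRingEnd ℂ (z - a) ≠ 0 :=
    (map_ne_zero _).2 hza
  have e3 : discKernel a z * z = 1 + (a * (z - a)⁻¹ - starRingEnd ℂ (a * (z - a)⁻¹)) := by
    rw [discKernel, e2, map_mul, map_inv₀]
    field_simp
    ring
  rw [e3, Complex.add_re, Complex.sub_re, Complex.conj_re, sub_self, add_zero, Complex.one_re]

/-- The normal derivative of the Green function at the boundary. -/
theorem IsConformalOntoDisc.dirDeriv_pullbackGreen (hΩ : IsC21Domain Ω)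
    (hφ : IsConformalOntoDisc Ω φ) {x p ν : ℂ} (hx : x ∈ Ω) (hp : p ∈ frontier Ω)
    (hν : IsOuterUnitNormal Ω p ν) :
    dirDeriv Ω (pullbackGreen φ x) p ν = (2 * Real.pi)⁻¹ * ‖cderiv Ω φ p‖ := by
  have hpx : p ≠ x := by
    rintro rfl; rw [hΩ.isOpen.frontier_eq] at hp; exact hp.2 hx
  rw [dirDeriv, hφ.fderivWithin_pullbackGreen hΩ hx (frontier_subset_closure hp) hpx]
  simp only [_root_.smul_apply, reMul_apply, smul_eq_mul]
  rw [mul_assoc, hφ.cderiv_mul_normal hΩ hp hν, mul_left_comm, Complex.re_ofReal_mul,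
    re_discKernel_mul_self (hφ.norm_lt_one hx) (hφ.norm_eq_one hp), mul_one]

/-- Only the direct term is singular: the denominator of the reflected one stays above `1 - |φ x|`,
and boundedness of `Ω` lets a constant be absorbed into `‖y - x‖⁻¹`. -/
theorem IsConformalOntoDisc.exists_norm_discKernel_le (hΩ : IsC21Domain Ω)
    (hφ : IsConformalOntoDisc Ω φ) {x : ℂ} (hx : x ∈ Ω) : ∃ B : ℝ, 0 < B ∧
      ∀ y ∈ Ω \ {x}, ‖discKernel (φ x) (φ y) * cderiv Ω φ y‖ ≤ B * ‖y - x‖⁻¹ := by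
  obtain ⟨A, hA, hb⟩ := hφ.exists_cderiv_bounds hΩ
  obtain ⟨A', hA', hlow⟩ := hφ.exists_norm_sub_le hΩ
  obtain ⟨R, hR⟩ := hΩ.isBounded.subset_closedBall x
  have hx1 := hφ.norm_lt_one hx
  have h1x : 0 < 1 - ‖φ x‖ := by linarith
  refine ⟨(A' + (1 - ‖φ x‖)⁻¹ * |R|) * A, by positivity, fun y hy => ?_⟩
  have h0 : 0 < ‖y - x‖ := norm_pos_iff.2 (_root_.sub_ne_zero.2 hy.2)
  have hφ0 : 0 < ‖φ y - φ x‖ := norm_pos_iff.2 (hφ.sub_ne_zero hx (subset_closure hy.1) hy.2)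
  have hyR : ‖y - x‖ ≤ |R| := by
    have := hR hy.1
    rw [Metric.mem_closedBall, dist_eq_norm] at this; exact this.trans (le_abs_self _)
  rw [norm_mul]
  have e1 : ‖(φ y - φ x)⁻¹‖ ≤ A' * ‖y - x‖⁻¹ := by
    rw [norm_inv, ← div_eq_mul_inv, le_div_iff₀ h0, inv_mul_le_iff₀ hφ0, mul_comm]
    exact hlow y hy.1 x hx
  have e2 : ‖starRingEnd ℂ (φ x) * (1 - starRingEnd ℂ (φ x) * φ y)⁻¹‖ ≤
      (1 - ‖φ x‖)⁻¹ * |R| * ‖y - x‖⁻¹ := by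
    rw [norm_mul, norm_inv, RCLike.norm_conj]
    have h2 := one_sub_norm_le_norm_one_sub_conj_mul (b := φ x) (hφ.norm_lt_one hy.1).le
    have h3 : 1 ≤ |R| * ‖y - x‖⁻¹ := by
      rw [← div_eq_mul_inv, le_div_iff₀ h0, one_mul]; exact hyR
    calc ‖φ x‖ * ‖1 - starRingEnd ℂ (φ x) * φ y‖⁻¹ ≤ 1 * (1 - ‖φ x‖)⁻¹ := by gcongr
      _ ≤ (1 - ‖φ x‖)⁻¹ * (|R| * ‖y - x‖⁻¹) := by
        rw [one_mul]; exact le_mul_of_one_le_right (by positivity) h3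
      _ = _ := by ring
  calc ‖discKernel (φ x) (φ y)‖ * ‖cderiv Ω φ y‖
      ≤ (A' * ‖y - x‖⁻¹ + (1 - ‖φ x‖)⁻¹ * |R| * ‖y - x‖⁻¹) * A := by
        gcongr
        · exact (norm_sub_le _ _).trans (add_le_add e1 e2)
        · exact (hb y (subset_closure hy.1)).1
    _ = _ := by ring

theorem IsConformalOntoDisc.exists_norm_fderiv_pullbackGreen_le (hΩ : IsC21Domain Ω)
    (hφ : IsConformalOntoDisc Ω φ) {x : ℂ} (hx : x ∈ Ω) : ∃ B : ℝ, 0 < B ∧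
      ∀ y ∈ Ω \ {x}, ‖fderiv ℝ (pullbackGreen φ x) y‖ ≤ B * ‖y - x‖⁻¹ := by
  obtain ⟨B, hB, h⟩ := hφ.exists_norm_discKernel_le hΩ hx
  refine ⟨(2 * Real.pi)⁻¹ * B, by positivity, fun y hy => ?_⟩
  rw [(hφ.hasFDerivAt_pullbackGreen hΩ hx hy.1 hy.2).fderiv, norm_smul, mul_assoc,
    Real.norm_of_nonneg (by positivity)]
  gcongr
  exact (norm_reMul_le _).trans (h y hy)

theorem IsConformalOntoDisc.contDiffOn_pullbackGreen
    (hφ : IsConformalOntoDisc Ω φ) {x : ℂ} (hx : x ∈ Ω) :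
    ContDiffOn ℝ 1 (pullbackGreen φ x) (Ω \ {x}) := by
  have e : pullbackGreen φ x = fun y => (2 * Real.pi)⁻¹ *
    (Real.log ‖φ y - φ x‖ + Real.log ‖1 - starRingEnd ℂ (φ x) * φ y‖) :=
    funext fun y => pullbackGreen_eq φ x y
  rw [e]
  have h1 : ContDiffOn ℝ 1 φ (Ω \ {x}) :=
    (hφ.contDiffOn.mono (sdiff_subset.trans subset_closure)).of_le (by norm_num)
  refine contDiffOn_const.mul (ContDiffOn.add ?_ ?_)
  · have h2 : ∀ y ∈ Ω \ {x}, φ y - φ x ≠ 0 := fun y hy =>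
      hφ.sub_ne_zero hx (subset_closure hy.1) hy.2
    exact ((h1.sub contDiffOn_const).norm ℝ h2).log fun y hy => norm_ne_zero_iff.2 (h2 y hy)
  · have h2 : ∀ y ∈ Ω \ {x}, 1 - starRingEnd ℂ (φ x) * φ y ≠ 0 := fun y hy =>
      hφ.one_sub_ne_zero hx (subset_closure hy.1)
    exact ((contDiffOn_const.sub (contDiffOn_const.mul h1)).norm ℝ h2).log
      fun y hy => norm_ne_zero_iff.2 (h2 y hy)

end conformal

/-! ### Green's representation formula in the disc. -/

/-- Integration of the radial derivative, in polar coordinates. -/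
theorem integral_fderiv_radial {K : ℂ → ℝ} {R M : ℝ} (hR : 0 < R)
    (hc : ContinuousOn K (Metric.closedBall 0 R)) (hd : ContDiffOn ℝ 1 K (Metric.ball 0 R))
    (hM : ∀ z ∈ Metric.ball (0 : ℂ) R, ‖fderiv ℝ K z‖ ≤ M) :
    ∫ z in Metric.ball (0 : ℂ) R, fderiv ℝ K z (starRingEnd ℂ z⁻¹) =
      (∫ θ in (-Real.pi)..Real.pi, K (R * (Real.cos θ + Real.sin θ * Complex.I)))
        - 2 * Real.pi * K 0 := by
  have hpi := Real.pi_pos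
  -- Since `conj(z⁻¹) = z/|z|²`, the area factor `r` cancels the `1/r`, and the integrand becomes
  -- the derivative of `K` along rays, integrated by the fundamental theorem of calculus.
  set e : ℝ → ℂ := fun θ => Real.cos θ + Real.sin θ * Complex.I with he
  have hec : Continuous e := by fun_prop
  have hen : ∀ θ, ‖e θ‖ = 1 := fun θ => by
    simp only [he, Complex.ofReal_cos, Complex.ofReal_sin, Complex.norm_cos_add_sin_mul_I]
  set G : ℝ × ℝ → ℝ := fun p => fderiv ℝ K (p.1 * e p.2) (e p.2) with hG
  have hball : ∀ r θ : ℝ, 0 < r → r < R → (r : ℂ) * e θ ∈ Metric.ball (0 : ℂ) R := by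
    intro r θ hr hrR
    rw [mem_ball_zero_iff, norm_mul, hen, mul_one, Complex.norm_real, Real.norm_of_nonneg hr.le]
    exact hrR
  have hGc : ContinuousOn G (Ioo 0 R ×ˢ Ioo (-Real.pi) Real.pi) := by
    have h1 : ContinuousOn (fun p : ℝ × ℝ => fderiv ℝ K (p.1 * e p.2))
        (Ioo 0 R ×ˢ Ioo (-Real.pi) Real.pi) := by
      refine (hd.continuousOn_fderiv_of_isOpen Metric.isOpen_ball le_rfl).comp
        (Continuous.continuousOn ?_) fun p hp => hball _ _ hp.1.1 hp.1.2
      exact (Complex.continuous_ofReal.comp continuous_fst).mul (hec.comp continuous_snd)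
    exact h1.clm_apply (hec.comp continuous_snd).continuousOn
  have hms : MeasurableSet (Ioo 0 R ×ˢ Ioo (-Real.pi) Real.pi) :=
    measurableSet_Ioo.prod measurableSet_Ioo
  have hGb : ∀ p ∈ Ioo 0 R ×ˢ Ioo (-Real.pi) Real.pi, ‖G p‖ ≤ M := by
    intro p hp
    refine (ContinuousLinearMap.le_opNorm _ _).trans ?_
    rw [hen, mul_one]; exact hM _ (hball _ _ hp.1.1 hp.1.2)
  have hGi : IntegrableOn G (Ioo 0 R ×ˢ Ioo (-Real.pi) Real.pi) := by
    refine (integrableOn_const (C := M) ?_).mono' (hGc.aestronglyMeasurable hms)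
      ((ae_restrict_mem hms).mono hGb)
    rw [Measure.volume_eq_prod, Measure.prod_prod]
    simp [ENNReal.mul_eq_top]
  have step1 : ∫ z in Metric.ball (0 : ℂ) R, fderiv ℝ K z (starRingEnd ℂ z⁻¹) =
      ∫ p in Ioo 0 R ×ˢ Ioo (-Real.pi) Real.pi, G p := by
    rw [← integral_indicator measurableSet_ball, ← Complex.integral_comp_polarCoord_symm,
      polarCoord_target]
    have hsub : Ioo 0 R ×ˢ Ioo (-Real.pi) Real.pi ⊆ Ioi (0 : ℝ) ×ˢ Ioo (-Real.pi) Real.pi :=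
      prod_mono Ioo_subset_Ioi_self subset_rfl
    rw [← inter_eq_self_of_subset_right hsub, ← setIntegral_indicator hms]
    refine setIntegral_congr_fun (measurableSet_Ioi.prod measurableSet_Ioo) fun p hp => ?_
    have hp1 : 0 < p.1 := hp.1
    rw [Complex.polarCoord_symm_apply]
    change p.1 • (Metric.ball (0 : ℂ) R).indicator _ (p.1 * e p.2) = _
    by_cases hpR : p.1 < R
    · rw [indicator_of_mem (hball _ _ hp1 hpR), indicator_of_mem
        (show p ∈ Ioo 0 R ×ˢ Ioo (-Real.pi) Real.pi from ⟨⟨hp1, hpR⟩, hp.2⟩), hG]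
      simp only
      rw [← map_smul]
      congr 1
      have h1 : (p.1 : ℂ) ≠ 0 := by exact_mod_cast hp1.ne'
      have h2 : (starRingEnd ℂ (e p.2)) * e p.2 = 1 := by
        rw [mul_comm, Complex.mul_conj, Complex.normSq_eq_norm_sq, hen]; simp
      have h3 : (starRingEnd ℂ (e p.2))⁻¹ = e p.2 :=
        inv_eq_of_mul_eq_one_right h2
      rw [map_inv₀, map_mul, Complex.conj_ofReal, mul_inv, h3, Complex.real_smul,
        mul_inv_cancel_left₀ h1]
    · rw [indicator_of_notMem, indicator_of_notMem, smul_zero]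
      · exact fun h => hpR h.1.2
      · rw [mem_ball_zero_iff, norm_mul, hen, mul_one, Complex.norm_real,
          Real.norm_of_nonneg hp1.le]; exact hpR
  have step2 : ∀ θ, ∫ r in Ioo 0 R, G (r, θ) = K (R * e θ) - K 0 := by
    intro θ
    rw [← integral_Ioc_eq_integral_Ioo, ← intervalIntegral.integral_of_le hR.le]
    have hcc : ContinuousOn (fun r : ℝ => K (r * e θ)) (Icc 0 R) := by
      refine hc.comp (by fun_prop) fun r hr => ?_
      rw [mem_closedBall_zero_iff, norm_mul, hen, mul_one, Complex.norm_real,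
        Real.norm_of_nonneg hr.1]; exact hr.2
    have hder : ∀ r ∈ Ioo 0 R, HasDerivAt (fun r : ℝ => K (r * e θ)) (G (r, θ)) r := by
      intro r hr
      have h1 : HasDerivAt (fun r : ℝ => (r : ℂ) * e θ) (e θ) r := by
        simpa using (Complex.ofRealCLM.hasDerivAt (x := r)).mul_const (e θ)
      exact ((hd.contDiffAt (Metric.isOpen_ball.mem_nhds (hball r θ hr.1 hr.2))).differentiableAt
        one_ne_zero).hasFDerivAt.comp_hasDerivAt r h1
    have hint : IntervalIntegrable (fun r => G (r, θ)) volume 0 R := by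
      rw [intervalIntegrable_iff_integrableOn_Ioo_of_le hR.le]
      refine (integrableOn_const (C := M) (by simp)).mono' ?_
        ((ae_restrict_mem measurableSet_Ioo).mono fun r hr => ?_)
      · refine ContinuousOn.aestronglyMeasurable ?_ measurableSet_Ioo
        have h1 : ContinuousOn (fun r : ℝ => fderiv ℝ K (r * e θ)) (Ioo 0 R) :=
          (hd.continuousOn_fderiv_of_isOpen Metric.isOpen_ball le_rfl).comp
            (by fun_prop) fun r hr => hball _ _ hr.1 hr.2
        exact h1.clm_apply (continuousOn_const (c := e θ))
      · refine (ContinuousLinearMap.le_opNorm _ _).trans ?_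
        rw [hen, mul_one]; exact hM _ (hball _ _ hr.1 hr.2)
    rw [intervalIntegral.integral_eq_sub_of_hasDerivAt_of_le hR.le hcc hder hint]
    simp
  have hKc : Continuous fun θ => K (R * e θ) := by
    refine hc.comp_continuous (by fun_prop) fun θ => ?_
    rw [mem_closedBall_zero_iff, norm_mul, hen, mul_one, Complex.norm_real,
      Real.norm_of_nonneg hR.le]
  rw [step1, Measure.volume_eq_prod, ← setIntegral_prod_swap, setIntegral_prod]
  · simp only [Prod.swap_prod_mk, step2]
    rw [← integral_Ioc_eq_integral_Ioo, ← intervalIntegral.integral_of_le (by linarith),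
      intervalIntegral.integral_sub (hKc.intervalIntegrable _ _) intervalIntegrable_const]
    rw [intervalIntegral.integral_const, smul_eq_mul]; ring
  · exact hGi.swap

theorem norm_discKernel_le {a z : ℂ} (ha : ‖a‖ < 1) (hz : ‖z‖ < 1) :
    ‖discKernel a z‖ ≤ ‖z - a‖⁻¹ + (1 - ‖a‖)⁻¹ := by
  have h := one_sub_norm_le_norm_one_sub_conj_mul (b := a) hz.le
  have h1 : 0 < 1 - ‖a‖ := by linarith
  refine (norm_sub_le _ _).trans ?_
  rw [norm_mul, norm_inv, norm_inv, RCLike.norm_conj]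
  gcongr
  calc ‖a‖ * ‖1 - starRingEnd ℂ a * z‖⁻¹ ≤ 1 * (1 - ‖a‖)⁻¹ := by gcongr
    _ = _ := one_mul _

theorem measurable_discKernel (a : ℂ) : Measurable (discKernel a) := by
  unfold discKernel; fun_prop

theorem integrableOn_discKernel {a : ℂ} (ha : ‖a‖ < 1) :
    IntegrableOn (discKernel a) (Metric.ball 0 1) := by
  have hk1 : IntegrableOn (fun y => ‖y - a‖⁻¹) (Metric.ball (0 : ℂ) 1) := by
    simpa [Real.rpow_neg_one] using
      integrableOn_norm_sub_rpow Metric.isBounded_ball (p := 1) (by norm_num) a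
  refine (hk1.add (integrableOn_const (C := (1 - ‖a‖)⁻¹) measure_ball_lt_top.ne)).mono'
    (measurable_discKernel a).aestronglyMeasurable
    ((ae_restrict_mem measurableSet_ball).mono fun z hz => ?_)
  exact norm_discKernel_le ha (mem_ball_zero_iff.1 hz)

theorem integrableOn_clm_apply_of_bound {s : Set ℂ} (hs : MeasurableSet s) {A : ℂ → ℂ →L[ℝ] ℝ}
    {m : ℂ → ℂ} {M : ℝ} (hA : AEStronglyMeasurable A (volume.restrict s))
    (hM : ∀ z ∈ s, ‖A z‖ ≤ M) (hm : IntegrableOn m s) : IntegrableOn (fun z => A z (m z)) s :=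
  (hm.norm.const_mul M).mono' (aestronglyMeasurable_clm_apply hA hm.aestronglyMeasurable)
    ((ae_restrict_mem hs).mono fun z hz => (ContinuousLinearMap.le_opNorm _ _).trans
      (mul_le_mul_of_nonneg_right (hM z hz) (norm_nonneg _)))

theorem grad_eq_conj {F : ℂ → ℝ} {y c : ℂ} (h : fderiv ℝ F y = reMul c) :
    grad F y = starRingEnd ℂ c := by
  rw [grad, h]
  apply Complex.ext <;> simp

/-- The field `conj (discKernel a)` has divergence `2π δ_a`. -/
theorem integral_fderiv_discKernel_of_hasCompactSupport {a : ℂ} (ha : ‖a‖ < 1) {ψ : ℂ → ℝ}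
    (hψ : ContDiff ℝ 1 ψ) (hc : HasCompactSupport ψ) (hs : tsupport ψ ⊆ Metric.ball 0 1) :
    ∫ z in Metric.ball (0 : ℂ) 1, fderiv ℝ ψ z (starRingEnd ℂ (discKernel a z)) =
      -(2 * Real.pi * ψ a) := by
  obtain ⟨M, hM⟩ := (hc.fderiv (𝕜 := ℝ)).exists_bound_of_continuous
    (hψ.continuous_fderiv one_ne_zero)
  have hcf := (hψ.continuous_fderiv one_ne_zero).aestronglyMeasurable
    (μ := volume.restrict (Metric.ball (0 : ℂ) 1))
  have h0 : ∀ y, y ∉ Metric.ball (0 : ℂ) 1 → ψ y = 0 := fun y hy =>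
    image_eq_zero_of_notMem_tsupport fun h => hy (hs h)
  have h0' : ∀ y, y ∉ Metric.ball (0 : ℂ) 1 → fderiv ℝ ψ y = 0 := fun y hy =>
    image_eq_zero_of_notMem_tsupport fun h => hy (hs (tsupport_fderiv_subset ℝ h))
  -- the singular part
  have hsing : ∫ z in Metric.ball (0 : ℂ) 1, fderiv ℝ ψ z (starRingEnd ℂ (z - a)⁻¹) =
      -(2 * Real.pi * ψ a) := by
    rw [setIntegral_eq_integral_of_forall_compl_eq_zero (fun y hy => by simp [h0' y hy]),
      ← integral_add_right_eq_self _ a]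
    simp only [add_sub_cancel_right]
    have hK : ∀ w, fderiv ℝ (fun w => ψ (w + a)) w = fderiv ℝ ψ (w + a) := fun w =>
      fderiv_comp_add_right a
    have hKd : ContDiff ℝ 1 fun w => ψ (w + a) := hψ.comp (contDiff_id.add contDiff_const)
    have hout : ∀ w : ℂ, 2 ≤ ‖w‖ → w + a ∉ Metric.ball (0 : ℂ) 1 := by
      intro w hw h
      rw [mem_ball_zero_iff] at h
      have := norm_sub_le (w + a) a
      rw [add_sub_cancel_right] at this
      linarith
    -- After recentring at `a` the support lies in the ball of radius `2`, so no boundary term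
    -- survives on the circle of radius `3`.
    have hr := integral_fderiv_radial (K := fun w => ψ (w + a)) (R := 3) (M := M) (by norm_num)
      hKd.continuous.continuousOn hKd.contDiffOn fun z _ => by rw [hK]; exact hM _
    simp only [hK] at hr
    rw [setIntegral_eq_integral_of_forall_compl_eq_zero] at hr
    · rw [hr, zero_add]
      have : ∀ θ : ℝ, ψ (((3 : ℝ) : ℂ) * (Real.cos θ + Real.sin θ * Complex.I) + a) = 0 := by
        intro θ
        refine h0 _ (hout _ ?_)
        rw [norm_mul, Complex.ofReal_cos, Complex.ofReal_sin, Complex.norm_cos_add_sin_mul_I]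
        norm_num
      simp only [this]
      simp
    · intro w hw
      rw [h0' _ (hout w _)]
      · simp
      · rw [mem_ball_zero_iff] at hw; linarith
  -- the harmonic part
  set h : ℂ → ℝ := fun z => Real.log ‖1 - starRingEnd ℂ a * z‖ with hh
  have hne : ∀ z ∈ Metric.ball (0 : ℂ) 1, 1 - starRingEnd ℂ a * z ≠ 0 := fun z hz =>
    one_sub_conj_mul_ne_zero ha (mem_ball_zero_iff.1 hz).le
  have hharm : ∀ z ∈ Metric.ball (0 : ℂ) 1, InnerProductSpace.HarmonicAt h z := fun z hz =>
    AnalyticAt.harmonicAt_log_norm (by fun_prop) (hne z hz)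
  have hgrad : ∀ z ∈ Metric.ball (0 : ℂ) 1, grad h z =
      starRingEnd ℂ (-(starRingEnd ℂ a * (1 - starRingEnd ℂ a * z)⁻¹)) := by
    intro z hz
    refine grad_eq_conj ?_
    have h1 := hasFDerivAt_log_norm (((hasFDerivAt_id z).const_mul (starRingEnd ℂ a)).const_sub 1)
      (hne z hz)
    have h2 : HasFDerivAt h _ z := h1
    rw [h2.fderiv]
    refine ContinuousLinearMap.ext fun v => ?_
    simp only [ContinuousLinearMap.comp_apply, reMul_apply, Complex.reCLM_apply, smul_apply,
      neg_apply, smul_eq_mul, ContinuousLinearMap.id_apply, id]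
    congr 1
    ring
  have hreg : ∫ z in Metric.ball (0 : ℂ) 1, fderiv ℝ ψ z
      (starRingEnd ℂ (-(starRingEnd ℂ a * (1 - starRingEnd ℂ a * z)⁻¹))) = 0 := by
    have hl := integral_laplacian_mul Metric.isOpen_ball (F := h)
      (fun z hz => (hharm z hz).1.contDiffWithinAt) hψ hc hs
    have e1 : ∫ z in Metric.ball (0 : ℂ) 1, Laplacian.laplacian h z * ψ z = 0 := by
      refine setIntegral_eq_zero_of_forall_eq_zero fun z hz => ?_
      have : Laplacian.laplacian h z = 0 := (hharm z hz).2.self_of_nhds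
      rw [this, zero_mul]
    rw [e1] at hl
    rw [← neg_eq_zero, hl]
    congr 1
    refine setIntegral_congr_fun measurableSet_ball fun z hz => ?_
    rw [hgrad z hz]
  have hi1 : IntegrableOn (fun z => (z - a)⁻¹) (Metric.ball (0 : ℂ) 1) := by
    have hk1 : IntegrableOn (fun y => ‖y - a‖⁻¹) (Metric.ball (0 : ℂ) 1) := by
      simpa [Real.rpow_neg_one] using
        integrableOn_norm_sub_rpow Metric.isBounded_ball (p := 1) (by norm_num) a
    refine hk1.mono' (by fun_prop) (ae_of_all _ fun z => by rw [norm_inv])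
  have hi2 : IntegrableOn (fun z => -(starRingEnd ℂ a * (1 - starRingEnd ℂ a * z)⁻¹))
      (Metric.ball (0 : ℂ) 1) := by
    have := (integrableOn_discKernel ha).sub hi1
    refine this.congr (ae_of_all _ fun z => ?_)
    simp [discKernel]
  have hconj : ∀ {f : ℂ → ℂ}, IntegrableOn f (Metric.ball (0 : ℂ) 1) →
      IntegrableOn (fun z => starRingEnd ℂ (f z)) (Metric.ball (0 : ℂ) 1) := fun hf =>
    Complex.conjCLE.toContinuousLinearMap.integrable_comp hf
  rw [← hsing, ← add_zero (∫ z in Metric.ball (0 : ℂ) 1, fderiv ℝ ψ z (starRingEnd ℂ (z - a)⁻¹)),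
    ← hreg, ← integral_add
      (integrableOn_clm_apply_of_bound measurableSet_ball hcf (fun z _ => hM z) (hconj hi1))
      (integrableOn_clm_apply_of_bound measurableSet_ball hcf (fun z _ => hM z) (hconj hi2))]
  refine setIntegral_congr_fun measurableSet_ball fun z _ => ?_
  simp only [discKernel]
  rw [← map_add, ← map_add, sub_eq_add_neg]

/-- The kernels with poles `a` and `0` have the same flux through the unit circle; the exact
difference of their radial parts carries the factor `1 - |z|²`, so the difference field is
asymptotically tangential. -/
theorem re_discKernel_sub_inv_mul {a z : ℂ} (ha : ‖a‖ < 1) (hz : ‖z‖ ≤ 1) (hz0 : z ≠ 0)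
    (hza : z - a ≠ 0) : ((discKernel a z - z⁻¹) * z).re =
      (starRingEnd ℂ a * (1 - ‖z‖ ^ 2) /
        (starRingEnd ℂ (z - a) * (1 - starRingEnd ℂ a * z))).re := by
  have h1 : 1 - starRingEnd ℂ a * z ≠ 0 := one_sub_conj_mul_ne_zero ha hz
  have hza' : starRingEnd ℂ (z - a) ≠ 0 := (map_ne_zero _).2 hza
  have hzz : z * starRingEnd ℂ z = (‖z‖ : ℂ) ^ 2 := by
    rw [Complex.mul_conj, Complex.normSq_eq_norm_sq]; push_cast; ring
  have e : (discKernel a z - z⁻¹) * z = starRingEnd ℂ a * (1 - ‖z‖ ^ 2) /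
      (starRingEnd ℂ (z - a) * (1 - starRingEnd ℂ a * z)) +
      (a * (z - a)⁻¹ - starRingEnd ℂ (a * (z - a)⁻¹)) := by
    rw [map_sub] at hza'
    rw [discKernel, map_mul, map_inv₀, ← hzz, map_sub]
    generalize starRingEnd ℂ a = c at *
    generalize starRingEnd ℂ z = w at *
    have h1' : 1 - z * c ≠ 0 := by rwa [mul_comm]
    field_simp
    ring
  rw [e, Complex.add_re, Complex.sub_re, Complex.conj_re, sub_self, add_zero]

/-- Green's representation formula in the disc, in terms of the gradient. -/
theorem integral_fderiv_discKernel {a : ℂ} (ha : ‖a‖ < 1) {K : ℂ → ℝ} {M : ℝ}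
    (hc : ContinuousOn K (Metric.closedBall 0 1)) (hd : ContDiffOn ℝ 1 K (Metric.ball 0 1))
    (hM : ∀ z ∈ Metric.ball (0 : ℂ) 1, ‖fderiv ℝ K z‖ ≤ M) :
    ∫ z in Metric.ball (0 : ℂ) 1, fderiv ℝ K z (starRingEnd ℂ (discKernel a z)) =
      (∫ θ in (-Real.pi)..Real.pi, K (Real.cos θ + Real.sin θ * Complex.I))
        - 2 * Real.pi * K a := by
  have hconj : ∀ {f : ℂ → ℂ}, IntegrableOn f (Metric.ball (0 : ℂ) 1) →
      IntegrableOn (fun z => starRingEnd ℂ (f z)) (Metric.ball (0 : ℂ) 1) := fun hf =>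
    Complex.conjCLE.toContinuousLinearMap.integrable_comp hf
  have hk0 : ∀ z, discKernel 0 z = z⁻¹ := fun z => by simp [discKernel]
  have hKm : AEStronglyMeasurable (fderiv ℝ K) (volume.restrict (Metric.ball (0 : ℂ) 1)) :=
    (hd.continuousOn_fderiv_of_isOpen Metric.isOpen_ball le_rfl).aestronglyMeasurable
      measurableSet_ball
  have hia := integrableOn_discKernel ha
  have hi0 := integrableOn_discKernel (a := 0) (by simp)
  -- For the pole `0` the formula is `integral_fderiv_radial`, so only the difference of the two
  -- fields is needed. It is tangential at the circle, hence boundary cutoffs may be inserted and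
  -- removed; with a cutoff each pole contributes just its point value.
  set m : ℂ → ℂ := fun z => starRingEnd ℂ (discKernel a z - discKernel 0 z) with hm
  have hmi : IntegrableOn m (Metric.ball (0 : ℂ) 1) := hconj (hia.sub hi0)
  have hrad := integral_fderiv_radial one_pos hc hd hM
  obtain ⟨B, hB⟩ := (isCompact_closedBall (0 : ℂ) 1).exists_bound_of_continuousOn hc
  have htan : ∀ η : ℝ, 0 < η → ∃ ε : ℝ, 0 < ε ∧ ∀ z ∈ Metric.ball (0 : ℂ) 1, 1 - ‖z‖ ^ 2 < ε →
      |fderiv ℝ (fun z : ℂ => 1 - ‖z‖ ^ 2) z (m z)| ≤ η := by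
    intro η hη
    have h1a : 0 < 1 - ‖a‖ := by linarith
    have h0a := norm_nonneg a
    -- The first threshold keeps `z` at distance at least `(1 - |a|)/2` from the pole; the second
    -- makes the quotient with denominator `(1 - |a|)²/2` at most `η/2`.
    refine ⟨min (1 - ((1 + ‖a‖) / 2) ^ 2) (η * (1 - ‖a‖) ^ 2 / 4), ?_, fun z hz hzε => ?_⟩
    · refine lt_min ?_ (by positivity)
      nlinarith
    have hz1 : ‖z‖ < 1 := mem_ball_zero_iff.1 hz
    have hz2 : (1 + ‖a‖) / 2 < ‖z‖ := by
      have := hzε.trans_le (min_le_left _ _)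
      nlinarith [norm_nonneg z]
    have hz3 : 1 - ‖z‖ ^ 2 < η * (1 - ‖a‖) ^ 2 / 4 := hzε.trans_le (min_le_right _ _)
    have hz0 : z ≠ 0 := by rintro rfl; simp at hz2; linarith
    have hza2 : (1 - ‖a‖) / 2 ≤ ‖z - a‖ := by
      have := norm_sub_norm_le z a; linarith
    have hza : z - a ≠ 0 := norm_pos_iff.1 (by linarith)
    have hfd : fderiv ℝ (fun z : ℂ => 1 - ‖z‖ ^ 2) z (m z) =
        -(2 * ((discKernel a z - z⁻¹) * z).re) := by
      have h := ((hasFDerivAt_id z).norm_sq (F := ℂ)).const_sub 1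
      have h' : HasFDerivAt (fun z : ℂ => 1 - ‖z‖ ^ 2) _ z := h
      rw [h'.fderiv]
      simp only [hm, hk0, neg_apply, smul_apply, ContinuousLinearMap.comp_apply,
        ContinuousLinearMap.id_apply, innerSL_apply_apply, Complex.inner, id, nsmul_eq_mul]
      rw [← Complex.conj_re, map_mul, Complex.conj_conj, Complex.conj_conj]
      simp
    rw [hfd, re_discKernel_sub_inv_mul ha hz1.le hz0 hza, abs_neg, abs_mul, abs_two]
    have h1 : ‖starRingEnd ℂ a * (1 - ‖z‖ ^ 2) /
        (starRingEnd ℂ (z - a) * (1 - starRingEnd ℂ a * z))‖ ≤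
        1 * (1 - ‖z‖ ^ 2) / ((1 - ‖a‖) / 2 * (1 - ‖a‖)) := by
      rw [norm_div, norm_mul, norm_mul, RCLike.norm_conj, RCLike.norm_conj]
      have e1 : ‖(1 : ℂ) - ‖z‖ ^ 2‖ = 1 - ‖z‖ ^ 2 := by
        rw [show (1 : ℂ) - ‖z‖ ^ 2 = ((1 - ‖z‖ ^ 2 : ℝ) : ℂ) by push_cast; ring, Complex.norm_real,
          Real.norm_of_nonneg (by nlinarith [norm_nonneg z])]
      rw [e1]
      have e2 := one_sub_norm_le_norm_one_sub_conj_mul (b := a) hz1.le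
      have e3 : 0 ≤ 1 - ‖z‖ ^ 2 := by nlinarith [norm_nonneg z]
      gcongr
    have h2 := (Complex.abs_re_le_norm _).trans h1
    have h3 : 1 * (1 - ‖z‖ ^ 2) / ((1 - ‖a‖) / 2 * (1 - ‖a‖)) ≤ η / 2 := by
      rw [div_le_iff₀ (by positivity)]; nlinarith
    linarith
  have hint : IntegrableOn (fun z => fderiv ℝ K z (m z)) (Metric.ball 0 1) :=
    integrableOn_clm_apply_of_bound measurableSet_ball hKm hM hmi
  have hlim := isDefiningFunction_disc.tendsto_integral_mul_cutoff Metric.isOpen_ball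
    hmi.aestronglyMeasurable htan hd (fun z hz => hB z (Metric.ball_subset_closedBall hz)) hint
  have hlim2 : Tendsto (fun κ : ℝ => ∫ z in Metric.ball (0 : ℂ) 1, fderiv ℝ
      (fun y => K y * cutoff (Metric.ball (0 : ℂ) 1) (fun z => 1 - ‖z‖ ^ 2) κ y) z (m z)) atTop
      (𝓝 (2 * Real.pi * K 0 - 2 * Real.pi * K a)) := by
    refine tendsto_const_nhds.congr' ?_
    have hone : ∀ w : ℂ, ‖w‖ < 1 → ∀ᶠ κ : ℝ in atTop,
        cutoff (Metric.ball (0 : ℂ) 1) (fun z => 1 - ‖z‖ ^ 2) κ w = 1 := by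
      intro w hw
      have hpos : 0 < 1 - ‖w‖ ^ 2 := by nlinarith [norm_nonneg w]
      filter_upwards [eventually_gt_atTop (2 / (1 - ‖w‖ ^ 2))] with τ hτ
      rw [cutoff_of_mem (mem_ball_zero_iff.2 hw), Real.smoothTransition.one_of_one_le]
      have := (div_lt_iff₀ hpos).1 hτ
      linarith
    filter_upwards [hone a ha, hone 0 (by simp), eventually_gt_atTop 0] with κ h1 h2 hκ
    have hψ := isDefiningFunction_disc.contDiff_mul_cutoff Metric.isOpen_ball hκ hd
    have hsub := isDefiningFunction_disc.tsupport_mul_cutoff_subset hκ K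
    have hcs : HasCompactSupport _ :=
      (isDefiningFunction_disc.isCompact _ (inv_pos.2 hκ)).of_isClosed_subset
        (isClosed_tsupport _) hsub
    obtain ⟨M', hM'⟩ := (hcs.fderiv (𝕜 := ℝ)).exists_bound_of_continuous
      (hψ.continuous_fderiv one_ne_zero)
    have hmeas := (hψ.continuous_fderiv one_ne_zero).aestronglyMeasurable
      (μ := volume.restrict (Metric.ball (0 : ℂ) 1))
    simp only [hm, map_sub]
    rw [integral_sub
      (integrableOn_clm_apply_of_bound measurableSet_ball hmeas (fun z _ => hM' z) (hconj hia))
      (integrableOn_clm_apply_of_bound measurableSet_ball hmeas (fun z _ => hM' z) (hconj hi0)),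
      integral_fderiv_discKernel_of_hasCompactSupport ha hψ hcs (hsub.trans fun z hz => hz.1),
      integral_fderiv_discKernel_of_hasCompactSupport (a := 0) (by simp) hψ hcs
        (hsub.trans fun z hz => hz.1), h1, h2]
    ring
  have huniq := tendsto_nhds_unique hlim hlim2
  have hiz : Integrable (fun z => fderiv ℝ K z (starRingEnd ℂ z⁻¹))
      (volume.restrict (Metric.ball (0 : ℂ) 1)) := by
    have := integrableOn_clm_apply_of_bound measurableSet_ball hKm hM (hconj hi0)
    simp only [hk0] at this
    exact this
  have hsplit : ∫ z in Metric.ball (0 : ℂ) 1, fderiv ℝ K z (m z) =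
      (∫ z in Metric.ball (0 : ℂ) 1, fderiv ℝ K z (starRingEnd ℂ (discKernel a z))) -
      ∫ z in Metric.ball (0 : ℂ) 1, fderiv ℝ K z (starRingEnd ℂ z⁻¹) := by
    rw [← integral_sub
      (integrableOn_clm_apply_of_bound measurableSet_ball hKm hM (hconj hia)) hiz]
    refine integral_congr_ae (ae_of_all _ fun z => ?_)
    simp only [hm, hk0, map_sub]
  rw [hsplit, hrad] at huniq
  simp only [Complex.ofReal_one, one_mul] at huniq
  linarith

/-! ### Arc length on the boundary in conformal coordinates. -/

theorem exists_disjoint_measurable_cover {f : ℝ → ℝ} (hf : ∀ θ, 0 < f θ) :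
    ∃ (x : ℕ → ℝ) (D : ℕ → Set ℝ), (∀ k, MeasurableSet (D k)) ∧ Pairwise (Function.onFun Disjoint D) ∧
      (⋃ k, D k) = univ ∧ ∀ k, D k ⊆ Metric.ball (x k) (f (x k)) := by
  obtain ⟨s, hs, hsu⟩ := TopologicalSpace.countable_cover_nhds
    (fun θ => Metric.ball_mem_nhds θ (hf θ))
  have hne : s.Nonempty := by
    rw [nonempty_iff_ne_empty]; rintro rfl
    rw [biUnion_empty] at hsu
    exact empty_ne_univ hsu
  obtain ⟨x, rfl⟩ := hs.exists_eq_range hne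
  refine ⟨x, disjointed fun k => Metric.ball (x k) (f (x k)), ?_, disjoint_disjointed _, ?_,
    fun k => disjointed_subset _ k⟩
  · exact fun k => MeasurableSet.disjointed (fun _ => measurableSet_ball) k
  · rw [iUnion_disjointed, ← hsu, biUnion_range]

/-- One-dimensional area formula for injective curves that are infinitesimally, and locally
uniformly, dilated by the factor `w`. -/
theorem hausdorffMeasure_image_curve {γ : ℝ → ℂ} {w : ℝ → ℝ} (hγc : Continuous γ)
    (hw : Continuous w) (hw0 : ∀ θ, 0 < w θ)
    (hγ : ∀ θ₀, ∀ c : ℝ, 1 < c → ∃ δ : ℝ, 0 < δ ∧ ∀ s ∈ Metric.ball θ₀ δ, ∀ t ∈ Metric.ball θ₀ δ,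
      c⁻¹ * w θ₀ * ‖s - t‖ ≤ ‖γ s - γ t‖ ∧ ‖γ s - γ t‖ ≤ c * w θ₀ * ‖s - t‖)
    {A : Set ℝ} (hA : MeasurableSet A) (hinj : InjOn γ A) :
    Measure.hausdorffMeasure 1 (γ '' A) = ∫⁻ θ in A, ENNReal.ofReal (w θ) := by
  -- local comparison
  have hloc : ∀ c : ℝ, 1 < c → ∀ θ₀, ∃ δ : ℝ, 0 < δ ∧ ∀ E ⊆ Metric.ball θ₀ δ, MeasurableSet E →
      InjOn γ E →
      Measure.hausdorffMeasure 1 (γ '' E) ≤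
        ENNReal.ofReal (c ^ 2) * ∫⁻ θ in E, ENNReal.ofReal (w θ) ∧
      ∫⁻ θ in E, ENNReal.ofReal (w θ) ≤
        ENNReal.ofReal (c ^ 2) * Measure.hausdorffMeasure 1 (γ '' E) := by
    intro c hc θ₀
    have hc0 : 0 < c := by linarith
    obtain ⟨δ₁, hδ₁, h1⟩ := hγ θ₀ c hc
    have hcl : c⁻¹ * w θ₀ < w θ₀ := by
      have := inv_lt_one_of_one_lt₀ hc; nlinarith [hw0 θ₀]
    have hcu : w θ₀ < c * w θ₀ := by nlinarith [hw0 θ₀]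
    obtain ⟨δ₂, hδ₂, h2⟩ := Metric.mem_nhds_iff.1
      (hw.continuousAt.preimage_mem_nhds (Ioo_mem_nhds hcl hcu))
    refine ⟨min δ₁ δ₂, by positivity, fun E hE hEm hEi => ?_⟩
    have hE1 : ∀ s ∈ E, s ∈ Metric.ball θ₀ δ₁ := fun s hs =>
      Metric.ball_subset_ball (min_le_left _ _) (hE hs)
    have hE2 : ∀ s ∈ E, c⁻¹ * w θ₀ < w s ∧ w s < c * w θ₀ := fun s hs =>
      h2 (Metric.ball_subset_ball (min_le_right _ _) (hE hs))
    have hup : Measure.hausdorffMeasure 1 (γ '' E) ≤ ENNReal.ofReal (c * w θ₀) * volume E := by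
      have hl : LipschitzOnWith (Real.toNNReal (c * w θ₀)) γ E := by
        refine LipschitzOnWith.of_dist_le_mul fun s hs t ht => ?_
        rw [dist_eq_norm, dist_eq_norm, Real.coe_toNNReal _ (by have := hw0 θ₀; positivity)]
        exact (h1 s (hE1 s hs) t (hE1 t ht)).2
      have := hl.hausdorffMeasure_image_le zero_le_one
      rwa [ENNReal.rpow_one, hausdorffMeasure_real] at this
    have hlow : volume E ≤ ENNReal.ofReal ((c⁻¹ * w θ₀)⁻¹) *
        Measure.hausdorffMeasure 1 (γ '' E) := by
      have hpos : 0 < c⁻¹ * w θ₀ := by have := hw0 θ₀; positivity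
      have hl : LipschitzOnWith (Real.toNNReal (c⁻¹ * w θ₀)⁻¹) (Function.invFunOn γ E)
          (γ '' E) := by
        refine LipschitzOnWith.of_dist_le_mul ?_
        rintro _ ⟨s, hs, rfl⟩ _ ⟨t, ht, rfl⟩
        rw [hEi.leftInvOn_invFunOn hs, hEi.leftInvOn_invFunOn ht, dist_eq_norm, dist_eq_norm,
          Real.coe_toNNReal _ (by positivity), ← div_eq_inv_mul, le_div_iff₀ hpos, mul_comm]
        exact (h1 s (hE1 s hs) t (hE1 t ht)).1
      have := hl.hausdorffMeasure_image_le zero_le_one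
      rwa [ENNReal.rpow_one, hausdorffMeasure_real, hEi.leftInvOn_invFunOn.image_image] at this
    constructor
    · calc Measure.hausdorffMeasure 1 (γ '' E) ≤ ENNReal.ofReal (c * w θ₀) * volume E := hup
        _ = ENNReal.ofReal (c ^ 2) * ∫⁻ θ in E, ENNReal.ofReal (c⁻¹ * w θ₀) := by
          rw [setLIntegral_const, ← mul_assoc, ← ENNReal.ofReal_mul (by positivity)]
          congr 2; field_simp
        _ ≤ _ := by
          exact mul_le_mul' le_rfl
            (setLIntegral_mono' hEm fun s hs => ENNReal.ofReal_le_ofReal (hE2 s hs).1.le)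
    · calc ∫⁻ θ in E, ENNReal.ofReal (w θ) ≤ ∫⁻ θ in E, ENNReal.ofReal (c * w θ₀) :=
          setLIntegral_mono' hEm fun s hs => ENNReal.ofReal_le_ofReal (hE2 s hs).2.le
        _ = ENNReal.ofReal (c * w θ₀) * volume E := setLIntegral_const _ _
        _ ≤ ENNReal.ofReal (c * w θ₀) * (ENNReal.ofReal ((c⁻¹ * w θ₀)⁻¹) *
            Measure.hausdorffMeasure 1 (γ '' E)) := by gcongr
        _ = _ := by
          have := hw0 θ₀
          rw [← mul_assoc, ← ENNReal.ofReal_mul (by positivity)]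
          congr 2; field_simp
  -- The factor is `c²`: one `c` from the dilation of `γ`, one from the oscillation of `w`. It does
  -- not depend on the piece, so it survives summation over a countable partition, and then `c → 1`.
  have hglob : ∀ c : ℝ, 1 < c → Measure.hausdorffMeasure 1 (γ '' A) ≤
        ENNReal.ofReal (c ^ 2) * ∫⁻ θ in A, ENNReal.ofReal (w θ) ∧
      ∫⁻ θ in A, ENNReal.ofReal (w θ) ≤
        ENNReal.ofReal (c ^ 2) * Measure.hausdorffMeasure 1 (γ '' A) := by
    intro c hc
    choose δ hδ h using hloc c hc
    obtain ⟨x, D, hDm, hDd, hDu, hDs⟩ := exists_disjoint_measurable_cover hδ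
    have hAm : ∀ k, MeasurableSet (A ∩ D k) := fun k => hA.inter (hDm k)
    have hAi : ∀ k, InjOn γ (A ∩ D k) := fun k => hinj.mono inter_subset_left
    have hAd : Pairwise (Function.onFun Disjoint fun k => A ∩ D k) := fun i j hij =>
      (hDd hij).mono inter_subset_right inter_subset_right
    have hAu : A = ⋃ k, A ∩ D k := by rw [← inter_iUnion, hDu, inter_univ]
    have e1 : ∫⁻ θ in A, ENNReal.ofReal (w θ) = ∑' k, ∫⁻ θ in A ∩ D k, ENNReal.ofReal (w θ) := by
      conv_lhs => rw [hAu]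
      exact lintegral_iUnion hAm hAd _
    have e2 : (Measure.hausdorffMeasure 1 (γ '' A) : ℝ≥0∞) =
        ∑' k, Measure.hausdorffMeasure 1 (γ '' (A ∩ D k)) := by
      conv_lhs => rw [hAu, image_iUnion]
      refine measure_iUnion (fun i j hij => ?_) fun k =>
        (hAm k).image_of_continuousOn_injOn hγc.continuousOn (hAi k)
      refine Set.disjoint_left.2 ?_
      rintro _ ⟨a, ha, rfl⟩ ⟨b, hb, hab⟩
      exact Set.disjoint_left.1 (hAd hij) ha (hinj hb.1 ha.1 hab ▸ hb)
    rw [e1, e2, ← ENNReal.tsum_mul_left, ← ENNReal.tsum_mul_left]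
    have hk := fun k => h (x k) (A ∩ D k) (inter_subset_right.trans (hDs k)) (hAm k) (hAi k)
    exact ⟨ENNReal.tsum_le_tsum fun k => (hk k).1, ENNReal.tsum_le_tsum fun k => (hk k).2⟩
  have hlim : ∀ X Y : ℝ≥0∞, (∀ c : ℝ, 1 < c → X ≤ ENNReal.ofReal (c ^ 2) * Y) → X ≤ Y := by
    intro X Y hXY
    have h1 : Tendsto (fun c : ℝ => ENNReal.ofReal (c ^ 2)) (𝓝[>] 1) (𝓝 1) := by
      have h2 : Continuous fun c : ℝ => ENNReal.ofReal (c ^ 2) :=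
        ENNReal.continuous_ofReal.comp (continuous_pow 2)
      simpa using (h2.tendsto 1).mono_left nhdsWithin_le_nhds
    have h3 := ENNReal.Tendsto.mul_const (b := Y) h1 (Or.inl one_ne_zero)
    rw [one_mul] at h3
    exact ge_of_tendsto h3 (by filter_upwards [self_mem_nhdsWithin] with c hc using hXY c hc)
  exact le_antisymm (hlim _ _ fun c hc => (hglob c hc).1) (hlim _ _ fun c hc => (hglob c hc).2)

/-- Change of variables for line integrals along such curves. -/
theorem integral_hausdorffMeasure_curve {γ : ℝ → ℂ} {w : ℝ → ℝ} (hγc : Continuous γ)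
    (hw : Continuous w) (hw0 : ∀ θ, 0 < w θ)
    (hγ : ∀ θ₀, ∀ c : ℝ, 1 < c → ∃ δ : ℝ, 0 < δ ∧ ∀ s ∈ Metric.ball θ₀ δ, ∀ t ∈ Metric.ball θ₀ δ,
      c⁻¹ * w θ₀ * ‖s - t‖ ≤ ‖γ s - γ t‖ ∧ ‖γ s - γ t‖ ≤ c * w θ₀ * ‖s - t‖)
    {I : Set ℝ} (hI : MeasurableSet I) (hinj : InjOn γ I) {f : ℂ → ℝ}
    (hf : AEStronglyMeasurable f ((Measure.hausdorffMeasure 1).restrict (γ '' I))) :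
    (IntegrableOn f (γ '' I) (Measure.hausdorffMeasure 1) ↔
      IntegrableOn (fun θ => w θ * f (γ θ)) I) ∧
    ∫ y in γ '' I, f y ∂(Measure.hausdorffMeasure 1) = ∫ θ in I, w θ * f (γ θ) := by
  set μ : Measure ℝ := (volume.restrict I).withDensity fun θ => ENNReal.ofReal (w θ) with hμ
  have hwm : Measurable fun θ => ENNReal.ofReal (w θ) :=
    (ENNReal.continuous_ofReal.comp hw).measurable
  -- The area formula on every measurable piece says exactly that arc length is the push-forward of
  -- `w dθ`.
  have hmap : (Measure.hausdorffMeasure 1).restrict (γ '' I) = μ.map γ := by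
    ext B hB
    have hBm := hγc.measurable hB
    rw [Measure.restrict_apply hB, Measure.map_apply hγc.measurable hB, hμ,
      withDensity_apply _ hBm, Measure.restrict_restrict hBm, ← image_preimage_inter]
    exact hausdorffMeasure_image_curve hγc hw hw0 hγ (hBm.inter hI)
      (hinj.mono inter_subset_right)
  have hlt : ∀ᵐ θ ∂(volume.restrict I), ENNReal.ofReal (w θ) < ⊤ :=
    ae_of_all _ fun _ => ENNReal.ofReal_lt_top
  have e : ∀ θ, (ENNReal.ofReal (w θ)).toReal • f (γ θ) = w θ * f (γ θ) := fun θ => by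
    rw [ENNReal.toReal_ofReal (hw0 θ).le, smul_eq_mul]
  rw [hmap] at hf
  constructor
  · rw [IntegrableOn, hmap, integrable_map_measure hf hγc.aemeasurable, hμ,
      integrable_withDensity_iff_integrable_smul' hwm hlt]
    simp only [Function.comp_apply, e]
    rfl
  · rw [hmap, integral_map hγc.aemeasurable hf, hμ,
      integral_withDensity_eq_integral_toReal_smul hwm hlt]
    simp only [e]

/-- The parametrization of the unit circle by the angle. -/
def unitCircle (θ : ℝ) : ℂ := Real.cos θ + Real.sin θ * Complex.I

theorem unitCircle_eq_exp (θ : ℝ) : unitCircle θ = Complex.exp (θ * Complex.I) := by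
  rw [unitCircle, Complex.exp_mul_I, Complex.ofReal_cos, Complex.ofReal_sin]

theorem norm_unitCircle (θ : ℝ) : ‖unitCircle θ‖ = 1 := by
  rw [unitCircle_eq_exp, Complex.norm_exp_ofReal_mul_I]

theorem continuous_unitCircle : Continuous unitCircle := by
  unfold unitCircle; fun_prop

theorem hasStrictDerivAt_unitCircle (θ : ℝ) :
    HasStrictDerivAt unitCircle (unitCircle θ * Complex.I) θ := by
  have h1 : HasStrictDerivAt (fun θ : ℝ => (θ : ℂ) * Complex.I) Complex.I θ := by
    simpa using! (Complex.ofRealCLM.hasStrictDerivAt (x := θ)).mul_const Complex.I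
  have h2 := h1.cexp
  simp only [← unitCircle_eq_exp] at h2
  exact h2

theorem bijOn_unitCircle :
    BijOn unitCircle (Ioc (-Real.pi) Real.pi) (Metric.sphere 0 1) := by
  refine ⟨fun θ _ => mem_sphere_zero_iff_norm.2 (norm_unitCircle θ), fun s hs t ht h => ?_,
    fun z hz => ?_⟩
  · rw [unitCircle, unitCircle, Complex.ofReal_cos, Complex.ofReal_sin, Complex.ofReal_cos,
      Complex.ofReal_sin] at h
    rw [← Complex.arg_cos_add_sin_mul_I hs, h, Complex.arg_cos_add_sin_mul_I ht]
  · have hz1 := mem_sphere_zero_iff_norm.1 hz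
    refine ⟨Complex.arg z, Complex.arg_mem_Ioc z, ?_⟩
    have := Complex.norm_mul_exp_arg_mul_I z
    rwa [hz1, Complex.ofReal_one, one_mul, ← unitCircle_eq_exp] at this

section conformal

variable {Ω : Set ℂ} {φ : ℂ → ℂ}

/-- The inverse conformal map is strictly differentiable up to the boundary of the disc. -/
theorem IsConformalOntoDisc.discInv_strict (hΩ : IsC21Domain Ω)
    (hφ : IsConformalOntoDisc Ω φ) {ζ : ℂ} (hζ : ζ ∈ Metric.closedBall (0 : ℂ) 1) {ε : ℝ}
    (hε : 0 < ε) : ∃ δ : ℝ, 0 < δ ∧ ∀ z ∈ Metric.closedBall (0 : ℂ) 1 ∩ Metric.ball ζ δ,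
      ∀ z' ∈ Metric.closedBall (0 : ℂ) 1 ∩ Metric.ball ζ δ,
      ‖discInv Ω φ z - discInv Ω φ z' - (cderiv Ω φ (discInv Ω φ ζ))⁻¹ * (z - z')‖ ≤
        ε * ‖z - z'‖ := by
  have hψc := hφ.continuousOn_discInv hΩ
  have hκc : ContinuousOn (fun z => (cderiv Ω φ (discInv Ω φ z))⁻¹) (Metric.closedBall 0 1) :=
    ((hφ.continuousOn_cderiv hΩ).comp hψc fun z hz => hφ.discInv_mem_closure hz).inv₀
      fun z hz => hφ.cderiv_ne_zero hΩ (hφ.discInv_mem_closure hz)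
  obtain ⟨δ, hδ, h⟩ := Metric.continuousOn_iff.1 hκc ζ hζ ε hε
  refine ⟨δ, hδ, ?_⟩
  set κ := (cderiv Ω φ (discInv Ω φ ζ))⁻¹ with hκ
  -- the estimate in the open disc, by convexity
  have hopen : ∀ z ∈ Metric.ball (0 : ℂ) 1 ∩ Metric.ball ζ δ,
      ∀ z' ∈ Metric.ball (0 : ℂ) 1 ∩ Metric.ball ζ δ,
      ‖discInv Ω φ z - discInv Ω φ z' - κ * (z - z')‖ ≤ ε * ‖z - z'‖ := by
    intro z hz z' hz'
    have hconv := (convex_ball (0 : ℂ) 1).inter (convex_ball ζ δ)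
    have := hconv.norm_image_sub_le_of_norm_hasDerivWithin_le
      (f := fun z => discInv Ω φ z - κ * z)
      (f' := fun z => (cderiv Ω φ (discInv Ω φ z))⁻¹ - κ) (C := ε) (x := z') (y := z)
      (fun w hw => ?_) (fun w hw => ?_) hz' hz
    · have e : discInv Ω φ z - discInv Ω φ z' - κ * (z - z') =
          (discInv Ω φ z - κ * z) - (discInv Ω φ z' - κ * z') := by ring
      rw [e]; exact this
    · have h1 := hφ.hasDerivAt_discInv hΩ hw.1
      have h2 := (hasDerivAt_id w).const_mul κ
      simpa using! (h1.sub h2).hasDerivWithinAt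
    · rw [← dist_eq_norm]
      exact (h w (Metric.ball_subset_closedBall hw.1) hw.2).le
  -- radial limits
  intro z hz z' hz'
  have hr : ∀ w ∈ Metric.closedBall (0 : ℂ) 1 ∩ Metric.ball ζ δ,
      Tendsto (fun r : ℝ => (r : ℂ) * w) (𝓝[<] 1) (𝓝 w) ∧
      Tendsto (fun r : ℝ => discInv Ω φ (r * w)) (𝓝[<] 1) (𝓝 (discInv Ω φ w)) ∧
      ∀ᶠ r : ℝ in 𝓝[<] 1, (r : ℂ) * w ∈ Metric.ball (0 : ℂ) 1 ∩ Metric.ball ζ δ := by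
    intro w hw
    have hw1 : ‖w‖ ≤ 1 := mem_closedBall_zero_iff.1 hw.1
    have h1 : Tendsto (fun r : ℝ => (r : ℂ) * w) (𝓝[<] 1) (𝓝 w) := by
      have : Continuous fun r : ℝ => (r : ℂ) * w := by fun_prop
      simpa using (this.tendsto 1).mono_left nhdsWithin_le_nhds
    have h2 : ∀ᶠ r : ℝ in 𝓝[<] 1, (r : ℂ) * w ∈ Metric.ball (0 : ℂ) 1 := by
      filter_upwards [Ioo_mem_nhdsLT (show (0 : ℝ) < 1 by norm_num)] with r hr
      rw [mem_ball_zero_iff, norm_mul, Complex.norm_real, Real.norm_of_nonneg hr.1.le]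
      nlinarith [hr.1, hr.2, norm_nonneg w]
    refine ⟨h1, ?_, h2.and (h1.eventually (Metric.isOpen_ball.mem_nhds hw.2))⟩
    refine (hψc w hw.1).tendsto.comp (tendsto_nhdsWithin_iff.2 ⟨h1, ?_⟩)
    exact h2.mono fun r hr => Metric.ball_subset_closedBall hr
  obtain ⟨a1, a2, a3⟩ := hr z hz
  obtain ⟨b1, b2, b3⟩ := hr z' hz'
  refine le_of_tendsto_of_tendsto ((a2.sub b2).sub ((a1.sub b1).const_mul κ)).norm
    ((a1.sub b1).norm.const_mul ε) ?_
  filter_upwards [a3, b3] with r h1 h2 using hopen _ h1 _ h2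

/-- The curve composes a map strictly differentiable up to the boundary with the unit speed
parametrization of the circle. Strictness, with two moving points, is what yields two-sided bounds
near `θ₀`. -/
theorem IsConformalOntoDisc.discInv_unitCircle_dilation (hΩ : IsC21Domain Ω)
    (hφ : IsConformalOntoDisc Ω φ) (θ₀ : ℝ) {c : ℝ} (hc : 1 < c) :
    ∃ δ : ℝ, 0 < δ ∧ ∀ s ∈ Metric.ball θ₀ δ, ∀ t ∈ Metric.ball θ₀ δ,
      c⁻¹ * ‖(cderiv Ω φ (discInv Ω φ (unitCircle θ₀)))⁻¹‖ * ‖s - t‖ ≤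
        ‖discInv Ω φ (unitCircle s) - discInv Ω φ (unitCircle t)‖ ∧
      ‖discInv Ω φ (unitCircle s) - discInv Ω φ (unitCircle t)‖ ≤
        c * ‖(cderiv Ω φ (discInv Ω φ (unitCircle θ₀)))⁻¹‖ * ‖s - t‖ := by
  have hmem : ∀ θ, unitCircle θ ∈ Metric.closedBall (0 : ℂ) 1 := fun θ =>
    mem_closedBall_zero_iff.2 (norm_unitCircle θ).le
  set κ := (cderiv Ω φ (discInv Ω φ (unitCircle θ₀)))⁻¹ with hκ
  have hκ0 : 0 < ‖κ‖ := norm_pos_iff.2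
    (inv_ne_zero (hφ.cderiv_ne_zero hΩ (hφ.discInv_mem_closure (hmem θ₀))))
  have hc1 : 0 < 1 - c⁻¹ := by have := inv_lt_one_of_one_lt₀ hc; linarith
  -- Then `‖κ‖ - η = c⁻¹ ‖κ‖`, and `‖κ‖ + η ≤ c ‖κ‖` because `1 - c⁻¹ ≤ c - 1`.
  set η := (1 - c⁻¹) * ‖κ‖ with hη
  have hη0 : 0 < η := by positivity
  have hη2 : η ≤ (c - 1) * ‖κ‖ := by
    rw [hη]
    refine mul_le_mul_of_nonneg_right ?_ (norm_nonneg _)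
    have : c⁻¹ * c = 1 := inv_mul_cancel₀ (by linarith)
    nlinarith [mul_nonneg hc1.le (show 0 ≤ c - 1 by linarith)]
  -- The inverse map contributes an error `ε ‖u‖ ≤ 2ε|s - t|` (this uses `ε ≤ 1`), and the circle
  -- contributes `‖κ‖ ε |s - t|`.
  set ε := min 1 (η / (2 + ‖κ‖)) with hε
  have hε0 : 0 < ε := by positivity
  have hε1 : ε ≤ 1 := min_le_left _ _
  have hε2 : ε * (2 + ‖κ‖) ≤ η := by
    rw [← le_div_iff₀ (by positivity)]; exact min_le_right _ _
  obtain ⟨δ₁, hδ₁, h1⟩ := hφ.discInv_strict hΩ (hmem θ₀) hε0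
  have h2 := (hasStrictDerivAt_unitCircle θ₀).hasStrictFDerivAt.isLittleO.def hε0
  rw [Metric.eventually_nhds_iff] at h2
  obtain ⟨δ₂, hδ₂, h2⟩ := h2
  obtain ⟨δ₃, hδ₃, h3⟩ := Metric.continuousAt_iff.1 continuous_unitCircle.continuousAt δ₁ hδ₁
  refine ⟨min δ₂ δ₃, by positivity, fun s hs t ht => ?_⟩
  rw [Metric.mem_ball] at hs ht
  have e1 := h1 (unitCircle s) ⟨hmem s, h3 (hs.trans_le (min_le_right _ _))⟩
    (unitCircle t) ⟨hmem t, h3 (ht.trans_le (min_le_right _ _))⟩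
  have e2 := @h2 (s, t) (by
    rw [Prod.dist_eq]
    exact max_lt (hs.trans_le (min_le_left _ _)) (ht.trans_le (min_le_left _ _)))
  simp only [ContinuousLinearMap.toSpanSingleton_apply] at e2
  set τ := unitCircle θ₀ * Complex.I with hτ
  have hτn : ‖τ‖ = 1 := by rw [hτ, norm_mul, norm_unitCircle, Complex.norm_I, one_mul]
  have e3 : ‖(s - t) • τ‖ = ‖s - t‖ := by rw [norm_smul, hτn, mul_one]
  set u := unitCircle s - unitCircle t with hu
  set d := discInv Ω φ (unitCircle s) - discInv Ω φ (unitCircle t) with hd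
  have e4 : ‖u‖ ≤ 2 * ‖s - t‖ := by
    have := norm_le_norm_add_norm_sub' u ((s - t) • τ)
    rw [e3] at this
    nlinarith [norm_nonneg (s - t)]
  have e5 : ‖d - κ * ((s - t) • τ)‖ ≤ η * ‖s - t‖ := by
    have : d - κ * ((s - t) • τ) = (d - κ * u) + κ * (u - (s - t) • τ) := by ring
    rw [this]
    refine (norm_add_le _ _).trans ?_
    rw [norm_mul]
    have e6 : ‖κ‖ * ‖u - (s - t) • τ‖ ≤ ‖κ‖ * (ε * ‖s - t‖) := by gcongr
    have e7 : ε * ‖u‖ ≤ ε * (2 * ‖s - t‖) := by gcongr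
    nlinarith [norm_nonneg (s - t)]
  have e8 : ‖κ * ((s - t) • τ)‖ = ‖κ‖ * ‖s - t‖ := by rw [norm_mul, e3]
  have e9 := norm_sub_norm_le d (κ * ((s - t) • τ))
  have e10 := norm_sub_norm_le (κ * ((s - t) • τ)) d
  rw [norm_sub_rev _ d] at e10
  rw [e8] at e9 e10
  constructor <;> nlinarith [norm_nonneg (s - t)]

/-- Line integrals over the boundary, in conformal coordinates. -/
theorem IsConformalOntoDisc.integral_frontier (hΩ : IsC21Domain Ω)
    (hφ : IsConformalOntoDisc Ω φ) {F : ℂ → ℝ} (hF : ContinuousOn F (closure Ω)) :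
    IntegrableOn (fun p => ‖cderiv Ω φ p‖ * F p) (frontier Ω) (Measure.hausdorffMeasure 1) ∧
    ∫ p in frontier Ω, ‖cderiv Ω φ p‖ * F p ∂(Measure.hausdorffMeasure 1) =
      ∫ θ in (-Real.pi)..Real.pi, F (discInv Ω φ (unitCircle θ)) := by
  have hmem : ∀ θ, unitCircle θ ∈ Metric.closedBall (0 : ℂ) 1 := fun θ =>
    mem_closedBall_zero_iff.2 (norm_unitCircle θ).le
  have hcl : ∀ θ, discInv Ω φ (unitCircle θ) ∈ closure Ω := fun θ =>
    hφ.discInv_mem_closure (hmem θ)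
  have hγc : Continuous fun θ => discInv Ω φ (unitCircle θ) :=
    (hφ.continuousOn_discInv hΩ).comp_continuous continuous_unitCircle hmem
  have hwc : Continuous fun θ => ‖(cderiv Ω φ (discInv Ω φ (unitCircle θ)))⁻¹‖ :=
    (((hφ.continuousOn_cderiv hΩ).comp_continuous hγc hcl).inv₀
      fun θ => hφ.cderiv_ne_zero hΩ (hcl θ)).norm
  have hw0 : ∀ θ, 0 < ‖(cderiv Ω φ (discInv Ω φ (unitCircle θ)))⁻¹‖ := fun θ =>
    norm_pos_iff.2 (inv_ne_zero (hφ.cderiv_ne_zero hΩ (hcl θ)))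
  have himg : (fun θ => discInv Ω φ (unitCircle θ)) '' Ioc (-Real.pi) Real.pi = frontier Ω := by
    have h1 := image_comp (discInv Ω φ) unitCircle (Ioc (-Real.pi) Real.pi)
    rw [bijOn_unitCircle.image_eq] at h1
    refine h1.trans (Subset.antisymm ?_ fun p hp => ?_)
    · rintro _ ⟨z, hz, rfl⟩
      exact hφ.discInv_mem_frontier hz
    · exact ⟨φ p, hφ.bijOn_boundary.mapsTo hp, hφ.discInv_apply (frontier_subset_closure hp)⟩
  have hinj : InjOn (fun θ => discInv Ω φ (unitCircle θ)) (Ioc (-Real.pi) Real.pi) := by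
    intro s hs t ht h
    refine bijOn_unitCircle.injOn hs ht ?_
    rw [← hφ.apply_discInv (hmem s), ← hφ.apply_discInv (hmem t)]
    exact congrArg φ h
  have hfc : ContinuousOn (fun p => ‖cderiv Ω φ p‖ * F p) (frontier Ω) :=
    (((hφ.continuousOn_cderiv hΩ).norm).mul hF).mono frontier_subset_closure
  have hmain := integral_hausdorffMeasure_curve hγc hwc hw0
    (fun θ₀ c hc => hφ.discInv_unitCircle_dilation hΩ θ₀ hc) measurableSet_Ioc hinj
    (f := fun p => ‖cderiv Ω φ p‖ * F p) (by
      rw [himg]; exact hfc.aestronglyMeasurable isClosed_frontier.measurableSet)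
  -- The density `|φ'|` of the normal derivative cancels the speed of the parametrization, leaving
  -- the plain angular measure.
  have e : ∀ θ, ‖(cderiv Ω φ (discInv Ω φ (unitCircle θ)))⁻¹‖ *
      (‖cderiv Ω φ (discInv Ω φ (unitCircle θ))‖ * F (discInv Ω φ (unitCircle θ))) =
      F (discInv Ω φ (unitCircle θ)) := fun θ => by
    rw [norm_inv, inv_mul_cancel_left₀ (norm_ne_zero_iff.2 (hφ.cderiv_ne_zero hΩ (hcl θ)))]
  simp only [himg, e] at hmain
  have hFc : Continuous fun θ => F (discInv Ω φ (unitCircle θ)) :=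
    hF.comp_continuous hγc hcl
  have hpi := Real.pi_pos
  refine ⟨hmain.1.2 ((hFc.integrableOn_Icc).mono_set Ioc_subset_Icc_self), ?_⟩
  rw [hmain.2, intervalIntegral.integral_of_le (by linarith)]

end conformal

/-! ### The representation formula for the Neumann problem. -/

/-- Both arguments of the logarithms in `N` are at most `2`, and the power `1/2` is the one that
`IsDefiningFunction.integral_mul_eq` admits. -/
theorem abs_log_le_rpow {t : ℝ} (h0 : 0 < t) (h2 : t ≤ 2) :
    |Real.log t| ≤ 2 * t ^ (-(1 / 2) : ℝ) := by
  rw [Real.rpow_neg h0.le, ← div_eq_mul_inv, le_div_iff₀ (by positivity)]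
  by_cases h1 : t ≤ 1
  · have := (Real.abs_log_mul_self_rpow_lt t (1 / 2) h0 h1 (by norm_num)).le
    rw [abs_mul, abs_of_nonneg (Real.rpow_nonneg h0.le _)] at this
    linarith
  · have h1 : 1 < t := not_le.1 h1
    rw [abs_of_nonneg (Real.log_nonneg h1.le)]
    have e1 := Real.log_le_sub_one_of_pos h0
    have e2 : t ^ (1 / 2 : ℝ) ≤ 2 := by
      rw [← Real.sqrt_eq_rpow]
      exact Real.sqrt_le_iff.2 ⟨by norm_num, by linarith⟩
    have e3 : 0 ≤ t ^ (1 / 2 : ℝ) := by positivity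
    nlinarith [Real.log_nonneg h1.le]

section conformal

variable {Ω : Set ℂ} {φ : ℂ → ℂ}

theorem IsConformalOntoDisc.exists_abs_pullbackGreen_le (hΩ : IsC21Domain Ω)
    (hφ : IsConformalOntoDisc Ω φ) {x : ℂ} (hx : x ∈ Ω) : ∃ B : ℝ, 0 < B ∧
      ∀ y ∈ Ω \ {x}, |pullbackGreen φ x y| ≤ B * ‖y - x‖ ^ (-(1 / 2) : ℝ) := by
  obtain ⟨A, hA, hlow⟩ := hφ.exists_norm_sub_le hΩ
  obtain ⟨R, hR⟩ := hΩ.isBounded.subset_closedBall x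
  have hx1 := hφ.norm_lt_one hx
  have h1x : 0 < 1 - ‖φ x‖ := by linarith
  refine ⟨(2 * Real.pi)⁻¹ * (2 * A ^ (1 / 2 : ℝ) +
    2 * ((1 - ‖φ x‖) ^ (-(1 / 2) : ℝ) * |R| ^ (1 / 2 : ℝ))), ?_, fun y hy => ?_⟩
  · have := Real.rpow_pos_of_pos hA (1 / 2)
    positivity
  have h0 : 0 < ‖y - x‖ := norm_pos_iff.2 (_root_.sub_ne_zero.2 hy.2)
  have hyR : ‖y - x‖ ≤ |R| := by
    have := hR hy.1
    rw [Metric.mem_closedBall, dist_eq_norm] at this; exact this.trans (le_abs_self _)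
  have hφ0 : 0 < ‖φ y - φ x‖ := norm_pos_iff.2 (hφ.sub_ne_zero hx (subset_closure hy.1) hy.2)
  have hy1 := hφ.norm_lt_one hy.1
  rw [pullbackGreen_eq, abs_mul, abs_of_nonneg (by positivity : (0 : ℝ) ≤ (2 * Real.pi)⁻¹),
    mul_assoc, add_mul]
  gcongr
  refine (abs_add_le _ _).trans (add_le_add ?_ ?_)
  · refine (abs_log_le_rpow hφ0 ((norm_sub_le _ _).trans (by linarith))).trans ?_
    rw [mul_assoc]
    gcongr
    have e1 : A⁻¹ * ‖y - x‖ ≤ ‖φ y - φ x‖ := by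
      rw [inv_mul_le_iff₀ hA]; exact hlow y hy.1 x hx
    refine (Real.rpow_le_rpow_of_nonpos (by positivity) e1 (by norm_num)).trans ?_
    rw [Real.mul_rpow (by positivity) h0.le, Real.inv_rpow hA.le, Real.rpow_neg hA.le, inv_inv]
  · have e1 := one_sub_norm_le_norm_one_sub_conj_mul (b := φ x) hy1.le
    have e2 : ‖1 - starRingEnd ℂ (φ x) * φ y‖ ≤ 2 := by
      refine (norm_sub_le _ _).trans ?_
      rw [norm_mul, RCLike.norm_conj, norm_one]
      nlinarith [norm_nonneg (φ x), norm_nonneg (φ y)]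
    refine (abs_log_le_rpow (h1x.trans_le e1) e2).trans ?_
    rw [mul_assoc, mul_assoc]
    gcongr
    refine (Real.rpow_le_rpow_of_nonpos h1x e1 (by norm_num)).trans ?_
    refine le_mul_of_one_le_right (by positivity) ?_
    rw [Real.rpow_neg h0.le, ← div_eq_mul_inv, one_le_div (by positivity)]
    exact Real.rpow_le_rpow h0.le hyR (by norm_num)

/-- A rearrangement of `cderiv_mul_normal`, which exhibits the derivative of `1 - |φ|²` at the
boundary as a multiple of the inner product with the normal. -/
theorem IsConformalOntoDisc.conj_mul_cderiv (hΩ : IsC21Domain Ω) (hφ : IsConformalOntoDisc Ω φ)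
    {p ν : ℂ} (hp : p ∈ frontier Ω) (hν : IsOuterUnitNormal Ω p ν) :
    starRingEnd ℂ (φ p) * cderiv Ω φ p = ‖cderiv Ω φ p‖ * starRingEnd ℂ ν := by
  have hone : ∀ {z : ℂ}, ‖z‖ = 1 → starRingEnd ℂ z * z = 1 := fun {z} hz => by
    rw [mul_comm, Complex.mul_conj, Complex.normSq_eq_norm_sq, hz]; simp
  have h1 := hone (hφ.norm_eq_one hp)
  have h2 := hone hν.1
  have h3 := hφ.cderiv_mul_normal hΩ hp hν
  linear_combination (starRingEnd ℂ (φ p)) * (starRingEnd ℂ ν) * h3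
    + (‖cderiv Ω φ p‖ : ℂ) * starRingEnd ℂ ν * h1 - starRingEnd ℂ (φ p) * cderiv Ω φ p * h2

theorem integrableOn_of_continuousOn_closure {E : Type*} [NormedAddCommGroup E]
    (hΩ : IsC21Domain Ω) {m : ℂ → E} (hm : ContinuousOn m (closure Ω)) : IntegrableOn m Ω :=
  (hm.integrableOn_compact hΩ.isCompact_closure).mono_set subset_closure

/-- Integration by parts on `Ω` for a continuous field tangential to the boundary. -/
theorem IsConformalOntoDisc.integral_mul_eq (hΩ : IsC21Domain Ω) (hφ : IsConformalOntoDisc Ω φ)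
    {n : ℂ → ℂ} (hn : ∀ p ∈ frontier Ω, IsOuterUnitNormal Ω p (n p)) {m : ℂ → ℂ} {g : ℂ → ℝ}
    (hm : ContinuousOn m (closure Ω)) (hmn : ∀ p ∈ frontier Ω, inner ℝ (m p) (n p) = 0)
    (hdiv : HasDivIn Ω m g) (hg : IntegrableOn g Ω) {x : ℂ} {Φ : ℂ → ℝ}
    (hΦ : ContDiffOn ℝ 1 Φ (Ω \ {x})) {B : ℝ}
    (hB : ∀ y ∈ Ω \ {x}, |Φ y| ≤ B * ‖y - x‖ ^ (-(1 / 2) : ℝ))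
    (hB' : ∀ y ∈ Ω \ {x}, ‖fderiv ℝ Φ y‖ ≤ B * ‖y - x‖⁻¹)
    (hgΦ : IntegrableOn (fun y => g y * Φ y) Ω) :
    IntegrableOn (fun y => fderiv ℝ Φ y (m y)) Ω ∧
      ∫ y in Ω, g y * Φ y = -∫ y in Ω, fderiv ℝ Φ y (m y) := by
  obtain ⟨C, hd⟩ := hφ.isDefiningFunction hΩ
  obtain ⟨M, hM⟩ := hΩ.isCompact_closure.exists_bound_of_continuousOn hm
  refine hd.integral_mul_eq hΩ.isOpen hΩ.isBounded hdiv hg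
    (integrableOn_of_continuousOn_closure hΩ hm).aestronglyMeasurable
    (fun y hy => hM y (subset_closure hy)) (fun η hη => ?_) hΦ hB hB' hgΦ
  -- This is the derivative of `1 - |φ|²` along `m`, extended continuously to the boundary; there it
  -- equals `-2|φ'| m·n = 0`, so it is small in thin layers.
  have hc : ContinuousOn (fun y => -(2 * (starRingEnd ℂ (φ y) * cderiv Ω φ y * m y).re))
      (closure Ω) := by
    have h1 : ContinuousOn (fun y => starRingEnd ℂ (φ y) * cderiv Ω φ y * m y) (closure Ω) :=
      ((Complex.continuous_conj.comp_continuousOn hφ.contDiffOn.continuousOn).mul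
        (hφ.continuousOn_cderiv hΩ)).mul hm
    exact (continuousOn_const.mul (Complex.continuous_re.comp_continuousOn h1)).neg
  have hc0 : ∀ p ∈ frontier Ω, -(2 * (starRingEnd ℂ (φ p) * cderiv Ω φ p * m p).re) = 0 := by
    intro p hp
    have h1 := hmn p hp
    rw [Complex.inner, ← Complex.conj_re, map_mul, Complex.conj_conj] at h1
    rw [hφ.conj_mul_cderiv hΩ hp (hn p hp), mul_assoc, Complex.re_ofReal_mul, h1]
    simp
  obtain ⟨ε, hε, h⟩ := hφ.exists_layer_small hΩ hc hc0 hη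
  refine ⟨ε, hε, fun y hy hyε => ?_⟩
  rw [hφ.fderiv_one_sub_norm_sq hΩ hy]
  exact h y hy hyε

/-- The gradient with one-sided values at the boundary. -/
def gradWithin (Ω : Set ℂ) (F : ℂ → ℝ) (y : ℂ) : ℂ :=
  fderivWithin ℝ F (closure Ω) y 1 + fderivWithin ℝ F (closure Ω) y Complex.I * Complex.I

theorem gradWithin_eq_grad (hΩ : IsOpen Ω) (F : ℂ → ℝ) {y : ℂ} (hy : y ∈ Ω) :
    gradWithin Ω F y = grad F y := by
  rw [gradWithin, grad, fderivWithin_closure_of_mem hΩ F hy]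

theorem inner_gradWithin (F : ℂ → ℝ) (y v : ℂ) :
    inner ℝ (gradWithin Ω F y) v = fderivWithin ℝ F (closure Ω) y v := by
  rw [clm_apply_eq (fderivWithin ℝ F (closure Ω) y) v]; simp [gradWithin, Complex.inner]

theorem continuousOn_gradWithin (hΩ : IsC21Domain Ω) {F : ℂ → ℝ}
    (hF : ContDiffOn ℝ 1 F (closure Ω)) : ContinuousOn (gradWithin Ω F) (closure Ω) := by
  have h := hF.continuousOn_fderivWithin hΩ.uniqueDiffOn le_rfl
  refine (Complex.continuous_ofReal.comp_continuousOn (h.clm_apply continuousOn_const)).add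
    ((Complex.continuous_ofReal.comp_continuousOn (h.clm_apply continuousOn_const)).mul
      continuousOn_const)

/-- Green's representation formula on `Ω`, in terms of the gradient. -/
theorem IsConformalOntoDisc.integral_fderiv_pullbackGreen_grad (hΩ : IsC21Domain Ω)
    (hφ : IsConformalOntoDisc Ω φ) {F : ℂ → ℝ} (hF : ContDiffOn ℝ 1 F (closure Ω)) {x : ℂ}
    (hx : x ∈ Ω) : ∫ y in Ω, fderiv ℝ (pullbackGreen φ x) y (gradWithin Ω F y) =
      (2 * Real.pi)⁻¹ * (∫ θ in (-Real.pi)..Real.pi, F (discInv Ω φ (unitCircle θ))) - F x := by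
  obtain ⟨A, hA, hb⟩ := hφ.exists_cderiv_bounds hΩ
  obtain ⟨M, hM⟩ := hΩ.isCompact_closure.exists_bound_of_continuousOn
    (hF.continuousOn_fderivWithin hΩ.uniqueDiffOn le_rfl)
  have hFΩ : ContDiffOn ℝ 1 F Ω := hF.mono subset_closure
  have hFd : ∀ y ∈ Ω, HasFDerivAt F (fderiv ℝ F y) y := fun y hy =>
    ((hFΩ.contDiffAt (hΩ.isOpen.mem_nhds hy)).differentiableAt one_ne_zero).hasFDerivAt
  set K : ℂ → ℝ := fun z => F (discInv Ω φ z) with hK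
  have hKc : ContinuousOn K (Metric.closedBall 0 1) :=
    hF.continuousOn.comp (hφ.continuousOn_discInv hΩ) fun z hz => hφ.discInv_mem_closure hz
  have hψd : ContDiffOn ℝ 1 (discInv Ω φ) (Metric.ball 0 1) := by
    have : DifferentiableOn ℂ (discInv Ω φ) (Metric.ball 0 1) := fun z hz =>
      (hφ.hasDerivAt_discInv hΩ hz).differentiableAt.differentiableWithinAt
    exact (this.contDiffOn (n := 1) Metric.isOpen_ball).restrict_scalars ℝ
  have hKd : ContDiffOn ℝ 1 K (Metric.ball 0 1) :=
    hFΩ.comp hψd fun z hz => hφ.discInv_mem hz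
  have hKf : ∀ z ∈ Metric.ball (0 : ℂ) 1, fderiv ℝ K z = (fderiv ℝ F (discInv Ω φ z)).comp
      ((cderiv Ω φ (discInv Ω φ z))⁻¹ • (1 : ℂ →L[ℝ] ℂ)) := fun z hz =>
    ((hFd _ (hφ.discInv_mem hz)).comp z
      (hφ.hasDerivAt_discInv hΩ hz).complexToReal_fderiv).fderiv
  have hKM : ∀ z ∈ Metric.ball (0 : ℂ) 1, ‖fderiv ℝ K z‖ ≤ M * A := by
    intro z hz
    rw [hKf z hz]
    have h1 := hM _ (subset_closure (hφ.discInv_mem hz))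
    rw [fderivWithin_closure_of_mem hΩ.isOpen F (hφ.discInv_mem hz)] at h1
    refine ContinuousLinearMap.opNorm_le_bound _
      (mul_nonneg ((norm_nonneg _).trans h1) hA.le) fun v => ?_
    have h2 := (hb _ (subset_closure (hφ.discInv_mem hz))).2
    rw [ContinuousLinearMap.comp_apply]
    refine (ContinuousLinearMap.le_opNorm _ _).trans ?_
    rw [smul_apply, one_apply_eq_self, smul_eq_mul, norm_mul, ← mul_assoc]
    gcongr
    exact (norm_nonneg _).trans h1
  have hdisc := integral_fderiv_discKernel (hφ.norm_lt_one hx) hKc hKd hKM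
  have hcv := integral_image_eq_integral_abs_det_fderiv_smul volume hΩ.isOpen.measurableSet
    (fun y hy => (hφ.hasDerivAt hΩ hy).complexToReal_fderiv.hasFDerivWithinAt)
    hφ.bijOn_interior.injOn
    (fun z => fderiv ℝ K z (starRingEnd ℂ (discKernel (φ x) z)))
  rw [hφ.bijOn_interior.image_eq, hdisc] at hcv
  -- Pointwise conformal invariance of the Dirichlet pairing: the chain rule factors of the two
  -- gradients combine into the Jacobian `|φ'|²`.
  have hpt : ∀ᵐ y ∂(volume.restrict Ω), fderiv ℝ (pullbackGreen φ x) y (gradWithin Ω F y) =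
      (2 * Real.pi)⁻¹ * (|(cderiv Ω φ y • (1 : ℂ →L[ℝ] ℂ)).det| •
        fderiv ℝ K (φ y) (starRingEnd ℂ (discKernel (φ x) (φ y)))) := by
    filter_upwards [ae_restrict_mem hΩ.isOpen.measurableSet, (measure_eq_zero_iff_ae_notMem.1
      (measure_singleton x) : ∀ᵐ y ∂(volume.restrict Ω), y ∉ ({x} : Set ℂ))] with y hy hyx
    rw [hφ.fderiv_pullbackGreen_apply hΩ hx hy hyx, det_smul_one, abs_of_nonneg (by positivity),
      gradWithin_eq_grad hΩ.isOpen F hy]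
    congr 1
    set c := cderiv Ω φ y with hc
    set G := discKernel (φ x) (φ y) with hG
    have e1 : (G * c * grad F y).re = fderiv ℝ F y (starRingEnd ℂ (G * c)) := by
      rw [fderiv_apply_eq_inner_grad, Complex.inner, ← map_mul, Complex.conj_re]
    have hc0 : c ≠ 0 := hφ.cderiv_ne_zero hΩ (subset_closure hy)
    have e2 : c⁻¹ * ((‖c‖ ^ 2 : ℝ) • starRingEnd ℂ G) = starRingEnd ℂ (G * c) := by
      rw [Complex.real_smul, Complex.sq_norm, ← Complex.mul_conj, map_mul]
      field_simp
    rw [e1, ← map_smul, hKf _ (hφ.bijOn_interior.mapsTo hy),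
      hφ.discInv_apply (subset_closure hy), ContinuousLinearMap.comp_apply, smul_apply,
      one_apply_eq_self, smul_eq_mul, e2]
  rw [integral_congr_ae hpt, integral_const_mul, ← hcv]
  have hKx : K (φ x) = F x := by rw [hK]; simp only; rw [hφ.discInv_apply (subset_closure hx)]
  rw [hKx, mul_sub, ← mul_assoc, inv_mul_cancel₀ (by positivity), one_mul]
  rfl

theorem continuousOn_force (hΩ : IsC21Domain Ω) {ρ : ℂ → ℝ} {u ut H : ℂ → ℂ}
    (hρ : ContinuousOn ρ (closure Ω)) (hut : ContinuousOn ut (closure Ω))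
    (hu : ContDiffOn ℝ 1 u (closure Ω)) (hH : ContDiffOn ℝ 1 H (closure Ω)) :
    ContinuousOn (uDot Ω u ut) (closure Ω) ∧ ContinuousOn (advect Ω H) (closure Ω) ∧
      ContinuousOn (force Ω ρ u ut H) (closure Ω) := by
  have h1 : ContinuousOn (uDot Ω u ut) (closure Ω) :=
    hut.add ((hu.continuousOn_fderivWithin hΩ.uniqueDiffOn le_rfl).clm_apply hu.continuousOn)
  have h2 : ContinuousOn (advect Ω H) (closure Ω) :=
    (hH.continuousOn_fderivWithin hΩ.uniqueDiffOn le_rfl).clm_apply hH.continuousOn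
  exact ⟨h1, h2, (hρ.smul h1).sub h2⟩

theorem IsConformalOntoDisc.integrableOn_fderiv_pullbackGreen (hΩ : IsC21Domain Ω)
    (hφ : IsConformalOntoDisc Ω φ) {x : ℂ} (hx : x ∈ Ω) {m : ℂ → ℂ}
    (hm : ContinuousOn m (closure Ω)) :
    IntegrableOn (fun y => fderiv ℝ (pullbackGreen φ x) y (m y)) Ω := by
  obtain ⟨B, hB, hBb⟩ := hφ.exists_norm_fderiv_pullbackGreen_le hΩ hx
  obtain ⟨M, hM⟩ := hΩ.isCompact_closure.exists_bound_of_continuousOn hm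
  have hk1 : IntegrableOn (fun y => ‖y - x‖⁻¹) Ω := by
    simpa [Real.rpow_neg_one] using integrableOn_norm_sub_rpow hΩ.isBounded (p := 1) (by norm_num) x
  have hmeas : AEStronglyMeasurable (fderiv ℝ (pullbackGreen φ x)) (volume.restrict Ω) :=
    (measurable_fderiv ℝ _).aestronglyMeasurable
  refine ((hk1.const_mul B).mul_const M).mono' (aestronglyMeasurable_clm_apply hmeas
    (integrableOn_of_continuousOn_closure hΩ hm).aestronglyMeasurable) ?_
  filter_upwards [ae_restrict_mem hΩ.isOpen.measurableSet, (measure_eq_zero_iff_ae_notMem.1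
      (measure_singleton x) : ∀ᵐ y ∂(volume.restrict Ω), y ∉ ({x} : Set ℂ))] with y hy hyx
  exact (ContinuousLinearMap.le_opNorm _ _).trans (mul_le_mul (hBb y ⟨hy, hyx⟩)
    (hM y (subset_closure hy)) (norm_nonneg _) (by positivity))

/-- The representation formula for solutions of the Neumann problem. -/
theorem SolvesNeumann.representation (hΩ : IsC21Domain Ω) (hφ : IsConformalOntoDisc Ω φ)
    {n : ℂ → ℂ} (hn : ∀ p ∈ frontier Ω, IsOuterUnitNormal Ω p (n p)) {f : ℂ → ℂ} {F : ℂ → ℝ}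
    (hf : ContinuousOn f (closure Ω)) (hF : SolvesNeumann Ω n f F) {x : ℂ} (hx : x ∈ Ω) :
    IntegrableOn (kernel3 Ω n φ F x) (frontier Ω) (Measure.hausdorffMeasure 1) ∧
      F x = -(∫ y in Ω, fderiv ℝ (pullbackGreen φ x) y (f y)) + F3 Ω n φ F x := by
  have hG := continuousOn_gradWithin hΩ hF.contDiffOn_closure
  have hw : ContinuousOn (fun y => gradWithin Ω F y - f y) (closure Ω) := hG.sub hf
  -- Subtracting before integrating by parts leaves zero divergence, so no integrability of `ΔF` up
  -- to the boundary is needed; the flux condition makes the difference tangential.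
  have hdiv : HasDivIn Ω (fun y => gradWithin Ω F y - f y) (fun _ => 0) := by
    intro ψ hψ hc hs
    obtain ⟨M, hM⟩ := (hc.fderiv (𝕜 := ℝ)).exists_bound_of_continuous
      (hψ.continuous_fderiv (by simp))
    have hmeas := (hψ.continuous_fderiv (by simp)).aestronglyMeasurable (μ := volume.restrict Ω)
    have h1 := hF.equation ψ hψ hc hs
    have h2 := integral_laplacian_mul hΩ.isOpen hF.contDiffOn (hψ.of_le (by simp)) hc hs
    have h3 : ∫ y in Ω, fderiv ℝ ψ y (grad F y) = ∫ y in Ω, fderiv ℝ ψ y (gradWithin Ω F y) :=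
      setIntegral_congr_fun hΩ.isOpen.measurableSet fun y hy => by
        simp only [gradWithin_eq_grad hΩ.isOpen F hy]
    simp only [zero_mul, integral_zero, map_sub]
    rw [integral_sub
      (integrableOn_clm_apply_of_bound hΩ.isOpen.measurableSet hmeas (fun y _ => hM y)
        (integrableOn_of_continuousOn_closure hΩ hG))
      (integrableOn_clm_apply_of_bound hΩ.isOpen.measurableSet hmeas (fun y _ => hM y)
        (integrableOn_of_continuousOn_closure hΩ hf))]
    rw [h3] at h2
    linarith
  obtain ⟨B₁, hB₁, hb₁⟩ := hφ.exists_abs_pullbackGreen_le hΩ hx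
  obtain ⟨B₂, hB₂, hb₂⟩ := hφ.exists_norm_fderiv_pullbackGreen_le hΩ hx
  have hibp := (hφ.integral_mul_eq hΩ hn hw (fun p hp => ?_) hdiv integrableOn_zero
    (hφ.contDiffOn_pullbackGreen hx) (x := x) (B := max B₁ B₂)
    (fun y hy => (hb₁ y hy).trans (by gcongr; exact le_max_left _ _))
    (fun y hy => (hb₂ y hy).trans (by gcongr; exact le_max_right _ _))
    (by simp)).2
  · have hfi := hφ.integrableOn_fderiv_pullbackGreen hΩ hx hf
    have hGi := hφ.integrableOn_fderiv_pullbackGreen hΩ hx hG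
    simp only [zero_mul, integral_zero, map_sub] at hibp
    rw [integral_sub hGi hfi,
      hφ.integral_fderiv_pullbackGreen_grad hΩ hF.contDiffOn_closure hx] at hibp
    have hbd := hφ.integral_frontier hΩ hF.contDiffOn_closure.continuousOn
    have hk3 : ∀ y ∈ frontier Ω, kernel3 Ω n φ F x y =
        (2 * Real.pi)⁻¹ * (‖cderiv Ω φ y‖ * F y) := fun y hy => by
      rw [kernel3, hφ.dirDeriv_pullbackGreen hΩ hx hy (hn y hy), mul_assoc]
    have hmf : MeasurableSet (frontier Ω) := isClosed_frontier.measurableSet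
    refine ⟨IntegrableOn.congr_fun (hbd.1.const_mul (2 * Real.pi)⁻¹) (fun y hy => (hk3 y hy).symm) hmf,
      ?_⟩
    rw [F3, setIntegral_congr_fun hmf hk3, integral_const_mul, hbd.2]
    linarith
  · rw [inner_sub_left, inner_gradWithin]
    have := hF.flux p hp
    rw [dirDeriv] at this
    rw [this, sub_self]

end conformal

/-! ### Weakly singular kernels against `L^q` densities. -/

theorem lintegral_norm_sub_rpow_le {Ω : Set ℂ} {R : ℝ} (p : ℝ) {x : ℂ}
    (hR : Ω ⊆ Metric.closedBall x R) :
    ∫⁻ y in Ω, ENNReal.ofReal (‖y - x‖ ^ (-p)) ≤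
      ∫⁻ y in Metric.closedBall (0 : ℂ) R, ENNReal.ofReal (‖y‖ ^ (-p)) := by
  refine (lintegral_mono_set hR).trans (le_of_eq ?_)
  rw [← lintegral_indicator Metric.isClosed_closedBall.measurableSet,
    ← lintegral_indicator Metric.isClosed_closedBall.measurableSet,
    ← lintegral_sub_right_eq_self
      (indicator (Metric.closedBall 0 R) fun y : ℂ => ENNReal.ofReal (‖y‖ ^ (-p))) x]
  congr 1 with y
  simp [indicator, dist_eq_norm]

theorem lintegral_closedBall_norm_rpow_lt_top {p : ℝ} (hp : p < 2) (R : ℝ) :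
    ∫⁻ y in Metric.closedBall (0 : ℂ) R, ENNReal.ofReal (‖y‖ ^ (-p)) < ⊤ := by
  have h := integrableOn_norm_sub_rpow (Metric.isBounded_closedBall (x := (0 : ℂ)) (r := R)) hp 0
  have h2 := h.2
  rw [hasFiniteIntegral_iff_ofReal (ae_of_all _ fun y => by positivity)] at h2
  simpa using h2

/-- Hölder's inequality for a weakly singular kernel, uniform in the pole. -/
theorem exists_lintegral_mul_rpow_le {Ω : Set ℂ} (hb : Bornology.IsBounded Ω) {q : ℝ≥0∞}
    (hq : 2 < q) : ∃ s : ℝ, 0 < s ∧ s < 1 ∧ ∃ C : ℝ≥0∞, C ≠ ⊤ ∧ ∀ x ∈ Ω, ∀ g : ℂ → ℝ,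
      AEStronglyMeasurable g (volume.restrict Ω) →
      ∫⁻ y in Ω, ‖g y‖ₑ * ENNReal.ofReal (‖y - x‖ ^ (-(1 + s))) ≤
        C * eLpNorm g q (volume.restrict Ω) := by
  obtain ⟨R, hR⟩ := hb.subset_closedBall 0
  -- Since `q` may be infinite, Hölder's inequality is used with `min q 3`, which is finite and
  -- still exceeds `2`; its conjugate exponent is below `2`.
  have hq3 : min q 3 ≠ ⊤ := ((min_le_right _ _).trans_lt (by simp)).ne
  have hr2 : (2 : ℝ≥0∞) < min q 3 := lt_min hq (by norm_num)
  set r := (min q 3).toReal with hr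
  have hr2' : 2 < r := by
    rw [hr, ← ENNReal.toReal_ofNat 2]
    exact (ENNReal.toReal_lt_toReal (by simp) hq3).2 hr2
  set p := r / (r - 1) with hp
  have hp1 : 1 < p := by rw [hp, one_lt_div (by linarith)]; linarith
  have hp2 : p < 2 := by rw [hp, div_lt_iff₀ (by linarith)]; linarith
  have hrp : r.HolderConjugate p := by
    rw [Real.holderConjugate_iff]
    refine ⟨by linarith, ?_⟩
    rw [hp]
    field_simp
    ring
  -- `1 + s` is the midpoint of `1` and `2/p`, so `(1 + s) p < 2` and the kernel remains integrable.
  set s := (2 / p - 1) / 2 with hs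
  have hp0 : 0 < p := by linarith
  have h2p : 1 < 2 / p := by rw [one_lt_div hp0]; exact hp2
  have h2p' : 2 / p < 2 := by rw [div_lt_iff₀ hp0]; linarith
  have hsp : (1 + s) * p < 2 := by
    rw [hs]; field_simp; linarith
  refine ⟨s, by rw [hs]; linarith, by rw [hs]; linarith, volume.restrict Ω univ ^
    (1 / (min q 3).toReal - 1 / q.toReal) *
    (∫⁻ y in Metric.closedBall (0 : ℂ) (2 * R), ENNReal.ofReal (‖y‖ ^ (-((1 + s) * p)))) ^ (1 / p),
    ?_, fun x hx g hg => ?_⟩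
  · refine ENNReal.mul_ne_top ?_ (ENNReal.rpow_ne_top_of_nonneg (by positivity)
      (lintegral_closedBall_norm_rpow_lt_top hsp _).ne)
    rw [Measure.restrict_apply_univ]
    refine ENNReal.rpow_ne_top_of_nonneg ?_ hb.measure_lt_top.ne
    -- For `q = ⊤` the conventions `⊤.toReal = 0` and `1 / 0 = 0` leave the exponent `1 / (min q
    -- 3).toReal`, which is the right one.
    by_cases hqt : q = ⊤
    · rw [hqt]; simp
    · have : (min q 3).toReal ≤ q.toReal := ENNReal.toReal_mono hqt (min_le_left _ _)
      rw [sub_nonneg]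
      exact one_div_le_one_div_of_le (by linarith) this
  · have hsub : Ω ⊆ Metric.closedBall x (2 * R) := fun y hy => by
      have h1 := hR hy
      have h2 := hR hx
      rw [mem_closedBall_zero_iff] at h1 h2
      rw [Metric.mem_closedBall, dist_eq_norm]
      exact (norm_sub_le _ _).trans (by linarith)
    have hk : Measurable fun y : ℂ => ENNReal.ofReal (‖y - x‖ ^ (-(1 + s))) := by fun_prop
    refine (ENNReal.lintegral_mul_le_Lp_mul_Lq _ hrp hg.enorm hk.aemeasurable).trans ?_
    have e1 : (∫⁻ y in Ω, ‖g y‖ₑ ^ r) ^ (1 / r) = eLpNorm g (min q 3) (volume.restrict Ω) := by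
      rw [eLpNorm_eq_lintegral_rpow_enorm_toReal (by positivity) hq3]
    have e2 : ∀ y : ℂ, ENNReal.ofReal (‖y - x‖ ^ (-(1 + s))) ^ p =
        ENNReal.ofReal (‖y - x‖ ^ (-((1 + s) * p))) := fun y => by
      rw [ENNReal.ofReal_rpow_of_nonneg (by positivity) hp0.le, ← Real.rpow_mul (norm_nonneg _),
        neg_mul]
    rw [e1]
    simp_rw [e2]
    calc _ ≤ (eLpNorm g q (volume.restrict Ω) * volume.restrict Ω univ ^
          (1 / (min q 3).toReal - 1 / q.toReal)) * (∫⁻ y in Metric.closedBall (0 : ℂ) (2 * R),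
            ENNReal.ofReal (‖y‖ ^ (-((1 + s) * p)))) ^ (1 / p) := by
          refine mul_le_mul' (eLpNorm_le_eLpNorm_mul_rpow_measure_univ (min_le_left _ _) hg) ?_
          exact ENNReal.rpow_le_rpow (lintegral_norm_sub_rpow_le _ hsub) (by positivity)
      _ = _ := by ring

theorem exists_integral_mul_rpow_le {Ω : Set ℂ} (hb : Bornology.IsBounded Ω) {q : ℝ≥0∞}
    (hq : 2 < q) : ∃ s : ℝ, 0 < s ∧ s < 1 ∧ ∃ C : ℝ, 0 ≤ C ∧ ∀ x ∈ Ω, ∀ g : ℂ → ℝ,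
      MemLp g q (volume.restrict Ω) →
      IntegrableOn (fun y => |g y| * ‖y - x‖ ^ (-(1 + s))) Ω ∧
      ∫ y in Ω, |g y| * ‖y - x‖ ^ (-(1 + s)) ≤ C * (eLpNorm g q (volume.restrict Ω)).toReal := by
  obtain ⟨s, hs0, hs1, C, hC, h⟩ := exists_lintegral_mul_rpow_le hb hq
  refine ⟨s, hs0, hs1, C.toReal, by positivity, fun x hx g hg => ?_⟩
  have h1 := h x hx g hg.1
  have e : ∀ y, ENNReal.ofReal (|g y| * ‖y - x‖ ^ (-(1 + s))) =
      ‖g y‖ₑ * ENNReal.ofReal (‖y - x‖ ^ (-(1 + s))) := fun y => by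
    rw [ENNReal.ofReal_mul (abs_nonneg _), Real.enorm_eq_ofReal_abs]
  have hk : Measurable fun y : ℂ => ‖y - x‖ ^ (-(1 + s)) := by fun_prop
  have hm : AEStronglyMeasurable (fun y => |g y| * ‖y - x‖ ^ (-(1 + s))) (volume.restrict Ω) :=
    (continuous_abs.comp_aestronglyMeasurable hg.1).mul hk.aestronglyMeasurable
  have hnn : 0 ≤ᵐ[volume.restrict Ω] fun y => |g y| * ‖y - x‖ ^ (-(1 + s)) :=
    ae_of_all _ fun y => by positivity
  have htop : C * eLpNorm g q (volume.restrict Ω) ≠ ⊤ := ENNReal.mul_ne_top hC hg.2.ne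
  refine ⟨⟨hm, ?_⟩, ?_⟩
  · rw [hasFiniteIntegral_iff_ofReal hnn]
    simp_rw [e]
    exact h1.trans_lt htop.lt_top
  · rw [integral_eq_lintegral_of_nonneg_ae hnn hm, ← ENNReal.toReal_mul]
    simp_rw [e]
    exact ENNReal.toReal_mono htop h1

/-- Lower order singularities are dominated on a bounded set. -/
theorem exists_rpow_norm_sub_le {Ω : Set ℂ} (hb : Bornology.IsBounded Ω) {α β : ℝ} (hαβ : α ≤ β) :
    ∃ D : ℝ, 0 < D ∧ ∀ x ∈ Ω, ∀ y ∈ Ω, y ≠ x → ‖y - x‖ ^ (-α) ≤ D * ‖y - x‖ ^ (-β) := by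
  obtain ⟨R, hR⟩ := hb.subset_closedBall 0
  refine ⟨(2 * |R| + 1) ^ (β - α), by positivity, fun x hx y hy hyx => ?_⟩
  have h1 := hR hy
  have h2 := hR hx
  rw [mem_closedBall_zero_iff] at h1 h2
  have h0 : 0 < ‖y - x‖ := norm_pos_iff.2 (_root_.sub_ne_zero.2 hyx)
  have h3 : ‖y - x‖ ≤ 2 * |R| + 1 :=
    (norm_sub_le _ _).trans (by linarith [le_abs_self R])
  have e : ‖y - x‖ ^ (-α) = ‖y - x‖ ^ (β - α) * ‖y - x‖ ^ (-β) := by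
    rw [← Real.rpow_add h0]; congr 1; ring
  rw [e]
  gcongr

section conformal

variable {Ω : Set ℂ} {φ : ℂ → ℂ}

theorem ae_mem_diff_singleton (hΩ : IsOpen Ω) (x : ℂ) :
    ∀ᵐ y ∂(volume.restrict Ω), y ∈ Ω \ {x} := by
  filter_upwards [ae_restrict_mem hΩ.measurableSet, (measure_eq_zero_iff_ae_notMem.1
    (measure_singleton x) : ∀ᵐ y ∂(volume.restrict Ω), y ∉ ({x} : Set ℂ))] with y hy hyx
  exact ⟨hy, hyx⟩

/-- `∇N(x, ·)` defines a bounded functional on `L^q` for `q > 2`. -/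
theorem IsConformalOntoDisc.exists_integral_fderiv_pullbackGreen_le (hΩ : IsC21Domain Ω)
    (hφ : IsConformalOntoDisc Ω φ) {x : ℂ} (hx : x ∈ Ω) {q : ℝ≥0∞} (hq : 2 < q) :
    ∃ C : ℝ, 0 ≤ C ∧ ∀ m : ℂ → ℂ, MemLp m q (volume.restrict Ω) →
      IntegrableOn (fun y => fderiv ℝ (pullbackGreen φ x) y (m y)) Ω ∧
      |∫ y in Ω, fderiv ℝ (pullbackGreen φ x) y (m y)| ≤
        C * (eLpNorm m q (volume.restrict Ω)).toReal := by
  obtain ⟨s, hs0, hs1, C, hC, h⟩ := exists_integral_mul_rpow_le hΩ.isBounded hq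
  obtain ⟨B, hB, hBb⟩ := hφ.exists_norm_fderiv_pullbackGreen_le hΩ hx
  obtain ⟨D, hD, hDb⟩ := exists_rpow_norm_sub_le hΩ.isBounded
    (by linarith : (1 : ℝ) ≤ 1 + s)
  refine ⟨B * D * C, by positivity, fun m hm => ?_⟩
  obtain ⟨h1, h2⟩ := h x hx (fun y => ‖m y‖) hm.norm
  rw [eLpNorm_norm] at h2
  simp only [abs_norm] at h1 h2
  have hmeas : AEStronglyMeasurable (fderiv ℝ (pullbackGreen φ x)) (volume.restrict Ω) :=
    (measurable_fderiv ℝ _).aestronglyMeasurable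
  have hbd : ∀ᵐ y ∂(volume.restrict Ω), ‖fderiv ℝ (pullbackGreen φ x) y (m y)‖ ≤
      B * D * (‖m y‖ * ‖y - x‖ ^ (-(1 + s))) := by
    filter_upwards [ae_mem_diff_singleton hΩ.isOpen x] with y hy
    have h3 := hDb x hx y hy.1 hy.2
    rw [Real.rpow_neg_one] at h3
    calc _ ≤ ‖fderiv ℝ (pullbackGreen φ x) y‖ * ‖m y‖ := ContinuousLinearMap.le_opNorm _ _
      _ ≤ (B * (D * ‖y - x‖ ^ (-(1 + s)))) * ‖m y‖ := by
        gcongr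
        exact (hBb y hy).trans (by gcongr)
      _ = _ := by ring
  refine ⟨(h1.const_mul (B * D)).mono' (aestronglyMeasurable_clm_apply hmeas hm.1) hbd, ?_⟩
  refine (norm_integral_le_of_norm_le (h1.const_mul (B * D)) hbd).trans ?_
  rw [integral_const_mul, mul_assoc (B * D)]
  gcongr

theorem memLp_of_continuousOn_closure {E : Type*} [NormedAddCommGroup E] (hΩ : IsC21Domain Ω)
    {m : ℂ → E} (hm : ContinuousOn m (closure Ω)) (q : ℝ≥0∞) :
    MemLp m q (volume.restrict Ω) := by
  obtain ⟨M, hM⟩ := hΩ.isCompact_closure.exists_bound_of_continuousOn hm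
  have : IsFiniteMeasure (volume.restrict Ω) :=
    ⟨by rw [Measure.restrict_apply_univ]; exact hΩ.isBounded.measure_lt_top⟩
  exact MemLp.of_bound (integrableOn_of_continuousOn_closure hΩ hm).aestronglyMeasurable M
    ((ae_restrict_mem hΩ.isOpen.measurableSet).mono fun y hy => hM y (subset_closure hy))

/-! ### The time derivative of `F₀`. -/

/-- The product rule for time derivatives in `L^q`. -/
theorem HasTimeDerivAt.smul (hΩ : IsC21Domain Ω) {T t : ℝ} (ht : t ∈ Ioo 0 T) {q : ℝ≥0∞}
    (hq : 1 ≤ q) {ρ : ℝ → ℂ → ℝ} {u : ℝ → ℂ → ℂ} {ρt : ℂ → ℝ} {ut : ℂ → ℂ}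
    (hρ : ContinuousOn (Function.uncurry ρ) (Icc 0 T ×ˢ closure Ω))
    (hu : ContinuousOn (Function.uncurry u) (Icc 0 T ×ˢ closure Ω))
    (hρt : HasTimeDerivAt Ω q ρ ρt t) (hut : HasTimeDerivAt Ω q u ut t) :
    HasTimeDerivAt Ω q (fun s y => ρ s y • u s y) (fun y => ρt y • u t y + ρ t y • ut y) t := by
  set μ := volume.restrict Ω with hμ
  have htI : t ∈ Icc 0 T := Ioo_subset_Icc_self ht
  have hρs : ∀ s ∈ Icc 0 T, ContinuousOn (ρ s) (closure Ω) := fun s hs =>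
    hρ.comp (by fun_prop : ContinuousOn (fun y => (s, y)) (closure Ω)) fun y hy => ⟨hs, hy⟩
  have hus : ∀ s ∈ Icc 0 T, ContinuousOn (u s) (closure Ω) := fun s hs =>
    hu.comp (by fun_prop : ContinuousOn (fun y => (s, y)) (closure Ω)) fun y hy => ⟨hs, hy⟩
  have hcomp := (isCompact_Icc (a := (0 : ℝ)) (b := T)).prod hΩ.isCompact_closure
  obtain ⟨M, hM⟩ := hcomp.exists_bound_of_continuousOn hu
  obtain ⟨R, hR⟩ := hcomp.exists_bound_of_continuousOn hρ
  have hmem : ∀ᵐ y ∂μ, y ∈ closure Ω :=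
    (ae_restrict_mem hΩ.isOpen.measurableSet).mono fun y hy => subset_closure hy
  have hev : ∀ᶠ s in 𝓝[≠] t, s ∈ Icc 0 T :=
    nhdsWithin_le_nhds (Icc_mem_nhds ht.1 ht.2)
  have hbdu : ∀ s ∈ Icc 0 T, ∀ᵐ y ∂μ, ‖u s y‖ ≤ M := fun s hs =>
    hmem.mono fun y hy => hM (s, y) ⟨hs, hy⟩
  have hbdρ : ∀ᵐ y ∂μ, ‖ρ t y‖ ≤ R := hmem.mono fun y hy => hR (t, y) ⟨htI, hy⟩
  have hm : ∀ {E : Type} [NormedAddCommGroup E] {m : ℂ → E}, ContinuousOn m (closure Ω) →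
      AEStronglyMeasurable m μ := fun h => (integrableOn_of_continuousOn_closure hΩ h).1
  have hA : ∀ {f : ℂ → ℝ}, MemLp f q μ → MemLp (fun y => f y • u t y) q μ := fun {f} hf => by
    refine (hf.const_mul M).mono (hf.1.smul (hm (hus t htI))) ((hbdu t htI).mono fun y hy => ?_)
    rw [norm_smul, norm_mul, mul_comm]
    gcongr
    exact hy.trans (le_abs_self _)
  have hA2 : MemLp (fun y => ρ t y • ut y) q μ := by
    refine (hut.1.norm.const_mul R).mono ((hm (hρs t htI)).smul hut.1.1)
      (hbdρ.mono fun y hy => ?_)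
    rw [norm_smul, norm_mul, norm_norm]
    gcongr
    exact hy.trans (le_abs_self _)
  refine ⟨(hA hρt.1).add hA2, ?_⟩
  -- `ρt` is only in `L^q`, but `u s → u t` uniformly, by uniform continuity on the compact
  -- cylinder.
  have hunif : Tendsto (fun s => eLpNorm (fun y => ρt y • (u s y - u t y)) q μ) (𝓝[≠] t)
      (𝓝 0) := by
    have hUC := Metric.uniformContinuousOn_iff.1 (hcomp.uniformContinuousOn_of_continuous hu)
    have hsm : ∀ ε : ℝ, 0 < ε → ∀ᶠ s in 𝓝[≠] t,
        eLpNorm (fun y => ρt y • (u s y - u t y)) q μ ≤ ENNReal.ofReal ε * eLpNorm ρt q μ := by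
      intro ε hε
      obtain ⟨δ, hδ, h⟩ := hUC ε hε
      filter_upwards [hev, nhdsWithin_le_nhds (Metric.ball_mem_nhds t hδ)] with s hs hsδ
      refine eLpNorm_le_mul_eLpNorm_of_ae_le_mul (hmem.mono fun y hy => ?_) q
      rw [norm_smul, mul_comm]
      gcongr
      have := h (s, y) ⟨hs, hy⟩ (t, y) ⟨htI, hy⟩ (by
        rw [Prod.dist_eq, dist_self]; exact max_lt hsδ hδ)
      rw [dist_eq_norm] at this
      exact this.le
    rw [ENNReal.tendsto_nhds_zero]
    intro η hη
    have hlim : Tendsto (fun ε : ℝ => ENNReal.ofReal ε * eLpNorm ρt q μ) (𝓝[>] 0) (𝓝 0) := by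
      have h1 : Tendsto (fun ε : ℝ => ENNReal.ofReal ε) (𝓝[>] 0) (𝓝 0) := by
        have := (ENNReal.continuous_ofReal.tendsto 0).mono_left
          (nhdsWithin_le_nhds (s := Ioi (0 : ℝ)))
        simpa using this
      simpa using ENNReal.Tendsto.mul_const h1 (Or.inr hρt.1.2.ne)
    obtain ⟨ε, h1, h2⟩ := (((ENNReal.tendsto_nhds_zero.1 hlim) η hη).and
      self_mem_nhdsWithin).exists
    exact (hsm ε h2).mono fun s hs => hs.trans h1
  have hsum : Tendsto (fun s => ENNReal.ofReal M *
      eLpNorm (fun y => (s - t)⁻¹ • (ρ s y - ρ t y) - ρt y) q μ +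
      eLpNorm (fun y => ρt y • (u s y - u t y)) q μ +
      ENNReal.ofReal R * eLpNorm (fun y => (s - t)⁻¹ • (u s y - u t y) - ut y) q μ)
      (𝓝[≠] t) (𝓝 0) := by
    have h1 := ENNReal.Tendsto.const_mul hρt.2 (Or.inr (ENNReal.ofReal_ne_top (r := M)))
    have h2 := ENNReal.Tendsto.const_mul hut.2 (Or.inr (ENNReal.ofReal_ne_top (r := R)))
    simpa using (h1.add hunif).add h2
  refine tendsto_of_tendsto_of_tendsto_of_le_of_le' tendsto_const_nhds hsum
    (Eventually.of_forall fun _ => zero_le) ?_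
  filter_upwards [hev] with s hs
  have mδρ : AEStronglyMeasurable (fun y => (s - t)⁻¹ • (ρ s y - ρ t y) - ρt y) μ :=
    (((hm (hρs s hs)).sub (hm (hρs t htI))).const_smul ((s - t)⁻¹)).sub hρt.1.1
  have mδu : AEStronglyMeasurable (fun y => (s - t)⁻¹ • (u s y - u t y) - ut y) μ :=
    (((hm (hus s hs)).sub (hm (hus t htI))).const_smul ((s - t)⁻¹)).sub hut.1.1
  have m1 : AEStronglyMeasurable
      (fun y => ((s - t)⁻¹ • (ρ s y - ρ t y) - ρt y) • u s y) μ := mδρ.smul (hm (hus s hs))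
  have m2 : AEStronglyMeasurable (fun y => ρt y • (u s y - u t y)) μ :=
    hρt.1.1.smul ((hm (hus s hs)).sub (hm (hus t htI)))
  have m3 : AEStronglyMeasurable
      (fun y => ρ t y • ((s - t)⁻¹ • (u s y - u t y) - ut y)) μ := (hm (hρs t htI)).smul mδu
  -- The quotient of `ρ` multiplies `u s`, not `u t`; the resulting discrepancy is the middle term.
  have e : (fun y => (s - t)⁻¹ • (ρ s y • u s y - ρ t y • u t y) -
      (ρt y • u t y + ρ t y • ut y)) =
      ((fun y => ((s - t)⁻¹ • (ρ s y - ρ t y) - ρt y) • u s y) +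
        fun y => ρt y • (u s y - u t y)) +
        fun y => ρ t y • ((s - t)⁻¹ • (u s y - u t y) - ut y) := by
    ext y
    simp only [Pi.add_apply, smul_eq_mul, Complex.real_smul]
    push_cast
    ring
  rw [e]
  refine (eLpNorm_add_le (m1.add m2) m3 hq).trans (add_le_add
    ((eLpNorm_add_le m1 m2 hq).trans (add_le_add ?_ le_rfl)) ?_)
  · refine eLpNorm_le_mul_eLpNorm_of_ae_le_mul ((hbdu s hs).mono fun y hy => ?_) q
    rw [norm_smul, mul_comm]
    gcongr
  · refine eLpNorm_le_mul_eLpNorm_of_ae_le_mul (hbdρ.mono fun y hy => ?_) q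
    rw [norm_smul]
    gcongr

/-- The time derivative of `F₀`. -/
theorem IsConformalOntoDisc.hasDerivAt_F0 (hΩ : IsC21Domain Ω) (hφ : IsConformalOntoDisc Ω φ)
    {x : ℂ} (hx : x ∈ Ω) {T t : ℝ} (ht : t ∈ Ioo 0 T) {q : ℝ≥0∞} (hq : 2 < q)
    {ρ : ℝ → ℂ → ℝ} {u : ℝ → ℂ → ℂ} {ρt : ℂ → ℝ} {ut : ℂ → ℂ}
    (hρ : ContinuousOn (Function.uncurry ρ) (Icc 0 T ×ˢ closure Ω))
    (hu : ContinuousOn (Function.uncurry u) (Icc 0 T ×ˢ closure Ω))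
    (hρt : HasTimeDerivAt Ω q ρ ρt t) (hut : HasTimeDerivAt Ω q u ut t) :
    HasDerivAt (fun s => F0 Ω φ (ρ s) (u s) x)
      (∫ y in Ω, fderiv ℝ (pullbackGreen φ x) y (ρt y • u t y + ρ t y • ut y)) t := by
  have hV := HasTimeDerivAt.smul hΩ ht (by exact (by norm_num : (1 : ℝ≥0∞) ≤ 2).trans hq.le)
    hρ hu hρt hut
  have hVc : ∀ s ∈ Icc 0 T, MemLp (fun y => ρ s y • u s y) q (volume.restrict Ω) := fun s hs =>
    memLp_of_continuousOn_closure hΩ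
      ((hρ.comp (by fun_prop : ContinuousOn (fun y => (s, y)) (closure Ω))
        fun y hy => ⟨hs, hy⟩).smul
      (hu.comp (by fun_prop : ContinuousOn (fun y => (s, y)) (closure Ω))
        fun y hy => ⟨hs, hy⟩)) q
  -- `F₀` is a bounded linear functional of `ρu` in `L^q`, so convergence of the difference
  -- quotients in `L^q` is enough.
  obtain ⟨C, hC, h⟩ := hφ.exists_integral_fderiv_pullbackGreen_le hΩ hx hq
  have htI : t ∈ Icc 0 T := Ioo_subset_Icc_self ht
  rw [hasDerivAt_iff_tendsto_slope, tendsto_iff_norm_sub_tendsto_zero]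
  have hlim : Tendsto (fun s => C * (eLpNorm (fun y => (s - t)⁻¹ •
      (ρ s y • u s y - ρ t y • u t y) - (ρt y • u t y + ρ t y • ut y)) q
      (volume.restrict Ω)).toReal) (𝓝[≠] t) (𝓝 0) := by
    simpa using ((ENNReal.tendsto_toReal ENNReal.zero_ne_top).comp hV.2).const_mul C
  refine squeeze_zero' (Eventually.of_forall fun _ => norm_nonneg _) ?_ hlim
  filter_upwards [nhdsWithin_le_nhds (Icc_mem_nhds ht.1 ht.2)] with s hs
  have hW := hV.1
  have hd : MemLp (fun y => (s - t)⁻¹ • (ρ s y • u s y - ρ t y • u t y)) q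
    (volume.restrict Ω) := ((hVc s hs).sub (hVc t htI)).const_smul ((s - t)⁻¹)
  refine le_trans (le_of_eq ?_) (h _ (hd.sub hW)).2
  rw [Real.norm_eq_abs]
  congr 1
  simp only [map_sub, map_smul, Pi.sub_apply]
  have i1 := (h _ (hVc s hs)).1
  have i2 := (h _ (hVc t htI)).1
  have i3 := (h _ hW).1
  simp only [map_smul] at i1 i2
  have i12 : IntegrableOn (fun y => (s - t)⁻¹ • (ρ s y • fderiv ℝ (pullbackGreen φ x) y (u s y) -
    ρ t y • fderiv ℝ (pullbackGreen φ x) y (u t y))) Ω := (i1.sub i2).smul ((s - t)⁻¹)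
  rw [integral_sub i12 i3, integral_smul, integral_sub i1 i2, slope_def_module]
  simp only [F0, kernel0, map_smul]

end conformal

/-! ### Differentiation of logarithmic potentials with respect to the pole. -/

/-- A first order Taylor formula for `log|1 - w|`. The remainder has order `1 + s` instead of `2`,
because singularities of that order are still integrable against `L^q` densities. For `‖w‖ ≤ 1/2` it
is the usual quadratic remainder; for larger `w` each term is bounded separately and the weight
absorbs the singularity at `w = 1`. -/
theorem abs_log_norm_one_sub_add_re_le {s : ℝ} (hs0 : 0 < s) (hs1 : s < 1) {w : ℂ} (hw : w ≠ 1) :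
    |Real.log ‖1 - w‖ + w.re| ≤ 6 * ‖w‖ ^ (1 + s) * (1 + ‖1 - w‖ ^ (-(1 + s))) := by
  have hr0 : 0 < ‖1 - w‖ := norm_pos_iff.2 (sub_ne_zero.2 hw.symm)
  have hrs : 0 < ‖1 - w‖ ^ (-(1 + s)) := Real.rpow_pos_of_pos hr0 _
  have hws : 0 ≤ ‖w‖ ^ (1 + s) := by positivity
  rcases le_or_gt ‖w‖ (1 / 2) with h | h
  · have h1 := Complex.norm_log_one_add_sub_self_le (z := -w) (by rw [norm_neg]; linarith)
    rw [norm_neg, ← sub_eq_add_neg, sub_neg_eq_add] at h1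
    have h2 := (Complex.abs_re_le_norm _).trans h1
    rw [Complex.add_re, Complex.log_re] at h2
    have h3 : (1 - ‖w‖)⁻¹ ≤ 2 := by
      rw [inv_le_comm₀ (by linarith) (by norm_num)]; linarith
    have h4 : ‖w‖ ^ 2 ≤ ‖w‖ ^ (1 + s) := by
      rw [← Real.rpow_natCast]
      exact Real.rpow_le_rpow_of_exponent_ge' (norm_nonneg _) (by linarith) (by linarith)
        (by push_cast; linarith)
    nlinarith [mul_le_mul_of_nonneg_left h3 (sq_nonneg ‖w‖), mul_nonneg hws hrs.le]
  · have hw0 : 0 < ‖w‖ := by linarith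
    have h1 : ‖w‖ ≤ 2 * ‖w‖ ^ (1 + s) := by
      have e : ‖w‖ ^ (1 + s) = ‖w‖ * ‖w‖ ^ s := by rw [Real.rpow_add hw0, Real.rpow_one]
      have h2 : (1 / 2 : ℝ) ≤ ‖w‖ ^ s := by
        calc (1 / 2 : ℝ) = (1 / 2) ^ (1 : ℝ) := by rw [Real.rpow_one]
          _ ≤ (1 / 2) ^ s := Real.rpow_le_rpow_of_exponent_ge (by norm_num) (by norm_num) hs1.le
          _ ≤ ‖w‖ ^ s := Real.rpow_le_rpow (by norm_num) h.le hs0.le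
      rw [e]
      nlinarith
    have hre : |w.re| ≤ ‖w‖ := Complex.abs_re_le_norm w
    have hlog : |Real.log ‖1 - w‖| ≤ ‖w‖ + 4 * ‖w‖ ^ (1 + s) * ‖1 - w‖ ^ (-(1 + s)) := by
      rcases le_or_gt 1 ‖1 - w‖ with h2 | h2
      · rw [abs_of_nonneg (Real.log_nonneg h2)]
        have e1 := Real.log_le_sub_one_of_pos hr0
        have e2 : ‖1 - w‖ ≤ 1 + ‖w‖ := (norm_sub_le _ _).trans (by rw [norm_one])
        nlinarith [mul_nonneg hws hrs.le]
      · rw [abs_of_nonpos (Real.log_nonpos hr0.le h2.le), ← Real.log_inv]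
        have e1 := Real.log_le_sub_one_of_pos (inv_pos.2 hr0)
        have e2 : ‖1 - w‖⁻¹ ≤ ‖1 - w‖ ^ (-(1 + s)) := by
          rw [← Real.rpow_neg_one]
          exact Real.rpow_le_rpow_of_exponent_ge hr0 h2.le (by linarith)
        have e3 : 1 / 4 ≤ ‖w‖ ^ (1 + s) := by linarith
        nlinarith
    have := abs_add_le (Real.log ‖1 - w‖) w.re
    nlinarith [mul_nonneg hws hrs.le]

theorem abs_log_norm_sub_sub_log_norm_add_le {s : ℝ} (hs0 : 0 < s) (hs1 : s < 1) {ζ h : ℂ}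
    (hζ : ζ ≠ 0) (hζh : ζ - h ≠ 0) :
    |Real.log ‖ζ - h‖ - Real.log ‖ζ‖ + (h * ζ⁻¹).re| ≤
      6 * ‖h‖ ^ (1 + s) * (‖ζ‖ ^ (-(1 + s)) + ‖ζ - h‖ ^ (-(1 + s))) := by
  have hw : h * ζ⁻¹ ≠ 1 := fun e => hζh (by
    rw [← div_eq_mul_inv, div_eq_one_iff_eq hζ] at e; rw [e, sub_self])
  have e1 : ‖1 - h * ζ⁻¹‖ = ‖ζ - h‖ * ‖ζ‖⁻¹ := by
    rw [← norm_inv, ← norm_mul]; congr 1; field_simp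
  have hz : 0 < ‖ζ‖ := norm_pos_iff.2 hζ
  have hzh : 0 < ‖ζ - h‖ := norm_pos_iff.2 hζh
  have key := abs_log_norm_one_sub_add_re_le hs0 hs1 hw
  rw [e1, Real.log_mul hzh.ne' (inv_ne_zero hz.ne'), Real.log_inv, ← sub_eq_add_neg] at key
  refine key.trans (le_of_eq ?_)
  rw [norm_mul, norm_inv, Real.mul_rpow (norm_nonneg _) (by positivity),
    Real.mul_rpow (norm_nonneg _) (by positivity), Real.inv_rpow hz.le, Real.inv_rpow hz.le,
    Real.rpow_neg hz.le]
  have : ‖ζ‖ ^ (1 + s) ≠ 0 := (Real.rpow_pos_of_pos hz _).ne'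
  field_simp

section conformal

variable {Ω : Set ℂ} {φ : ℂ → ℂ}

/-- `-conj` of the gradient, up to the factor `2π`, of the Green function of the disc with respect
to its pole `a`. -/
def discPoleKernel (a z : ℂ) : ℂ := (z - a)⁻¹ + starRingEnd ℂ (z * (1 - starRingEnd ℂ a * z)⁻¹)

/-- The Taylor estimate is applied to both logarithms, with increments `h = φ x' - φ x` and `conj(h)
φ y`. Closeness of `x'` to `x` keeps the reflected argument above `(1 - |φ x|)/2` in modulus, so the
remainder is singular only at `x` and `x'`. -/
theorem IsConformalOntoDisc.exists_abs_pullbackGreen_sub_le (hΩ : IsC21Domain Ω)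
    (hφ : IsConformalOntoDisc Ω φ) {x : ℂ} (hx : x ∈ Ω) {s : ℝ} (hs0 : 0 < s) (hs1 : s < 1) :
    ∃ C : ℝ, 0 ≤ C ∧ ∀ x' ∈ Ω, ‖φ x' - φ x‖ ≤ (1 - ‖φ x‖) / 2 → ∀ y ∈ Ω, y ≠ x → y ≠ x' →
      |pullbackGreen φ x' y - pullbackGreen φ x y +
          (2 * Real.pi)⁻¹ * ((φ x' - φ x) * discPoleKernel (φ x) (φ y)).re| ≤
        C * ‖φ x' - φ x‖ ^ (1 + s) * (‖y - x‖ ^ (-(1 + s)) + ‖y - x'‖ ^ (-(1 + s))) := by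
  obtain ⟨A, hA, hlow⟩ := hφ.exists_norm_sub_le hΩ
  obtain ⟨D, hD, hDb⟩ := exists_rpow_norm_sub_le hΩ.isBounded (by linarith : (0 : ℝ) ≤ 1 + s)
  have hx1 := hφ.norm_lt_one hx
  have hδ : 0 < (1 - ‖φ x‖) / 2 := by linarith
  set δ := (1 - ‖φ x‖) / 2 with hδd
  refine ⟨(2 * Real.pi)⁻¹ * (6 * A ^ (1 + s) + 12 * δ ^ (-(1 + s)) * D), by positivity,
    fun x' hx' hxx' y hy hyx hyx' => ?_⟩
  have hy1 := hφ.norm_lt_one hy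
  have hpow : ∀ z ∈ Ω, y ≠ z → ‖φ y - φ z‖ ^ (-(1 + s)) ≤ A ^ (1 + s) * ‖y - z‖ ^ (-(1 + s)) := by
    intro z hz hyz
    have h0 : 0 < ‖y - z‖ := norm_pos_iff.2 (_root_.sub_ne_zero.2 hyz)
    have e1 : A⁻¹ * ‖y - z‖ ≤ ‖φ y - φ z‖ := by
      rw [inv_mul_le_iff₀ hA]; exact hlow y hy z hz
    refine (Real.rpow_le_rpow_of_nonpos (by positivity) e1 (by linarith)).trans (le_of_eq ?_)
    rw [Real.mul_rpow (by positivity) h0.le, Real.inv_rpow hA.le, Real.rpow_neg hA.le, inv_inv]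
  set h := φ x' - φ x with hh
  have e1 : φ y - φ x - h = φ y - φ x' := by rw [hh]; ring
  have e2 : (1 - starRingEnd ℂ (φ x) * φ y) - starRingEnd ℂ h * φ y =
      1 - starRingEnd ℂ (φ x') * φ y := by rw [hh, map_sub]; ring
  have k1 := abs_log_norm_sub_sub_log_norm_add_le hs0 hs1 (h := h)
    (hφ.sub_ne_zero hx (subset_closure hy) hyx)
    (by rw [e1]; exact hφ.sub_ne_zero hx' (subset_closure hy) hyx')
  have k2 := abs_log_norm_sub_sub_log_norm_add_le hs0 hs1 (h := starRingEnd ℂ h * φ y)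
    (hφ.one_sub_ne_zero hx (subset_closure hy))
    (by rw [e2]; exact hφ.one_sub_ne_zero hx' (subset_closure hy))
  rw [e1] at k1
  rw [e2] at k2
  have hx'1 : δ ≤ 1 - ‖φ x'‖ := by
    have : ‖φ x'‖ ≤ ‖φ x‖ + ‖h‖ := by
      have := norm_add_le (φ x) h
      rwa [hh, add_sub_cancel] at this
    linarith
  have d1 : ‖1 - starRingEnd ℂ (φ x) * φ y‖ ^ (-(1 + s)) ≤ δ ^ (-(1 + s)) :=
    Real.rpow_le_rpow_of_nonpos hδ ((by linarith : δ ≤ 1 - ‖φ x‖).trans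
      (one_sub_norm_le_norm_one_sub_conj_mul hy1.le)) (by linarith)
  have d2 : ‖1 - starRingEnd ℂ (φ x') * φ y‖ ^ (-(1 + s)) ≤ δ ^ (-(1 + s)) :=
    Real.rpow_le_rpow_of_nonpos hδ (hx'1.trans
      (one_sub_norm_le_norm_one_sub_conj_mul hy1.le)) (by linarith)
  have d3 : ‖starRingEnd ℂ h * φ y‖ ^ (1 + s) ≤ ‖h‖ ^ (1 + s) := by
    refine Real.rpow_le_rpow (norm_nonneg _) ?_ (by linarith)
    rw [norm_mul, RCLike.norm_conj]
    exact mul_le_of_le_one_right (norm_nonneg _) hy1.le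
  have d4 : 1 ≤ D * ‖y - x‖ ^ (-(1 + s)) := by
    have := hDb x hx y hy hyx
    simpa using this
  have hre : (h * discPoleKernel (φ x) (φ y)).re = (h * (φ y - φ x)⁻¹).re +
      (starRingEnd ℂ h * φ y * (1 - starRingEnd ℂ (φ x) * φ y)⁻¹).re := by
    rw [discPoleKernel, mul_add, Complex.add_re, ← Complex.conj_re (starRingEnd ℂ h * φ y * _),
      mul_assoc (starRingEnd ℂ h)]
    simp only [map_mul, Complex.conj_conj]
  have hsplit : pullbackGreen φ x' y - pullbackGreen φ x y +
      (2 * Real.pi)⁻¹ * (h * discPoleKernel (φ x) (φ y)).re =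
      (2 * Real.pi)⁻¹ * ((Real.log ‖φ y - φ x'‖ - Real.log ‖φ y - φ x‖ +
        (h * (φ y - φ x)⁻¹).re) + (Real.log ‖1 - starRingEnd ℂ (φ x') * φ y‖ -
        Real.log ‖1 - starRingEnd ℂ (φ x) * φ y‖ +
        (starRingEnd ℂ h * φ y * (1 - starRingEnd ℂ (φ x) * φ y)⁻¹).re)) := by
    rw [pullbackGreen_eq, pullbackGreen_eq, hre]; ring
  rw [hsplit, abs_mul, abs_of_nonneg (by positivity : (0 : ℝ) ≤ (2 * Real.pi)⁻¹),
    mul_assoc (2 * Real.pi)⁻¹, mul_assoc (2 * Real.pi)⁻¹]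
  refine mul_le_mul_of_nonneg_left ?_ (by positivity)
  refine (abs_add_le _ _).trans ((add_le_add k1 k2).trans ?_)
  have p1 := hpow x hx hyx
  have p2 := hpow x' hx' hyx'
  have hn0 : 0 ≤ ‖h‖ ^ (1 + s) := by positivity
  have hδ0 : 0 ≤ δ ^ (-(1 + s)) := by positivity
  have hy0 : 0 ≤ ‖y - x'‖ ^ (-(1 + s)) := by positivity
  calc _ ≤ 6 * ‖h‖ ^ (1 + s) * (A ^ (1 + s) * ‖y - x‖ ^ (-(1 + s)) +
          A ^ (1 + s) * ‖y - x'‖ ^ (-(1 + s))) +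
        6 * ‖h‖ ^ (1 + s) * ((δ ^ (-(1 + s)) + δ ^ (-(1 + s))) * (D * ‖y - x‖ ^ (-(1 + s)))) := by
        gcongr
        refine (add_le_add d1 d2).trans ?_
        exact le_mul_of_one_le_right (by positivity) d4
    _ ≤ _ := by
      nlinarith [mul_nonneg (mul_nonneg (mul_nonneg hδ0 hD.le) hy0) hn0]

theorem measurable_discPoleKernel (a : ℂ) : Measurable (discPoleKernel a) := by
  unfold discPoleKernel
  fun_prop

theorem IsConformalOntoDisc.exists_norm_discPoleKernel_le (hΩ : IsC21Domain Ω)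
    (hφ : IsConformalOntoDisc Ω φ) {x : ℂ} (hx : x ∈ Ω) : ∃ B : ℝ, 0 < B ∧
      ∀ y ∈ Ω \ {x}, ‖discPoleKernel (φ x) (φ y)‖ ≤ B * ‖y - x‖⁻¹ := by
  obtain ⟨A, hA, hlow⟩ := hφ.exists_norm_sub_le hΩ
  obtain ⟨D, hD, hDb⟩ := exists_rpow_norm_sub_le hΩ.isBounded (by norm_num : (0 : ℝ) ≤ 1)
  have h1x : 0 < 1 - ‖φ x‖ := by linarith [hφ.norm_lt_one hx]
  refine ⟨A + (1 - ‖φ x‖)⁻¹ * D, by positivity, fun y hy => ?_⟩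
  have h0 : 0 < ‖y - x‖ := norm_pos_iff.2 (_root_.sub_ne_zero.2 hy.2)
  have hy1 := hφ.norm_lt_one hy.1
  have d4 : 1 ≤ D * ‖y - x‖⁻¹ := by
    simpa [Real.rpow_neg_one] using hDb x hx y hy.1 hy.2
  have e1 : A⁻¹ * ‖y - x‖ ≤ ‖φ y - φ x‖ := by
    rw [inv_mul_le_iff₀ hA]; exact hlow y hy.1 x hx
  rw [add_mul]
  refine (norm_add_le _ _).trans (add_le_add ?_ ?_)
  · rw [norm_inv]
    refine (inv_anti₀ (by positivity) e1).trans (le_of_eq ?_)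
    rw [mul_inv, inv_inv]
  · rw [RCLike.norm_conj, norm_mul, norm_inv, mul_assoc]
    calc _ ≤ 1 * (1 - ‖φ x‖)⁻¹ := by
          gcongr
          exact one_sub_norm_le_norm_one_sub_conj_mul hy1.le
      _ = (1 - ‖φ x‖)⁻¹ * 1 := by ring
      _ ≤ _ := by gcongr

theorem IsConformalOntoDisc.integrableOn_mul_pullbackGreen (hΩ : IsC21Domain Ω)
    (hφ : IsConformalOntoDisc Ω φ) {x : ℂ} (hx : x ∈ Ω) {q : ℝ≥0∞} (hq : 2 < q) {g : ℂ → ℝ}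
    (hg : MemLp g q (volume.restrict Ω)) : IntegrableOn (fun y => g y * pullbackGreen φ x y) Ω := by
  obtain ⟨s, hs0, hs1, C, hC, h⟩ := exists_integral_mul_rpow_le hΩ.isBounded hq
  obtain ⟨B, hB, hBb⟩ := hφ.exists_abs_pullbackGreen_le hΩ hx
  obtain ⟨D, hD, hDb⟩ := exists_rpow_norm_sub_le hΩ.isBounded (by linarith : (1 / 2 : ℝ) ≤ 1 + s)
  have hN : AEStronglyMeasurable (pullbackGreen φ x) (volume.restrict Ω) := by
    have := ((hφ.contDiffOn_pullbackGreen hx).continuousOn).aestronglyMeasurable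
      (μ := volume) (hΩ.isOpen.measurableSet.diff (measurableSet_singleton x))
    rwa [Measure.restrict_congr_set (sdiff_null_ae_eq_self (measure_singleton x))] at this
  refine ((h x hx g hg).1.const_mul (B * D)).mono' (hg.1.mul hN) ?_
  filter_upwards [ae_mem_diff_singleton hΩ.isOpen x] with y hy
  rw [norm_mul]
  calc _ ≤ |g y| * (B * (D * ‖y - x‖ ^ (-(1 + s)))) := by
        gcongr
        · exact le_rfl
        · exact (hBb y hy).trans (by gcongr; exact hDb x hx y hy.1 hy.2)
    _ = _ := by ring

/-- Differentiation with respect to the pole of a logarithmic potential with `L^q` density. -/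
theorem IsConformalOntoDisc.hasFDerivAt_integral_pullbackGreen (hΩ : IsC21Domain Ω)
    (hφ : IsConformalOntoDisc Ω φ) {x : ℂ} (hx : x ∈ Ω) {q : ℝ≥0∞} (hq : 2 < q) {g : ℂ → ℝ}
    (hg : MemLp g q (volume.restrict Ω)) :
    IntegrableOn (fun y => (g y : ℂ) * discPoleKernel (φ x) (φ y)) Ω ∧
    HasFDerivAt (fun x' => ∫ y in Ω, g y * pullbackGreen φ x' y)
      (reMul (-(2 * Real.pi : ℂ)⁻¹ * (∫ y in Ω, (g y : ℂ) * discPoleKernel (φ x) (φ y)) *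
        cderiv Ω φ x)) x := by
  obtain ⟨s, hs0, hs1, C, hC, h⟩ := exists_integral_mul_rpow_le hΩ.isBounded hq
  have hint : IntegrableOn (fun y => (g y : ℂ) * discPoleKernel (φ x) (φ y)) Ω := by
    obtain ⟨B, hB, hBb⟩ := hφ.exists_norm_discPoleKernel_le hΩ hx
    obtain ⟨D, hD, hDb⟩ := exists_rpow_norm_sub_le hΩ.isBounded (by linarith : (1 : ℝ) ≤ 1 + s)
    have hφm : AEMeasurable φ (volume.restrict Ω) :=
      (hφ.contDiffOn.continuousOn.mono subset_closure).aemeasurable hΩ.isOpen.measurableSet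
    refine ((h x hx g hg).1.const_mul (B * D)).mono'
      ((Complex.continuous_ofReal.comp_aestronglyMeasurable hg.1).mul
        ((measurable_discPoleKernel _).comp_aemeasurable hφm).aestronglyMeasurable) ?_
    filter_upwards [ae_mem_diff_singleton hΩ.isOpen x] with y hy
    rw [norm_mul, Complex.norm_real]
    have h3 := hDb x hx y hy.1 hy.2
    rw [Real.rpow_neg_one] at h3
    calc _ ≤ |g y| * (B * (D * ‖y - x‖ ^ (-(1 + s)))) := by
          gcongr
          · exact le_rfl
          · exact (hBb y hy).trans (by gcongr)
      _ = _ := by ring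
  refine ⟨hint, ?_⟩
  set I := ∫ y in Ω, (g y : ℂ) * discPoleKernel (φ x) (φ y) with hI
  -- The `x`-derivative of the kernel is singular at a point that moves with the pole, so
  -- differentiation under the integral by domination is replaced by an increment estimate. Its
  -- weights, centred at `x` and `x'`, have integrals against `|g|` bounded uniformly in the pole,
  -- and the factor `‖φ x' - φ x‖ ^ (1 + s)` is `o(‖x' - x‖)`.
  obtain ⟨K, hK, hKb⟩ := hφ.exists_abs_pullbackGreen_sub_le hΩ hx hs0 hs1
  have hφd := (hφ.hasDerivAt hΩ hx).complexToReal_fderiv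
  have hx1 := hφ.norm_lt_one hx
  set E := 2 * K * C * (eLpNorm g q (volume.restrict Ω)).toReal with hE
  have hrem : ∀ᶠ x' in 𝓝 x, ‖(∫ y in Ω, g y * pullbackGreen φ x' y) -
      (∫ y in Ω, g y * pullbackGreen φ x y) - reMul (-(2 * Real.pi : ℂ)⁻¹ * I) (φ x' - φ x)‖ ≤
      E * ‖‖φ x' - φ x‖ ^ (1 + s)‖ := by
    have hnear : ∀ᶠ x' in 𝓝 x, ‖φ x' - φ x‖ ≤ (1 - ‖φ x‖) / 2 := by
      have := hφd.continuousAt.eventually (Metric.closedBall_mem_nhds (φ x)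
        (by linarith : 0 < (1 - ‖φ x‖) / 2))
      simpa [dist_eq_norm] using this
    filter_upwards [hnear, hΩ.isOpen.mem_nhds hx] with x' hx'n hx'
    set b := φ x' - φ x with hb
    have i1 := hφ.integrableOn_mul_pullbackGreen hΩ hx' hq hg
    have i2 := hφ.integrableOn_mul_pullbackGreen hΩ hx hq hg
    have i3 : IntegrableOn (fun y => g y * ((2 * Real.pi)⁻¹ *
        (b * discPoleKernel (φ x) (φ y)).re)) Ω := by
      have := ((hint.const_mul b).re).const_mul (2 * Real.pi)⁻¹
      refine this.congr (ae_of_all _ fun y => ?_)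
      simp only [RCLike.re_to_complex]
      rw [mul_left_comm b, Complex.re_ofReal_mul]
      ring
    have hre : reMul (-(2 * Real.pi : ℂ)⁻¹ * I) b =
        -∫ y in Ω, g y * ((2 * Real.pi)⁻¹ * (b * discPoleKernel (φ x) (φ y)).re) := by
      have e1 : ∫ y in Ω, g y * ((2 * Real.pi)⁻¹ * (b * discPoleKernel (φ x) (φ y)).re) =
          ∫ y in Ω, (2 * Real.pi)⁻¹ *
            (RCLike.re (b * ((g y : ℂ) * discPoleKernel (φ x) (φ y))) : ℝ) := by
        congr 1 with y
        simp only [RCLike.re_to_complex]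
        rw [mul_left_comm b, Complex.re_ofReal_mul]
        ring
      rw [e1, integral_const_mul, integral_re (hint.const_mul b), integral_const_mul, ← hI,
        reMul_apply, RCLike.re_to_complex, ← Complex.re_ofReal_mul, ← Complex.neg_re]
      congr 1
      push_cast
      ring
    have i12 : IntegrableOn (fun y => g y * pullbackGreen φ x' y - g y * pullbackGreen φ x y) Ω :=
      i1.sub i2
    rw [hre, sub_neg_eq_add, ← integral_sub i1 i2, ← integral_add i12 i3]
    obtain ⟨j1, k1⟩ := h x hx g hg
    obtain ⟨j2, k2⟩ := h x' hx' g hg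
    have hbd : ∀ᵐ y ∂(volume.restrict Ω), ‖g y * pullbackGreen φ x' y - g y * pullbackGreen φ x y +
        g y * ((2 * Real.pi)⁻¹ * (b * discPoleKernel (φ x) (φ y)).re)‖ ≤
        K * ‖b‖ ^ (1 + s) * (|g y| * ‖y - x‖ ^ (-(1 + s)) + |g y| * ‖y - x'‖ ^ (-(1 + s))) := by
      filter_upwards [ae_mem_diff_singleton hΩ.isOpen x, ae_mem_diff_singleton hΩ.isOpen x'] with
        y hy hy'
      rw [← mul_sub, ← mul_add, norm_mul, ← mul_add]
      calc _ ≤ |g y| * (K * ‖b‖ ^ (1 + s) *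
            (‖y - x‖ ^ (-(1 + s)) + ‖y - x'‖ ^ (-(1 + s)))) := by
            gcongr
            · exact le_rfl
            · exact hKb x' hx' hx'n y hy.1 hy.2 hy'.2
        _ = _ := by ring
    refine (norm_integral_le_of_norm_le ((j1.add j2).const_mul _) hbd).trans ?_
    rw [integral_const_mul]
    simp only [Pi.add_apply]
    rw [integral_add j1 j2, Real.norm_of_nonneg (by positivity : 0 ≤ ‖b‖ ^ (1 + s))]
    calc _ ≤ K * ‖b‖ ^ (1 + s) * (C * (eLpNorm g q (volume.restrict Ω)).toReal +
          C * (eLpNorm g q (volume.restrict Ω)).toReal) := by gcongr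
      _ = _ := by rw [hE]; ring
  have hO : (fun x' => φ x' - φ x) =O[𝓝 x] fun x' => x' - x := hφd.isBigO_sub
  have ho : (fun x' => ‖φ x' - φ x‖ ^ (1 + s)) =o[𝓝 x] fun x' => x' - x := by
    refine Asymptotics.IsLittleO.trans_isBigO ?_ hO
    have h0 : Tendsto (fun x' => ‖φ x' - φ x‖) (𝓝 x) (𝓝 0) := by
      have : Tendsto (fun x' => φ x' - φ x) (𝓝 x) (𝓝 (φ x - φ x)) :=
        hφd.continuousAt.tendsto.sub_const _
      rw [sub_self] at this
      simpa using this.norm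
    have h1 : Tendsto (fun x' => ‖φ x' - φ x‖ ^ s) (𝓝 x) (𝓝 0) := by
      have := h0.rpow_const (p := s) (Or.inr hs0.le)
      rwa [Real.zero_rpow hs0.ne'] at this
    have h2 : (fun x' => ‖φ x' - φ x‖ ^ s * ‖φ x' - φ x‖) =o[𝓝 x]
        fun x' => (1 : ℝ) * ‖φ x' - φ x‖ :=
      ((Asymptotics.isLittleO_one_iff ℝ).2 h1).mul_isBigO (Asymptotics.isBigO_refl _ _)
    refine (h2.congr (fun x' => ?_) (fun x' => one_mul _)).of_norm_right
    rw [add_comm, Real.rpow_add_one' (norm_nonneg _) (by linarith)]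
  rw [hasFDerivAt_iff_isLittleO]
  have hlin : (fun x' => reMul (-(2 * Real.pi : ℂ)⁻¹ * I)
      (φ x' - φ x - cderiv Ω φ x * (x' - x))) =o[𝓝 x] fun x' => x' - x := by
    refine ((reMul (-(2 * Real.pi : ℂ)⁻¹ * I)).isBigO_comp _ _).trans_isLittleO ?_
    have := hφd.isLittleO
    refine this.congr_left fun x' => ?_
    simp
  refine (((Asymptotics.IsBigO.of_bound E hrem).trans_isLittleO ho).add hlin).congr_left
    fun x' => ?_
  have e : reMul (-(2 * Real.pi : ℂ)⁻¹ * I * cderiv Ω φ x) (x' - x) =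
      reMul (-(2 * Real.pi : ℂ)⁻¹ * I) (cderiv Ω φ x * (x' - x)) := by
    simp only [reMul_apply, mul_assoc]
  rw [map_sub (reMul (-(2 * Real.pi : ℂ)⁻¹ * I)) (φ x' - φ x) (cderiv Ω φ x * (x' - x)), e]
  ring

end conformal

/-! ### The transported Green's function and its product rule. -/

/-- A function which is `C¹` up to the boundary is Lipschitz at every interior point. -/
theorem exists_norm_sub_le_of_contDiffOn {E : Type*} [NormedAddCommGroup E] [NormedSpace ℝ E]
    {Ω : Set ℂ} (hΩ : IsC21Domain Ω) {f : ℂ → E} (hf : ContDiffOn ℝ 1 f (closure Ω)) {x : ℂ}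
    (hx : x ∈ Ω) : ∃ M : ℝ, 0 ≤ M ∧ ∀ y ∈ Ω, ‖f y‖ ≤ M ∧ ‖fderiv ℝ f y‖ ≤ M ∧
      ‖f y - f x‖ ≤ M * ‖y - x‖ := by
  obtain ⟨M₁, hM₁⟩ := hΩ.isCompact_closure.exists_bound_of_continuousOn hf.continuousOn
  obtain ⟨M₂, hM₂⟩ := hΩ.isCompact_closure.exists_bound_of_continuousOn
    (hf.continuousOn_fderivWithin hΩ.uniqueDiffOn le_rfl)
  obtain ⟨δ, hδ, hball⟩ := Metric.isOpen_iff.1 hΩ.isOpen x hx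
  have h1 : 0 ≤ M₁ := (norm_nonneg _).trans (hM₁ x (subset_closure hx))
  have h2 : 0 ≤ M₂ := (norm_nonneg _).trans (hM₂ x (subset_closure hx))
  have hd : ∀ y ∈ Ω, ‖fderiv ℝ f y‖ ≤ M₂ := fun y hy => by
    rw [← fderivWithin_closure_of_mem hΩ.isOpen f hy]; exact hM₂ y (subset_closure hy)
  refine ⟨M₁ + M₂ + 2 * M₁ / δ, by positivity, fun y hy => ⟨?_, ?_, ?_⟩⟩
  · exact (hM₁ y (subset_closure hy)).trans (by
      have : 0 ≤ 2 * M₁ / δ := by positivity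
      linarith)
  · exact (hd y hy).trans (by
      have : 0 ≤ 2 * M₁ / δ := by positivity
      linarith)
  -- As `Ω` need not be convex, the mean value inequality is used only in a ball around `x`; farther
  -- away, boundedness of `f` suffices.
  · rcases lt_or_ge ‖y - x‖ δ with h | h
    · have := (convex_ball x δ).norm_image_sub_le_of_norm_fderiv_le (𝕜 := ℝ) (f := f)
        (fun z hz => ((hf.mono subset_closure).contDiffAt
          (hΩ.isOpen.mem_nhds (hball hz))).differentiableAt one_ne_zero)
        (fun z hz => hd z (hball hz)) (Metric.mem_ball_self hδ)
        (by rwa [Metric.mem_ball, dist_eq_norm] : y ∈ Metric.ball x δ)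
      refine this.trans ?_
      gcongr
      have : 0 ≤ 2 * M₁ / δ := by positivity
      linarith
    · calc ‖f y - f x‖ ≤ M₁ + M₁ := (norm_sub_le _ _).trans
            (add_le_add (hM₁ y (subset_closure hy)) (hM₁ x (subset_closure hx)))
        _ = 2 * M₁ / δ * δ := by field_simp; ring
        _ ≤ (M₁ + M₂ + 2 * M₁ / δ) * ‖y - x‖ := by
          gcongr
          linarith

section conformal

variable {Ω : Set ℂ} {φ : ℂ → ℂ}

theorem IsConformalOntoDisc.contDiffOn_cderiv (hΩ : IsC21Domain Ω)
    (hφ : IsConformalOntoDisc Ω φ) : ContDiffOn ℝ 1 (cderiv Ω φ) (closure Ω) :=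
  (hφ.contDiffOn.fderivWithin hΩ.uniqueDiffOn (by norm_num)).clm_apply contDiffOn_const

theorem IsConformalOntoDisc.hasDerivAt_cderiv (hΩ : IsC21Domain Ω)
    (hφ : IsConformalOntoDisc Ω φ) {y : ℂ} (hy : y ∈ Ω) :
    HasDerivAt (cderiv Ω φ) (deriv (cderiv Ω φ) y) y := by
  have h1 : DifferentiableOn ℂ (deriv φ) Ω := hφ.holomorphic.deriv hΩ.isOpen
  have h2 : EqOn (cderiv Ω φ) (deriv φ) Ω := fun z hz => (hφ.hasDerivAt hΩ hz).deriv.symm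
  exact ((h1.congr h2).differentiableAt (hΩ.isOpen.mem_nhds hy)).hasDerivAt

theorem IsConformalOntoDisc.hasDerivAt_inv_sub (hΩ : IsC21Domain Ω)
    (hφ : IsConformalOntoDisc Ω φ) {x y : ℂ} (hx : x ∈ Ω) (hy : y ∈ Ω) (hyx : y ≠ x) :
    HasDerivAt (fun y => (φ y - φ x)⁻¹) (-cderiv Ω φ y * ((φ y - φ x)⁻¹) ^ 2) y := by
  have := ((hφ.hasDerivAt hΩ hy).sub_const (φ x)).fun_inv
    (hφ.sub_ne_zero hx (subset_closure hy) hyx)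
  refine this.congr_deriv ?_
  rw [div_eq_mul_inv, inv_pow]

theorem IsConformalOntoDisc.hasDerivAt_inv_one_sub (hΩ : IsC21Domain Ω)
    (hφ : IsConformalOntoDisc Ω φ) {x y : ℂ} (hx : x ∈ Ω) (hy : y ∈ Ω) :
    HasDerivAt (fun y => (1 - starRingEnd ℂ (φ x) * φ y)⁻¹)
      (starRingEnd ℂ (φ x) * cderiv Ω φ y * ((1 - starRingEnd ℂ (φ x) * φ y)⁻¹) ^ 2) y := by
  have := (((hφ.hasDerivAt hΩ hy).const_mul (starRingEnd ℂ (φ x))).const_sub 1).fun_inv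
    (hφ.one_sub_ne_zero hx (subset_closure hy))
  refine this.congr_deriv ?_
  rw [div_eq_mul_inv, inv_pow, neg_neg]

/-- Up to the factor `2π` and the real part, the function `(u(x) · ∇ₓ + u(y) · ∇_y) N(x, y)`, for
`P = φ'(x) u(x)` and `q = φ' u`. -/
def transportKernel (φ : ℂ → ℂ) (x P : ℂ) (q : ℂ → ℂ) (y : ℂ) : ℂ :=
  (q y - P) * (φ y - φ x)⁻¹ -
    (starRingEnd ℂ (φ x) * q y + starRingEnd ℂ P * φ y) * (1 - starRingEnd ℂ (φ x) * φ y)⁻¹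

/-- The two terms on the right are, up to `2π`, the derivative of `N` in `y` and that in `x`; the
minus sign is the one built into `discPoleKernel`. -/
theorem re_transportKernel (φ : ℂ → ℂ) (x P : ℂ) (q : ℂ → ℂ) (y : ℂ) :
    (transportKernel φ x P q y).re =
      (discKernel (φ x) (φ y) * q y).re - (P * discPoleKernel (φ x) (φ y)).re := by
  have e : (P * starRingEnd ℂ (φ y * (1 - starRingEnd ℂ (φ x) * φ y)⁻¹)).re =
      (starRingEnd ℂ P * φ y * (1 - starRingEnd ℂ (φ x) * φ y)⁻¹).re := by
    rw [← Complex.conj_re, map_mul, Complex.conj_conj, mul_assoc]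
  rw [discPoleKernel, mul_add, Complex.add_re, e, ← Complex.add_re, ← Complex.sub_re]
  congr 1
  rw [transportKernel, discKernel]
  ring

theorem IsConformalOntoDisc.hasFDerivAt_transportKernel (hΩ : IsC21Domain Ω)
    (hφ : IsConformalOntoDisc Ω φ) {x y P : ℂ} (hx : x ∈ Ω) (hy : y ∈ Ω) (hyx : y ≠ x)
    {q : ℂ → ℂ} (hq : DifferentiableAt ℝ q y) :
    ∃ L : ℂ →L[ℝ] ℂ, HasFDerivAt (transportKernel φ x P q) L y ∧ ∀ v : ℂ, L v =
      fderiv ℝ q y v * (φ y - φ x)⁻¹ - (q y - P) * (cderiv Ω φ y * v * ((φ y - φ x)⁻¹) ^ 2) -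
      (starRingEnd ℂ (φ x) * fderiv ℝ q y v + starRingEnd ℂ P * (cderiv Ω φ y * v)) *
        (1 - starRingEnd ℂ (φ x) * φ y)⁻¹ -
      (starRingEnd ℂ (φ x) * q y + starRingEnd ℂ P * φ y) * (starRingEnd ℂ (φ x) *
        (cderiv Ω φ y * v) * ((1 - starRingEnd ℂ (φ x) * φ y)⁻¹) ^ 2) := by
  have h1 := (hφ.hasDerivAt_inv_sub hΩ hx hy hyx).complexToReal_fderiv
  have h2 := (hφ.hasDerivAt_inv_one_sub hΩ hx hy).complexToReal_fderiv
  have h3 := hq.hasFDerivAt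
  have h4 := (hφ.hasDerivAt hΩ hy).complexToReal_fderiv
  refine ⟨_, ((h3.sub_const P).mul h1).sub (((h3.const_mul (starRingEnd ℂ (φ x))).add
    (h4.const_mul (starRingEnd ℂ P))).mul h2), fun v => ?_⟩
  simp only [_root_.smul_apply, _root_.add_apply, _root_.sub_apply, smul_eq_mul,
    one_apply_eq_self, Pi.add_apply]
  ring

theorem IsConformalOntoDisc.contDiffOn_transportKernel
    (hφ : IsConformalOntoDisc Ω φ) {x P : ℂ} (hx : x ∈ Ω) {q : ℂ → ℂ}
    (hq : ContDiffOn ℝ 1 q (closure Ω)) :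
    ContDiffOn ℝ 1 (transportKernel φ x P q) (Ω \ {x}) := by
  have h1 : ContDiffOn ℝ 1 φ (Ω \ {x}) :=
    (hφ.contDiffOn.mono (sdiff_subset.trans subset_closure)).of_le (by norm_num)
  have h2 : ContDiffOn ℝ 1 q (Ω \ {x}) := hq.mono (sdiff_subset.trans subset_closure)
  refine ((h2.sub contDiffOn_const).mul ((h1.sub contDiffOn_const).inv fun y hy =>
    hφ.sub_ne_zero hx (subset_closure hy.1) hy.2)).sub (ContDiffOn.mul ?_ ?_)
  · exact (contDiffOn_const.mul h2).add (contDiffOn_const.mul h1)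
  · exact (contDiffOn_const.sub (contDiffOn_const.mul h1)).inv fun y hy =>
      hφ.one_sub_ne_zero hx (subset_closure hy.1)

/-- The decisive cancellation. With `P = q x` the numerator `q y - P` vanishes at the pole at a
Lipschitz rate, which lowers the singularity by one order: the function is bounded and its gradient
is `O(‖y - x‖⁻¹)`. This is what integration by parts requires. -/
theorem IsConformalOntoDisc.exists_transportKernel_le (hΩ : IsC21Domain Ω)
    (hφ : IsConformalOntoDisc Ω φ) {x : ℂ} (hx : x ∈ Ω) {q : ℂ → ℂ}
    (hq : ContDiffOn ℝ 1 q (closure Ω)) : ∃ B : ℝ, 0 ≤ B ∧ ∀ y ∈ Ω \ {x},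
      ‖transportKernel φ x (q x) q y‖ ≤ B ∧
      ‖fderiv ℝ (transportKernel φ x (q x) q) y‖ ≤ B * ‖y - x‖⁻¹ := by
  obtain ⟨A, hA, hb⟩ := hφ.exists_cderiv_bounds hΩ
  obtain ⟨A', hA', hlow⟩ := hφ.exists_norm_sub_le hΩ
  obtain ⟨D, hD, hDb⟩ := exists_rpow_norm_sub_le hΩ.isBounded (by norm_num : (0 : ℝ) ≤ 1)
  obtain ⟨M, hM, hMb⟩ := exists_norm_sub_le_of_contDiffOn hΩ hq hx
  have hx1 := hφ.norm_lt_one hx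
  have h1x : 0 < 1 - ‖φ x‖ := by linarith
  set κ := (1 - ‖φ x‖)⁻¹ with hκ
  have hκ0 : 0 < κ := inv_pos.2 h1x
  set B₁ := M * A' + (M + M) * κ with hB₁
  set B₂ := M * A' + M * A * A' ^ 2 + ((M + M * A) * κ + (M + M) * (A * κ ^ 2)) * D with hB₂
  have hB₁0 : 0 ≤ B₁ := by positivity
  have hB₂0 : 0 ≤ B₂ := by positivity
  refine ⟨B₁ + B₂, by positivity, fun y hy => ?_⟩
  obtain ⟨m1, m2, m3⟩ := hMb y hy.1
  have mx := (hMb x hx).1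
  have h0 : 0 < ‖y - x‖ := norm_pos_iff.2 (_root_.sub_ne_zero.2 hy.2)
  have hφ0 : 0 < ‖φ y - φ x‖ := norm_pos_iff.2 (hφ.sub_ne_zero hx (subset_closure hy.1) hy.2)
  have hy1 := hφ.norm_lt_one hy.1
  have d4 : 1 ≤ D * ‖y - x‖⁻¹ := by
    simpa [Real.rpow_neg_one] using hDb x hx y hy.1 hy.2
  have e1 : ‖(φ y - φ x)⁻¹‖ ≤ A' * ‖y - x‖⁻¹ := by
    rw [norm_inv, ← div_eq_mul_inv, le_div_iff₀ h0, inv_mul_le_iff₀ hφ0, mul_comm]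
    exact hlow y hy.1 x hx
  have e2 : ‖(1 - starRingEnd ℂ (φ x) * φ y)⁻¹‖ ≤ κ := by
    rw [norm_inv]
    exact inv_anti₀ h1x (one_sub_norm_le_norm_one_sub_conj_mul hy1.le)
  have ec := (hb y (subset_closure hy.1)).1
  have n1 : ‖starRingEnd ℂ (φ x) * q y + starRingEnd ℂ (q x) * φ y‖ ≤ M + M := by
    refine (norm_add_le _ _).trans (add_le_add ?_ ?_)
    · rw [norm_mul, RCLike.norm_conj]
      nlinarith [norm_nonneg (φ x), norm_nonneg (q y)]
    · rw [norm_mul, RCLike.norm_conj]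
      nlinarith [norm_nonneg (φ y), norm_nonneg (q x)]
  constructor
  · refine le_trans ?_ (by linarith : B₁ ≤ B₁ + B₂)
    refine (norm_sub_le _ _).trans (add_le_add ?_ ?_)
    · rw [norm_mul]
      calc _ ≤ (M * ‖y - x‖) * (A' * ‖y - x‖⁻¹) := by gcongr
        _ = _ := by field_simp
    · rw [norm_mul]
      gcongr
  · have hqd : DifferentiableAt ℝ q y := ((hq.mono subset_closure).contDiffAt
      (hΩ.isOpen.mem_nhds hy.1)).differentiableAt one_ne_zero
    obtain ⟨L, hL, hLv⟩ := hφ.hasFDerivAt_transportKernel hΩ (P := q x) hx hy.1 hy.2 hqd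
    rw [hL.fderiv]
    refine ContinuousLinearMap.opNorm_le_bound _ (by positivity) fun v => ?_
    have hdv : ‖fderiv ℝ q y v‖ ≤ M * ‖v‖ :=
      (ContinuousLinearMap.le_opNorm _ _).trans (by gcongr)
    have hcv : ‖cderiv Ω φ y * v‖ ≤ A * ‖v‖ := by rw [norm_mul]; gcongr
    have t1 : ‖fderiv ℝ q y v * (φ y - φ x)⁻¹‖ ≤ (M * ‖v‖) * (A' * ‖y - x‖⁻¹) := by
      rw [norm_mul]; gcongr
    have t2 : ‖(q y - q x) * (cderiv Ω φ y * v * ((φ y - φ x)⁻¹) ^ 2)‖ ≤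
        (M * ‖y - x‖) * (A * ‖v‖ * (A' * ‖y - x‖⁻¹) ^ 2) := by
      rw [norm_mul, norm_mul (cderiv Ω φ y * v), norm_pow]; gcongr
    have t3 : ‖(starRingEnd ℂ (φ x) * fderiv ℝ q y v + starRingEnd ℂ (q x) *
        (cderiv Ω φ y * v)) * (1 - starRingEnd ℂ (φ x) * φ y)⁻¹‖ ≤
        (1 * (M * ‖v‖) + M * (A * ‖v‖)) * κ := by
      rw [norm_mul]
      gcongr
      refine (norm_add_le _ _).trans ?_
      rw [norm_mul, norm_mul (starRingEnd ℂ (q x)), RCLike.norm_conj, RCLike.norm_conj]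
      gcongr
    have t4 : ‖(starRingEnd ℂ (φ x) * q y + starRingEnd ℂ (q x) * φ y) * (starRingEnd ℂ (φ x) *
        (cderiv Ω φ y * v) * ((1 - starRingEnd ℂ (φ x) * φ y)⁻¹) ^ 2)‖ ≤
        (M + M) * (1 * (A * ‖v‖) * κ ^ 2) := by
      rw [norm_mul, norm_mul (starRingEnd ℂ (φ x) * _), norm_pow, norm_mul (starRingEnd ℂ (φ x)),
        RCLike.norm_conj]
      gcongr
    rw [hLv v]
    refine (norm_sub_le _ _).trans ((add_le_add ((norm_sub_le _ _).trans
      (add_le_add ((norm_sub_le _ _).trans (add_le_add t1 t2)) t3)) t4).trans ?_)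
    have hlast : ((1 * (M * ‖v‖) + M * (A * ‖v‖)) * κ) + (M + M) * (1 * (A * ‖v‖) * κ ^ 2) ≤
        (((1 * (M * ‖v‖) + M * (A * ‖v‖)) * κ) + (M + M) * (1 * (A * ‖v‖) * κ ^ 2)) *
          (D * ‖y - x‖⁻¹) := le_mul_of_one_le_right (by positivity) d4
    have hB : B₂ * ‖y - x‖⁻¹ * ‖v‖ ≤ (B₁ + B₂) * ‖y - x‖⁻¹ * ‖v‖ := by
      gcongr
      linarith
    refine le_trans ?_ hB
    rw [add_assoc]
    refine (add_le_add le_rfl hlast).trans (le_of_eq ?_)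
    rw [hB₂]
    field_simp

/-- The derivative of `∇_y N(x, y) · m` with respect to the pole `x`. -/
theorem IsConformalOntoDisc.fderiv_pole_fderiv_pullbackGreen (hΩ : IsC21Domain Ω)
    (hφ : IsConformalOntoDisc Ω φ) {x y : ℂ} (hx : x ∈ Ω) (hy : y ∈ Ω) (hyx : y ≠ x) (m v : ℂ) :
    fderiv ℝ (fun x' => fderiv ℝ (pullbackGreen φ x') y m) x v = (2 * Real.pi)⁻¹ *
      ((cderiv Ω φ x * v * ((φ y - φ x)⁻¹) ^ 2 - starRingEnd ℂ (cderiv Ω φ x * v) *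
        ((1 - starRingEnd ℂ (φ x) * φ y)⁻¹) ^ 2) * cderiv Ω φ y * m).re := by
  have hev : (fun x' => fderiv ℝ (pullbackGreen φ x') y m) =ᶠ[𝓝 x] fun x' =>
      (2 * Real.pi)⁻¹ * (discKernel (φ x') (φ y) * (cderiv Ω φ y * m)).re := by
    filter_upwards [hΩ.isOpen.mem_nhds hx, isOpen_ne.mem_nhds hyx.symm] with x' hx' hx'y
    rw [hφ.fderiv_pullbackGreen_apply hΩ hx' hy (Ne.symm hx'y), mul_assoc]
  have hd := (hφ.hasDerivAt hΩ hx)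
  have h1 : HasDerivAt (fun x' => (φ y - φ x')⁻¹) (cderiv Ω φ x * ((φ y - φ x)⁻¹) ^ 2) x := by
    have := (hd.const_sub (φ y)).fun_inv (hφ.sub_ne_zero hx (subset_closure hy) hyx)
    refine this.congr_deriv ?_
    rw [div_eq_mul_inv, inv_pow, neg_neg]
  have hE := hφ.one_sub_ne_zero hx (subset_closure hy)
  -- The reflected term depends on `x` only through `conj (φ x)`: it is differentiated
  -- holomorphically in that variable, then composed with the real linear conjugation.
  have h2 : HasDerivAt (fun β : ℂ => β * (1 - β * φ y)⁻¹)
      (((1 - starRingEnd ℂ (φ x) * φ y)⁻¹) ^ 2) (starRingEnd ℂ (φ x)) := by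
    have := (hasDerivAt_id (starRingEnd ℂ (φ x))).fun_mul
      ((((hasDerivAt_id (starRingEnd ℂ (φ x))).mul_const (φ y)).const_sub 1).fun_inv hE)
    refine this.congr_deriv ?_
    simp only [id]
    field_simp
    ring
  have h3 : HasFDerivAt (fun x' => starRingEnd ℂ (φ x'))
      ((Complex.conjCLE : ℂ →L[ℝ] ℂ).comp (cderiv Ω φ x • (1 : ℂ →L[ℝ] ℂ))) x :=
    (Complex.conjCLE : ℂ →L[ℝ] ℂ).hasFDerivAt.comp x hd.complexToReal_fderiv
  have h4 := h2.complexToReal_fderiv.comp x h3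
  have h5 := ((Complex.reCLM.hasFDerivAt.comp x
    ((h1.complexToReal_fderiv.sub h4).mul_const (cderiv Ω φ y * m))).const_mul (2 * Real.pi)⁻¹)
  rw [hev.fderiv_eq]
  have h6 : HasFDerivAt (fun x' => (2 * Real.pi)⁻¹ *
      (discKernel (φ x') (φ y) * (cderiv Ω φ y * m)).re) _ x := h5
  rw [h6.fderiv]
  simp only [_root_.smul_apply, ContinuousLinearMap.comp_apply, _root_.sub_apply, smul_eq_mul,
    one_apply_eq_self, Complex.reCLM_apply, ContinuousLinearEquiv.coe_coe, Complex.conjCLE_apply]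
  congr 2
  ring

/-- The second derivatives of `N(x, y)` in `y`. -/
theorem IsConformalOntoDisc.fderiv_fderiv_pullbackGreen (hΩ : IsC21Domain Ω)
    (hφ : IsConformalOntoDisc Ω φ) {x y : ℂ} (hx : x ∈ Ω) (hy : y ∈ Ω) (hyx : y ≠ x) (m v : ℂ) :
    fderiv ℝ (fun y' => fderiv ℝ (pullbackGreen φ x) y' m) y v = (2 * Real.pi)⁻¹ *
      (((-cderiv Ω φ y * ((φ y - φ x)⁻¹) ^ 2 - starRingEnd ℂ (φ x) * (starRingEnd ℂ (φ x) *
        cderiv Ω φ y * ((1 - starRingEnd ℂ (φ x) * φ y)⁻¹) ^ 2)) * cderiv Ω φ y +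
        discKernel (φ x) (φ y) * deriv (cderiv Ω φ) y) * v * m).re := by
  have hev : (fun y' => fderiv ℝ (pullbackGreen φ x) y' m) =ᶠ[𝓝 y] fun y' =>
      (2 * Real.pi)⁻¹ * (discKernel (φ x) (φ y') * cderiv Ω φ y' * m).re := by
    filter_upwards [hΩ.isOpen.mem_nhds hy, isOpen_ne.mem_nhds hyx] with y' hy' hy'x
    rw [hφ.fderiv_pullbackGreen_apply hΩ hx hy' hy'x]
  have h1 := ((hφ.hasDerivAt_inv_sub hΩ hx hy hyx).fun_sub
    ((hφ.hasDerivAt_inv_one_sub hΩ hx hy).const_mul (starRingEnd ℂ (φ x)))).fun_mul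
    (hφ.hasDerivAt_cderiv hΩ hy)
  have h2 := (Complex.reCLM.hasFDerivAt.comp y
    ((h1.mul_const m).complexToReal_fderiv)).const_mul (2 * Real.pi)⁻¹
  rw [hev.fderiv_eq]
  have h3 : HasFDerivAt (fun y' => (2 * Real.pi)⁻¹ *
      (discKernel (φ x) (φ y') * cderiv Ω φ y' * m).re) _ y := h2
  rw [h3.fderiv]
  simp only [_root_.smul_apply, ContinuousLinearMap.comp_apply, smul_eq_mul,
    one_apply_eq_self, Complex.reCLM_apply]
  congr 2
  rw [discKernel]
  ring

/-- The product rule `∇_y ((u(x) · ∇ₓ + u(y) · ∇_y) N) · m`. -/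
theorem IsConformalOntoDisc.fderiv_re_transportKernel (hΩ : IsC21Domain Ω)
    (hφ : IsConformalOntoDisc Ω φ) {x y : ℂ} (hx : x ∈ Ω) (hy : y ∈ Ω) (hyx : y ≠ x)
    {u : ℂ → ℂ} (hu : DifferentiableAt ℝ u y) (m : ℂ) :
    fderiv ℝ (fun y => (2 * Real.pi)⁻¹ * (transportKernel φ x (cderiv Ω φ x * u x)
        (fun y => cderiv Ω φ y * u y) y).re) y m =
      fderiv ℝ (fun x' => fderiv ℝ (pullbackGreen φ x') y m) x (u x) +
        fderiv ℝ (fun y' => fderiv ℝ (pullbackGreen φ x) y' m) y (u y) +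
        fderiv ℝ (pullbackGreen φ x) y (fderiv ℝ u y m) := by
  have hq := (hφ.hasDerivAt_cderiv hΩ hy).complexToReal_fderiv.mul hu.hasFDerivAt
  have hqe : fderiv ℝ (fun y => cderiv Ω φ y * u y) y m =
      cderiv Ω φ y * fderiv ℝ u y m + u y * (deriv (cderiv Ω φ) y * m) := by
    have : HasFDerivAt (fun y => cderiv Ω φ y * u y) _ y := hq
    rw [this.fderiv]
    simp
  have hqd : DifferentiableAt ℝ (fun y => cderiv Ω φ y * u y) y := hq.differentiableAt
  obtain ⟨L, hL, hLv⟩ := hφ.hasFDerivAt_transportKernel hΩ (P := cderiv Ω φ x * u x) hx hy hyx hqd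
  have h1 : HasFDerivAt (fun y => (2 * Real.pi)⁻¹ * (transportKernel φ x (cderiv Ω φ x * u x)
      (fun y => cderiv Ω φ y * u y) y).re) ((2 * Real.pi)⁻¹ • Complex.reCLM.comp L) y :=
    (Complex.reCLM.hasFDerivAt.comp y hL).const_mul _
  rw [h1.fderiv, hφ.fderiv_pole_fderiv_pullbackGreen hΩ hx hy hyx,
    hφ.fderiv_fderiv_pullbackGreen hΩ hx hy hyx, hφ.fderiv_pullbackGreen_apply hΩ hx hy hyx,
    ← mul_add, ← mul_add, ← Complex.add_re, ← Complex.add_re, _root_.smul_apply,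
    ContinuousLinearMap.comp_apply, Complex.reCLM_apply, smul_eq_mul, hLv, hqe]
  congr 2
  -- The product rule yields two terms in `conj P`, while the mixed derivative of `N` has a single
  -- one over the squared denominator; this identity merges them.
  have hE : (1 - starRingEnd ℂ (φ x) * φ y)⁻¹ * (1 - starRingEnd ℂ (φ x) * φ y) = 1 :=
    inv_mul_cancel₀ (hφ.one_sub_ne_zero hx (subset_closure hy))
  rw [discKernel]
  linear_combination (starRingEnd ℂ (cderiv Ω φ x * u x) * cderiv Ω φ y * m *
    (1 - starRingEnd ℂ (φ x) * φ y)⁻¹) * hE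

end conformal

/-! ### Transport of `F₀` by the flow, and `F₁`. -/

section conformal

variable {Ω : Set ℂ} {φ : ℂ → ℂ}

/-- The spatial derivative of `F₀` and its relation to `F₁`. -/
theorem IsConformalOntoDisc.F0_transport (hΩ : IsC21Domain Ω) (hφ : IsConformalOntoDisc Ω φ)
    {n : ℂ → ℂ} (hn : ∀ p ∈ frontier Ω, IsOuterUnitNormal Ω p (n p)) {q : ℝ≥0∞} (hq : 2 < q)
    {ρ g : ℂ → ℝ} {u : ℂ → ℂ} (hρ : ContinuousOn ρ (closure Ω))
    (hu : ContDiffOn ℝ 1 u (closure Ω)) (hg : MemLp g q (volume.restrict Ω))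
    (hdiv : HasDivIn Ω (fun y => ρ y • u y) (fun y => -g y))
    (hun : ∀ p ∈ frontier Ω, inner ℝ (u p) (n p) = 0) {x : ℂ} (hx : x ∈ Ω) :
    IntegrableOn (kernel1 φ ρ u x) Ω ∧ DifferentiableAt ℝ (F0 Ω φ ρ u) x ∧
      fderiv ℝ (F0 Ω φ ρ u) x (u x) + (∫ y in Ω, fderiv ℝ (pullbackGreen φ x) y (g y • u y)) =
        F1 Ω φ ρ u x + ∫ y in Ω, fderiv ℝ (pullbackGreen φ x) y (ρ y • dirDeriv Ω u y (u y)) := by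
  have hm : ContinuousOn (fun y => ρ y • u y) (closure Ω) := hρ.smul hu.continuousOn
  have hmn : ∀ p ∈ frontier Ω, inner ℝ (ρ p • u p) (n p) = 0 := fun p hp => by
    rw [inner_smul_left, hun p hp, mul_zero]
  have : IsFiniteMeasure (volume.restrict Ω) :=
    ⟨by rw [Measure.restrict_apply_univ]; exact hΩ.isBounded.measure_lt_top⟩
  have hgi : IntegrableOn (fun y => -g y) Ω :=
    (hg.integrable ((by norm_num : (1 : ℝ≥0∞) ≤ 2).trans hq.le)).neg
  -- First use of the continuity equation, tested with `N(x', ·)`; here `g` plays the role of `ρ_t`.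
  -- It trades `∇N` for `N`, so a single derivative in `x` falls on a logarithm and an `L^q` density
  -- suffices.
  have hF0 : ∀ x' ∈ Ω, F0 Ω φ ρ u x' = ∫ y in Ω, g y * pullbackGreen φ x' y := by
    intro x' hx'
    obtain ⟨B₁, hB₁, hb₁⟩ := hφ.exists_abs_pullbackGreen_le hΩ hx'
    obtain ⟨B₂, hB₂, hb₂⟩ := hφ.exists_norm_fderiv_pullbackGreen_le hΩ hx'
    have hi := hφ.integrableOn_mul_pullbackGreen hΩ hx' hq hg
    have h := (hφ.integral_mul_eq hΩ hn hm hmn hdiv hgi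
      (hφ.contDiffOn_pullbackGreen hx') (x := x') (B := max B₁ B₂)
      (fun y hy => (hb₁ y hy).trans (by gcongr; exact le_max_left _ _))
      (fun y hy => (hb₂ y hy).trans (by gcongr; exact le_max_right _ _))
      (by simpa using hi.neg)).2
    simp only [neg_mul, integral_neg] at h
    rw [F0]
    exact (neg_injective h).symm
  obtain ⟨hpole, hFd⟩ := hφ.hasFDerivAt_integral_pullbackGreen hΩ hx hq hg
  have hF0d := hFd.congr_of_eventuallyEq (f₁ := F0 Ω φ ρ u)
    (by filter_upwards [hΩ.isOpen.mem_nhds hx] with x' hx' using hF0 x' hx')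
  set Q : ℂ → ℂ := fun y => cderiv Ω φ y * u y with hQ
  have hQc : ContDiffOn ℝ 1 Q (closure Ω) := (hφ.contDiffOn_cderiv hΩ).mul hu
  obtain ⟨B, hB, hBb⟩ := hφ.exists_transportKernel_le hΩ hx hQc
  obtain ⟨D, hD, hDb⟩ := exists_rpow_norm_sub_le hΩ.isBounded (by norm_num : (0 : ℝ) ≤ 1 / 2)
  -- `Φ` is `(u(x)·∇ₓ + u(y)·∇_y) N(x, y)`.
  set Φ : ℂ → ℝ := fun y => (2 * Real.pi)⁻¹ * (transportKernel φ x (Q x) Q y).re with hΦ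
  have hW := hφ.contDiffOn_transportKernel hx (P := Q x) hQc
  have hΦc : ContDiffOn ℝ 1 Φ (Ω \ {x}) :=
    contDiffOn_const.mul (Complex.reCLM.contDiff.comp_contDiffOn hW)
  have hopen : IsOpen (Ω \ {x}) := hΩ.isOpen.sdiff isClosed_singleton
  have hπ : (2 * Real.pi)⁻¹ ≤ 1 := inv_le_one_of_one_le₀ (by linarith [Real.two_le_pi])
  have hΦ0 : ∀ y ∈ Ω \ {x}, |Φ y| ≤ B := fun y hy => by
    rw [hΦ]
    simp only
    rw [abs_mul, abs_of_nonneg (by positivity : (0 : ℝ) ≤ (2 * Real.pi)⁻¹)]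
    calc _ ≤ 1 * ‖transportKernel φ x (Q x) Q y‖ := by
          gcongr
          exact Complex.abs_re_le_norm _
      _ ≤ B := by rw [one_mul]; exact (hBb y hy).1
  have hΦ1 : ∀ y ∈ Ω \ {x}, |Φ y| ≤ (B * D + B) * ‖y - x‖ ^ (-(1 / 2) : ℝ) := fun y hy => by
    have h1 : 1 ≤ D * ‖y - x‖ ^ (-(1 / 2) : ℝ) := by simpa using hDb x hx y hy.1 hy.2
    have h2 : 0 ≤ ‖y - x‖ ^ (-(1 / 2) : ℝ) := by positivity
    have h3 := hΦ0 y hy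
    nlinarith [mul_nonneg hB h2]
  have hΦ2 : ∀ y ∈ Ω \ {x}, ‖fderiv ℝ Φ y‖ ≤ (B * D + B) * ‖y - x‖⁻¹ := fun y hy => by
    have hd := ((hW.contDiffAt (hopen.mem_nhds hy)).differentiableAt one_ne_zero).hasFDerivAt
    have h1 : HasFDerivAt Φ ((2 * Real.pi)⁻¹ • Complex.reCLM.comp
        (fderiv ℝ (transportKernel φ x (Q x) Q) y)) y :=
      (Complex.reCLM.hasFDerivAt.comp y hd).const_mul _
    rw [h1.fderiv]
    refine ContinuousLinearMap.opNorm_le_bound _ (by positivity) fun v => ?_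
    rw [_root_.smul_apply, norm_smul, ContinuousLinearMap.comp_apply,
      Real.norm_of_nonneg (by positivity : (0 : ℝ) ≤ (2 * Real.pi)⁻¹)]
    calc _ ≤ 1 * (‖fderiv ℝ (transportKernel φ x (Q x) Q) y‖ * ‖v‖) := by
          gcongr
          exact (Complex.abs_re_le_norm _).trans (ContinuousLinearMap.le_opNorm _ _)
      _ ≤ ((B * D + B) * ‖y - x‖⁻¹) * ‖v‖ := by
          rw [one_mul]
          gcongr
          refine (hBb y hy).2.trans ?_
          gcongr
          nlinarith [mul_nonneg hB hD.le]
  have hNu : IntegrableOn (fun y => fderiv ℝ (pullbackGreen φ x) y (g y • u y)) Ω := by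
    obtain ⟨C, hC, h⟩ := hφ.exists_integral_fderiv_pullbackGreen_le hΩ hx hq
    obtain ⟨M, hM⟩ := hΩ.isCompact_closure.exists_bound_of_continuousOn hu.continuousOn
    refine (h _ ((hg.const_mul M).mono (hg.1.smul
      (integrableOn_of_continuousOn_closure hΩ hu.continuousOn).1) ?_)).1
    filter_upwards [ae_restrict_mem hΩ.isOpen.measurableSet] with y hy
    rw [Pi.smul_apply', norm_smul, norm_mul, mul_comm]
    gcongr
    exact (hM y (subset_closure hy)).trans (le_abs_self _)
  have hpi : IntegrableOn (fun y => (2 * Real.pi)⁻¹ *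
      (RCLike.re (Q x * ((g y : ℂ) * discPoleKernel (φ x) (φ y))) : ℝ)) Ω :=
    ((hpole.const_mul (Q x)).re).const_mul _
  have hae : (fun y => g y * Φ y) =ᵐ[volume.restrict Ω] fun y =>
      fderiv ℝ (pullbackGreen φ x) y (g y • u y) - (2 * Real.pi)⁻¹ *
        (RCLike.re (Q x * ((g y : ℂ) * discPoleKernel (φ x) (φ y))) : ℝ) := by
    filter_upwards [ae_mem_diff_singleton hΩ.isOpen x] with y hy
    rw [map_smul, hφ.fderiv_pullbackGreen_apply hΩ hx hy.1 hy.2, hΦ]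
    simp only [RCLike.re_to_complex]
    rw [re_transportKernel, mul_left_comm (Q x), Complex.re_ofReal_mul, smul_eq_mul, hQ]
    simp only [mul_assoc]
    ring
  have hgΦ : IntegrableOn (fun y => g y * Φ y) Ω := (hNu.sub hpi).congr hae.symm
  have hfd : fderiv ℝ (F0 Ω φ ρ u) x (u x) = -∫ y in Ω, (2 * Real.pi)⁻¹ *
      (RCLike.re (Q x * ((g y : ℂ) * discPoleKernel (φ x) (φ y))) : ℝ) := by
    rw [hF0d.fderiv, integral_const_mul, integral_re (hpole.const_mul (Q x)), integral_const_mul,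
      reMul_apply, RCLike.re_to_complex, ← Complex.re_ofReal_mul, ← Complex.neg_re]
    congr 1
    rw [hQ]
    push_cast
    ring
  have hsum : fderiv ℝ (F0 Ω φ ρ u) x (u x) +
      (∫ y in Ω, fderiv ℝ (pullbackGreen φ x) y (g y • u y)) = ∫ y in Ω, g y * Φ y := by
    rw [integral_congr_ae hae, integral_sub hNu hpi, hfd]
    ring
  -- Second use of the continuity equation, tested with `Φ`. The derivative of `Φ` along `ρu` is the
  -- integrand of `F₁` plus `∇N` applied to the derivative of `u` along `ρu`.
  obtain ⟨hib, hibp⟩ := hφ.integral_mul_eq hΩ hn hm hmn hdiv hgi hΦc hΦ1 hΦ2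
    (by simpa using hgΦ.neg)
  simp only [neg_mul, integral_neg] at hibp
  have hDu : ContinuousOn (fun y => ρ y • dirDeriv Ω u y (u y)) (closure Ω) :=
    hρ.smul ((hu.continuousOn_fderivWithin hΩ.uniqueDiffOn le_rfl).clm_apply hu.continuousOn)
  have hDui := hφ.integrableOn_fderiv_pullbackGreen hΩ hx hDu
  have hk1 : kernel1 φ ρ u x =ᵐ[volume.restrict Ω] fun y => fderiv ℝ Φ y (ρ y • u y) -
      fderiv ℝ (pullbackGreen φ x) y (ρ y • dirDeriv Ω u y (u y)) := by
    filter_upwards [ae_mem_diff_singleton hΩ.isOpen x] with y hy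
    have hud : DifferentiableAt ℝ u y := ((hu.mono subset_closure).contDiffAt
      (hΩ.isOpen.mem_nhds hy.1)).differentiableAt one_ne_zero
    rw [hΦ, hφ.fderiv_re_transportKernel hΩ hx hy.1 hy.2 hud, dirDeriv,
      fderivWithin_closure_of_mem hΩ.isOpen u hy.1, map_smul (fderiv ℝ u y), add_sub_cancel_right,
      kernel1]
  refine ⟨(hib.sub hDui).congr hk1.symm, hF0d.differentiableAt, ?_⟩
  rw [hsum, neg_injective hibp, F1, integral_congr_ae hk1, integral_sub hib hDui, sub_add_cancel]

end conformal

end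

end MHD

/-! ### Assembly of the two formulas. -/

theorem lemma3p7
    (Ω : Set ℂ) (hΩ : MHD.IsC21Domain Ω)
    (n : ℂ → ℂ) (hn : ∀ p ∈ frontier Ω, MHD.IsOuterUnitNormal Ω p (n p))
    (φ : ℂ → ℂ) (hφ : MHD.IsConformalOntoDisc Ω φ)
    (T t : ℝ) (ht : t ∈ Ioo 0 T) (q : ℝ≥0∞) (hq : 2 < q)
    (ρ : ℝ → ℂ → ℝ) (u H : ℝ → ℂ → ℂ) (ρt : ℂ → ℝ) (ut : ℂ → ℂ)
    (hρ : ContinuousOn (Function.uncurry ρ) (Icc 0 T ×ˢ closure Ω))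
    (hu : ContinuousOn (Function.uncurry u) (Icc 0 T ×ˢ closure Ω))
    (hρt : MHD.HasTimeDerivAt Ω q ρ ρt t)
    (hut : MHD.HasTimeDerivAt Ω q u ut t)
    (hutc : ContinuousOn ut (closure Ω))
    (hu1 : ContDiffOn ℝ 1 (u t) (closure Ω))
    (hH1 : ContDiffOn ℝ 1 (H t) (closure Ω))
    (F : ℂ → ℝ)
    (hF : MHD.SolvesNeumann Ω n (MHD.force Ω (ρ t) (u t) ut (H t)) F) :
    (∀ x ∈ Ω,
      IntegrableOn (fun y => fderiv ℝ (MHD.pullbackGreen φ x) y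
        (MHD.force Ω (ρ t) (u t) ut (H t) y)) Ω ∧
      IntegrableOn (MHD.kernel3 Ω n φ F x) (frontier Ω) (Measure.hausdorffMeasure 1) ∧
      F x = -(∫ y in Ω, fderiv ℝ (MHD.pullbackGreen φ x) y
          (MHD.force Ω (ρ t) (u t) ut (H t) y))
        + ∫ y in frontier Ω, MHD.dirDeriv Ω (MHD.pullbackGreen φ x) y (n y) * F y
            ∂(Measure.hausdorffMeasure 1)) ∧
    (MHD.HasDivIn Ω (fun y => ρ t y • u t y) (fun y => -ρt y) →
      (∀ y ∈ frontier Ω, inner ℝ (u t y) (n y) = 0) →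
      ∀ x ∈ Ω,
        (∀ s ∈ Icc 0 T, IntegrableOn (MHD.kernel0 φ (ρ s) (u s) x) Ω) ∧
        IntegrableOn (MHD.kernel1 φ (ρ t) (u t) x) Ω ∧
        IntegrableOn (MHD.kernel2 Ω φ (H t) x) Ω ∧
        DifferentiableAt ℝ (fun s => MHD.F0 Ω φ (ρ s) (u s) x) t ∧
        DifferentiableAt ℝ (MHD.F0 Ω φ (ρ t) (u t)) x ∧
        F x = -MHD.materialDeriv u (fun s => MHD.F0 Ω φ (ρ s) (u s)) t x
          + MHD.F1 Ω φ (ρ t) (u t) x + MHD.F2 Ω φ (H t) x + MHD.F3 Ω n φ F x) := by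
  have htI : t ∈ Icc 0 T := Ioo_subset_Icc_self ht
  have hρs : ∀ s ∈ Icc 0 T, ContinuousOn (ρ s) (closure Ω) := fun s hs =>
    hρ.comp (by fun_prop : ContinuousOn (fun y => (s, y)) (closure Ω)) fun y hy => ⟨hs, hy⟩
  have hus : ∀ s ∈ Icc 0 T, ContinuousOn (u s) (closure Ω) := fun s hs =>
    hu.comp (by fun_prop : ContinuousOn (fun y => (s, y)) (closure Ω)) fun y hy => ⟨hs, hy⟩
  obtain ⟨hc1, hc2, hc3⟩ := MHD.continuousOn_force hΩ (hρs t htI) hutc hu1 hH1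
  refine ⟨fun x hx => ?_, fun hdiv hun x hx => ?_⟩
  · obtain ⟨h1, h2⟩ := hF.representation hΩ hφ hn hc3 hx
    exact ⟨hφ.integrableOn_fderiv_pullbackGreen hΩ hx hc3, h1, h2⟩
  · obtain ⟨-, hrep⟩ := hF.representation hΩ hφ hn hc3 hx
    obtain ⟨hk1, hd, htr⟩ := hφ.F0_transport hΩ hn hq (hρs t htI) hu1 hρt.1 hdiv hun hx
    have htd := hφ.hasDerivAt_F0 hΩ hx ht hq hρ hu hρt hut
    have hadv := hφ.integrableOn_fderiv_pullbackGreen hΩ hx hc2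
    refine ⟨fun s hs => hφ.integrableOn_fderiv_pullbackGreen hΩ hx ((hρs s hs).smul (hus s hs)),
      hk1, hadv, htd.differentiableAt, hd, ?_⟩
    have i1 : IntegrableOn (fun y => fderiv ℝ (MHD.pullbackGreen φ x) y (ρ t y • ut y)) Ω :=
      hφ.integrableOn_fderiv_pullbackGreen hΩ hx ((hρs t htI).smul hutc)
    have hDu : ContinuousOn (fun y => MHD.dirDeriv Ω (u t) y (u t y)) (closure Ω) :=
      (hu1.continuousOn_fderivWithin hΩ.uniqueDiffOn le_rfl).clm_apply hu1.continuousOn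
    have i2 : IntegrableOn (fun y => fderiv ℝ (MHD.pullbackGreen φ x) y
        (ρ t y • MHD.dirDeriv Ω (u t) y (u t y))) Ω :=
      hφ.integrableOn_fderiv_pullbackGreen hΩ hx ((hρs t htI).smul hDu)
    -- `ρt` is not assumed continuous; integrability comes from the product rule, which puts the sum
    -- with `ρ u_t` in `L^q`, by subtracting the continuous part.
    have i3 : IntegrableOn (fun y => fderiv ℝ (MHD.pullbackGreen φ x) y (ρt y • u t y)) Ω := by
      obtain ⟨C, hC, h⟩ := hφ.exists_integral_fderiv_pullbackGreen_le hΩ hx hq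
      have h4 := (h _ (MHD.HasTimeDerivAt.smul hΩ ht
        ((by norm_num : (1 : ℝ≥0∞) ≤ 2).trans hq.le) hρ hu hρt hut).1).1
      refine (h4.sub i1).congr (ae_of_all _ fun y => ?_)
      simp only [Pi.sub_apply, map_add, add_sub_cancel_right]
    have e1 : ∫ y in Ω, fderiv ℝ (MHD.pullbackGreen φ x) y (ρt y • u t y + ρ t y • ut y) =
        (∫ y in Ω, fderiv ℝ (MHD.pullbackGreen φ x) y (ρt y • u t y)) +
          ∫ y in Ω, fderiv ℝ (MHD.pullbackGreen φ x) y (ρ t y • ut y) := by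
      simp only [map_add]
      exact integral_add i3 i1
    have e2 : ∫ y in Ω, fderiv ℝ (MHD.pullbackGreen φ x) y
          (MHD.force Ω (ρ t) (u t) ut (H t) y) =
        (∫ y in Ω, fderiv ℝ (MHD.pullbackGreen φ x) y (ρ t y • ut y)) +
          (∫ y in Ω, fderiv ℝ (MHD.pullbackGreen φ x) y
            (ρ t y • MHD.dirDeriv Ω (u t) y (u t y))) - MHD.F2 Ω φ (H t) x := by
      simp only [MHD.force, MHD.uDot, smul_add, map_add, map_sub]
      have i12 : IntegrableOn (fun y => fderiv ℝ (MHD.pullbackGreen φ x) y (ρ t y • ut y) +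
          fderiv ℝ (MHD.pullbackGreen φ x) y (ρ t y • MHD.dirDeriv Ω (u t) y (u t y))) Ω :=
        i1.add i2
      rw [MHD.F2, ← integral_add i1 i2]
      exact integral_sub i12 hadv
    -- What remains is linear in the integrals: `htr` exchanges `u·∇F₀` plus the `ρ_t` integral for
    -- `F₁` plus the `ρ(u·∇)u` integral, and the `ρ u_t` integrals cancel.
    rw [hrep, MHD.materialDeriv, htd.deriv, e1, e2]
    linarith
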